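/- Let $T>0$ and $\Omega=[0,1]\times[0,T]$. A function $f$ on $\Omega$ is called completely continuous if it is absolutely continuous in the sense of Carathéodory, i.e. $f(x,t)=f(0,0)+\int_0^x a+\int_0^t b+\int_0^x\!\int_0^t h$ with integrable $a,b,h$. Let $W(\Omega)$ be the space of functions $u$ on $\Omega$ for which $\partial_x^2\partial_t^2u$ exists and is completely continuous, $\partial_x^3\partial_t^3u\in L^2(\Omega)$, $u(x,0)=\partial_tu(x,0)=u(0,t)=u(1,t)=0$, and all terms of the following inner product are finite: $$\langle u,g\rangle_W=\sum_{i=0}^2\int_0^T\partial_t^3\partial_x^iu(0,t)\,\partial_t^3\partial_x^ig(0,t)\,dt+\sum_{j=0}^2\big\langle\partial_t^ju(\cdot,0),\partial_t^jg(\cdot,0)\big\rangle_{W_2^3}+\int_0^1\!\!\int_0^T\partial_x^3\partial_t^3u\,\partial_x^3\partial_t^3g\,dt\,dx,$$ where $\langle v,w\rangle_{W_2^3}=v(0)w(0)+v'(0)w'(0)+v'(1)w'(1)+\int_0^1v'''w'''\,dx$. Let $\widehat W(\Omega)$ be the space of completely continuous functions $f$ on $\Omega$ with $\partial_x\partial_tf\in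 L^2(\Omega)$, $\partial_t f(0,\cdot)\in L^2[0,T]$, $\partial_xf(\cdot,0)\in L^2[0,1]$, with inner product $$\langle f,g\rangle_{\widehat W}=\int_0^T\partial_tf(0,t)\,\partial_tg(0,t)\,dt+f(0,0)g(0,0)+\int_0^1\partial_xf(x,0)\,\partial_xg(x,0)\,dx+\int_0^1\!\!\int_0^T\partial_x\partial_tf\,\partial_x\partial_tg\,dt\,dx$$ and reproducing kernel $G_{(y,s)}(x,t)=(1+\min(x,y))(1+\min(t,s))$. Let $L:W(\Omega)\to\widehat W(\Omega)$, $Lv=\partial_t^2v-\partial_x^2v$, with adjoint $L^*$. Let $M:\Omega\times\mathbb R\to\mathbb R$ be continuous, and consider the homogenized sine-Gordon problem $$Lv(x,t)=M(x,t,v(x,t))\quad\text{on }\Omega,\qquad v(x,0)=\partial_tv(x,0)=v(0,t)=v(1,t)=0.\tag{1}$$ Let $(x_1,t_1),(x_2,t_2),\dots$ be distinct points of $\Omega$ that are dense in $\Omega$. Put $\varphi_i=G_{(x_i,t_i)}$ and $\Psi_i=L^*\varphi_i$, let $(\widehat\Psi_i)$ be obtained from $(\Psi_i)$ by Gram–Schmidt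 orthonormalization in $W(\Omega)$ (with $\widehat\Psi_i=0$ if $\Psi_i$ lies in the span of its predecessors), and let $\beta_{ik}$ be coefficients with $\widehat\Psi_i=\sum_{k=1}^i\beta_{ik}\Psi_k$. Put $u_0=0$ and $$u_n=\sum_{i=1}^nB_i\widehat\Psi_i,\qquad B_i=\sum_{k=1}^i\beta_{ik}\,M\big(x_k,t_k,u_{k-1}(x_k,t_k)\big).$$ Suppose that (1) has a unique solution $u$ in $W(\Omega)$. Then $L$ maps $W(\Omega)$ into $\widehat W(\Omega)$ and all the objects above exist. If moreover the norms $\|u_n\|_W$ are bounded, then $u_n\to u$ in $W(\Omega)$ and uniformly on $\Omega$, and $$u=\sum_{i=1}^\infty B_i\widehat\Psi_i,$$ where the series converges (unconditionally) in $W(\Omega)$ and at each point of $\Omega$. -/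

import Mathlib

open Set Filter Topology MeasureTheory

namespace SineGordon

noncomputable section

/-- The rectangle `Ω = [0,1] × [0,T]`. Functions on `Ω` are written as functions
`u : ℝ → ℝ → ℝ`, `u x t`, of which only the values on `Ω` matter. -/
def Omega (T : ℝ) : Set (ℝ × ℝ) := Icc 0 1 ×ˢ Icc 0 T

/-- `∂u/∂x` on `[0,1]` (one-sided at the end points). -/
def dx (u : ℝ → ℝ → ℝ) : ℝ → ℝ → ℝ :=
  fun x t => derivWithin (fun y => u y t) (Icc 0 1) x

/-- `∂u/∂t` on `[0,T]` (one-sided at the end points). -/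
def dt (T : ℝ) (u : ℝ → ℝ → ℝ) : ℝ → ℝ → ℝ :=
  fun x t => derivWithin (fun s => u x s) (Icc 0 T) t

/-- `∂^{i+j} u / ∂x^i ∂t^j`. -/
def D (T : ℝ) (i j : ℕ) (u : ℝ → ℝ → ℝ) : ℝ → ℝ → ℝ := dx^[i] ((dt T)^[j] u)

/-- Complete (= absolute) continuity on the rectangle, in the sense of Carathéodory:
`f(x,t) = f(0,0) + ∫₀ˣ a + ∫₀ᵗ b + ∫₀ˣ∫₀ᵗ h` with integrable `a`, `b`, `h`. For such `f`,
almost everywhere `a = ∂f/∂x(·,0)`, `b = ∂f/∂t(0,·)` and `h = ∂²f/∂x∂t`. -/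
def CompletelyContinuous (T : ℝ) (f : ℝ → ℝ → ℝ) : Prop :=
  ∃ (a b : ℝ → ℝ) (h : ℝ → ℝ → ℝ),
    IntegrableOn a (Icc 0 1) ∧ IntegrableOn b (Icc 0 T) ∧
    IntegrableOn (fun q : ℝ × ℝ => h q.1 q.2) (Omega T) ∧
    ∀ x ∈ Icc (0 : ℝ) 1, ∀ t ∈ Icc (0 : ℝ) T,
      f x t = f 0 0 + (∫ ξ in (0 : ℝ)..x, a ξ) + (∫ τ in (0 : ℝ)..t, b τ)
        + ∫ ξ in (0 : ℝ)..x, ∫ τ in (0 : ℝ)..t, h ξ τ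

/-- The inner product of `W₂³[0,1]`. -/
def inner3 (v w : ℝ → ℝ) : ℝ :=
  v 0 * w 0 + derivWithin v (Icc 0 1) 0 * derivWithin w (Icc 0 1) 0
    + derivWithin v (Icc 0 1) 1 * derivWithin w (Icc 0 1) 1
    + ∫ x in (0 : ℝ)..1, iteratedDerivWithin 3 v (Icc 0 1) x * iteratedDerivWithin 3 w (Icc 0 1) x

/-- The inner product of `W₂¹[0,1]`. -/
def inner1 (v w : ℝ → ℝ) : ℝ :=
  v 0 * w 0 + ∫ x in (0 : ℝ)..1, derivWithin v (Icc 0 1) x * derivWithin w (Icc 0 1) x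

/-- Membership in `W(Ω)`: `∂⁴u/∂x²∂t²` exists and is completely continuous, `∂⁶u/∂x³∂t³` is
square integrable, the terms of the inner product are finite, and
`u(x,0) = ∂u/∂t(x,0) = u(0,t) = u(1,t) = 0`. -/
structure MemW (T : ℝ) (u : ℝ → ℝ → ℝ) : Prop where
  diff_t : ∀ j < 2, ∀ x ∈ Icc (0 : ℝ) 1, ∀ t ∈ Icc (0 : ℝ) T,
    DifferentiableWithinAt ℝ (fun s => D T 0 j u x s) (Icc 0 T) t
  diff_x : ∀ i < 2, ∀ j ≤ 2, ∀ x ∈ Icc (0 : ℝ) 1, ∀ t ∈ Icc (0 : ℝ) T,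
    DifferentiableWithinAt ℝ (fun y => D T i j u y t) (Icc 0 1) x
  completelyContinuous : CompletelyContinuous T (D T 2 2 u)
  memLp_top : MemLp (fun q : ℝ × ℝ => dx (dt T (D T 2 2 u)) q.1 q.2) 2 (volume.restrict (Omega T))
  memLp_left : ∀ i ≤ 2, MemLp (fun t => dt T (D T i 2 u) 0 t) 2 (volume.restrict (Icc 0 T))
  memLp_bottom : ∀ j ≤ 2,
    MemLp (iteratedDerivWithin 3 (fun x => D T 0 j u x 0) (Icc 0 1)) 2 (volume.restrict (Icc 0 1))
  initial : ∀ x ∈ Icc (0 : ℝ) 1, u x 0 = 0 ∧ dt T u x 0 = 0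
  boundary : ∀ t ∈ Icc (0 : ℝ) T, u 0 t = 0 ∧ u 1 t = 0

/-- The inner product of `W(Ω)`. -/
def innerW (T : ℝ) (u g : ℝ → ℝ → ℝ) : ℝ :=
  (∑ i ∈ Finset.range 3, ∫ t in (0 : ℝ)..T, dt T (D T i 2 u) 0 t * dt T (D T i 2 g) 0 t)
    + (∑ j ∈ Finset.range 3, inner3 (fun x => D T 0 j u x 0) (fun x => D T 0 j g x 0))
    + ∫ x in (0 : ℝ)..1, ∫ t in (0 : ℝ)..T,
        dx (dt T (D T 2 2 u)) x t * dx (dt T (D T 2 2 g)) x t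

/-- The norm of `W(Ω)`. -/
def normW (T : ℝ) (u : ℝ → ℝ → ℝ) : ℝ := √(innerW T u u)

/-- Membership in `Ŵ(Ω)`: complete continuity, square integrable `∂²f/∂x∂t`, and finiteness of
the terms of the inner product. -/
structure MemHatW (T : ℝ) (f : ℝ → ℝ → ℝ) : Prop where
  completelyContinuous : CompletelyContinuous T f
  memLp_top : MemLp (fun q : ℝ × ℝ => dx (dt T f) q.1 q.2) 2 (volume.restrict (Omega T))
  memLp_left : MemLp (fun t => dt T f 0 t) 2 (volume.restrict (Icc 0 T))
  memLp_bottom : MemLp (fun x => dx f x 0) 2 (volume.restrict (Icc 0 1))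

/-- The inner product of `Ŵ(Ω)`. -/
def innerHatW (T : ℝ) (f g : ℝ → ℝ → ℝ) : ℝ :=
  (∫ t in (0 : ℝ)..T, dt T f 0 t * dt T g 0 t)
    + inner1 (fun x => f x 0) (fun x => g x 0)
    + ∫ x in (0 : ℝ)..1, ∫ t in (0 : ℝ)..T, dx (dt T f) x t * dx (dt T g) x t

/-- `Q_y(x)`, which is also `q_s(t)` with `s`, `t` in place of `y`, `x`. -/
def kernelQ (y x : ℝ) : ℝ := if x ≤ y then 1 + x else 1 + y

/-- The reproducing kernel `G_{(y,s)}(x,t) = Q_y(x) q_s(t)` of `Ŵ(Ω)`. -/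
def kernelG (q : ℝ × ℝ) : ℝ → ℝ → ℝ := fun x t => kernelQ q.1 x * kernelQ q.2 t

/-- The operator `L v = ∂²v/∂t² - ∂²v/∂x²`. -/
def waveOp (T : ℝ) (v : ℝ → ℝ → ℝ) : ℝ → ℝ → ℝ := fun x t => D T 0 2 v x t - D T 2 0 v x t

/-- `Ψ = L* φ`, for the adjoint `L*` of `L : W(Ω) → Ŵ(Ω)`. -/
def IsAdjointImage (T : ℝ) (φ Ψ : ℝ → ℝ → ℝ) : Prop :=
  MemW T Ψ ∧ ∀ v, MemW T v → innerW T v Ψ = innerHatW T (waveOp T v) φ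

/-- `v ∈ W(Ω)` solves `L v = M(x, t, v(x,t))` on `Ω`; the homogeneous initial and boundary
conditions are part of `v ∈ W(Ω)`. -/
def IsSolution (T : ℝ) (M : ℝ → ℝ → ℝ → ℝ) (v : ℝ → ℝ → ℝ) : Prop :=
  MemW T v ∧ ∀ x ∈ Icc (0 : ℝ) 1, ∀ t ∈ Icc (0 : ℝ) T, waveOp T v x t = M x t (v x t)

/-- The residual `Ψ_i - ∑_{k<i} ⟨Ψ_i, Ψ̂_k⟩ Ψ̂_k` of the Gram-Schmidt process. -/
def residual (T : ℝ) (Ψ Ψhat : ℕ → ℝ → ℝ → ℝ) (i : ℕ) : ℝ → ℝ → ℝ :=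
  Ψ i - ∑ k ∈ Finset.range i, innerW T (Ψ i) (Ψhat k) • Ψhat k

/-- The objects of the method for the points `p 0, p 1, …` and the right-hand side `M`, each fixed
by its defining equation. Points and coefficients are numbered from `0`, so that `u n` is the sum
of the first `n` terms, `u 0 = 0`, and `u k` is the iterate that enters at the point `p k`. -/
structure Scheme (T : ℝ) (M : ℝ → ℝ → ℝ → ℝ) (p : ℕ → ℝ × ℝ) where
  Ψ : ℕ → ℝ → ℝ → ℝ
  Ψhat : ℕ → ℝ → ℝ → ℝ
  β : ℕ → ℕ → ℝ
  B : ℕ → ℝ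
  u : ℕ → ℝ → ℝ → ℝ
  /-- `Ψ_i = L* φ_i` with `φ_i = G_{p_i}`. -/
  adjoint_eq : ∀ i, IsAdjointImage T (kernelG (p i)) (Ψ i)
  /-- Gram-Schmidt orthonormalization; a vanishing residual gives `Ψ̂_i = 0`. (At the corners
  `(0,0)` and `(1,0)` every `v ∈ W(Ω)` has `L v = 0`, hence `Ψ_i = 0` there.) -/
  gramSchmidt_eq : ∀ i, Ψhat i = (normW T (residual T Ψ Ψhat i))⁻¹ • residual T Ψ Ψhat i
  /-- `Ψ̂_i = ∑_{k≤i} β_{ik} Ψ_k` on `Ω`. -/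
  coeff_eq : ∀ i, ∀ x ∈ Icc (0 : ℝ) 1, ∀ t ∈ Icc (0 : ℝ) T,
    Ψhat i x t = ∑ k ∈ Finset.range (i + 1), β i k * Ψ k x t
  B_eq : ∀ i, B i = ∑ k ∈ Finset.range (i + 1),
    β i k * M (p k).1 (p k).2 (u k (p k).1 (p k).2)
  u_eq : ∀ n, u n = ∑ i ∈ Finset.range n, B i • Ψhat i

end

end SineGordon

/-! On Ω an element u of W(Ω) is determined by F = ∂x²∂t²u: the boundary values lead to the
Dirichlet Green operator in x, the initial values to a double integration in t (`recon`,
`IsDerivFamily.eq_zero`). In turn F is determined by F(0,0), ∂xF(·,0), ∂tF(0,·) and ∂x∂tF. Up to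
equality on Ω, the space W(Ω) is therefore the product `Data T` of ℝ and three L² spaces. In these
coordinates its inner product is pulled back from a Hilbert sum along `Data.embed`, and
`Data.norm_le_embed` bounds this map from below, which makes W(Ω) complete. Since Lu is the Green
operator applied to F minus the double t-primitive of F, L maps into Ŵ(Ω), and the values of u and
of Lu at a point are bounded functionals, uniformly in the point. The Riesz theorem (`exists_riesz`)
and the reproducing property of G then give Ψ_i with ⟨v, Ψ_i⟩ = Lv(p_i).

If the iterates are bounded, ∑ B_i Ψ̂_i is an orthogonal series with bounded partial sums, hence
converges unconditionally (`summable_of_orthogonal`), say to d. Comparing ⟨d, Ψ̂_i⟩ with B_i and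
expanding both through β gives a triangular system for the differences Ld(p_k) − M(p_k, u_k(p_k)).
Its diagonal entry is nonzero away from the corners (0,0) and (1,0), because a product of localized
functions separates p_i from its predecessors (`exists_separating_data`). At these corners every Lv
vanishes, and so does M(·, 0), because a solution exists. Induction gives Ld(p_i) = M(p_i, u_i(p_i))
for all i (`SchemeData.waveC_point`).

Every point of Ω is a limit of points p_i with i tending to infinity (`mapClusterPt_of_dense`). As
u_n tends to d uniformly and M is continuous, Ld = M(·, d) on all of Ω, and uniqueness identifies d
with the solution.

The analytic groundwork is that the mixed derivative of a function given only as a double primitive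
exists almost everywhere as an iterated one-sided derivative. For this the exceptional null set of
times must not depend on x (`ae_hasDerivAt_primitive`). -/

open scoped InnerProductSpace

namespace SineGordon

/-! ### Almost everywhere differentiation of double primitives -/

/-- Pointwise convergence of monotone functions on a dense set of points passes to all points at
which the limit is continuous. -/
theorem tendsto_of_monotone_of_rat {ι : Type*} {l : Filter ι} {q : ι → ℝ → ℝ} {m : ℝ → ℝ}
    (hq : ∀ᶠ i in l, MonotoneOn (q i) (Ici 0)) (hm : Continuous m)
    (hr : ∀ r : ℚ, 0 ≤ (r : ℝ) → Tendsto (fun i => q i r) l (𝓝 (m r)))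
    {x : ℝ} (hx : 0 ≤ x) : Tendsto (fun i => q i x) l (𝓝 (m x)) := by
  rcases hx.eq_or_lt with rfl | hx
  · simpa using hr 0 (by simp)
  refine tendsto_order.2 ⟨fun c hc => ?_, fun c hc => ?_⟩
  · have h1 : ∀ᶠ y in 𝓝[<] x, c < m y ∧ 0 < y :=
      ((hm.continuousAt.eventually (lt_mem_nhds hc)).and (lt_mem_nhds hx)).filter_mono
        nhdsWithin_le_nhds
    obtain ⟨a, hax, ha⟩ := (mem_nhdsLT_iff_exists_Ioo_subset).1 h1
    obtain ⟨r, hr1, hr2⟩ := exists_rat_btwn (mem_Iio.1 hax)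
    have h2 := ha ⟨hr1, hr2⟩
    filter_upwards [hq, (hr r h2.2.le).eventually (lt_mem_nhds h2.1)] with i hi h3
    exact h3.trans_le (hi h2.2.le hx.le hr2.le)
  · have h1 : ∀ᶠ y in 𝓝[>] x, m y < c :=
      (hm.continuousAt.eventually (gt_mem_nhds hc)).filter_mono nhdsWithin_le_nhds
    obtain ⟨a, hax, ha⟩ := (mem_nhdsGT_iff_exists_Ioo_subset).1 h1
    obtain ⟨r, hr1, hr2⟩ := exists_rat_btwn (mem_Ioi.1 hax)
    have h2 := ha ⟨hr1, hr2⟩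
    have h0 : (0 : ℝ) ≤ r := (hx.trans hr1).le
    filter_upwards [hq, (hr r h0).eventually (gt_mem_nhds h2)] with i hi h3
    exact (hi hx.le h0 hr1.le).trans_lt h3

theorem integrable_primitive_fst {h : ℝ → ℝ → ℝ}
    (hh : Integrable (fun q : ℝ × ℝ => h q.1 q.2)) (x : ℝ) :
    Integrable (fun t => ∫ ξ in (0 : ℝ)..x, h ξ t) := by
  have h1 : ∀ s : Set ℝ, Integrable (fun t => ∫ ξ in s, h ξ t) := fun s => by
    have : Integrable (fun q : ℝ × ℝ => h q.1 q.2) ((volume.restrict s).prod volume) := by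
      have := hh.integrableOn (s := s ×ˢ univ)
      rwa [IntegrableOn, Measure.volume_eq_prod, ← Measure.prod_restrict,
        Measure.restrict_univ] at this
    exact this.integral_prod_right
  exact (h1 _).sub (h1 _)

theorem ae_integrable_fst {h : ℝ → ℝ → ℝ} (hh : Integrable (fun q : ℝ × ℝ => h q.1 q.2)) :
    ∀ᵐ t, Integrable (fun ξ => h ξ t) := hh.prod_left_ae

/-- The point is one null set of times for all x. Countably many null sets take care of rational x;
as h is nonnegative, the difference quotients are monotone in x and their limit is continuous in x,
so the convergence extends to every x. -/
theorem ae_hasDerivAt_primitive_of_nonneg {h : ℝ → ℝ → ℝ}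
    (hh : Integrable (fun q : ℝ × ℝ => h q.1 q.2)) (h0 : ∀ x t, 0 ≤ h x t) :
    ∀ᵐ t, ∀ x, 0 ≤ x → HasDerivAt (fun s => ∫ τ in (0 : ℝ)..s, ∫ ξ in (0 : ℝ)..x, h ξ τ)
      (∫ ξ in (0 : ℝ)..x, h ξ t) t := by
  have h1 : ∀ᵐ t, ∀ r : ℚ, HasDerivAt (fun s => ∫ τ in (0 : ℝ)..s, ∫ ξ in (0 : ℝ)..r, h ξ τ)
      (∫ ξ in (0 : ℝ)..r, h ξ t) t := by
    refine ae_all_iff.2 fun r => ?_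
    filter_upwards [LocallyIntegrable.ae_hasDerivAt_integral
      (integrable_primitive_fst hh r).locallyIntegrable]
      with t ht using ht 0
  filter_upwards [h1, ae_integrable_fst hh] with t ht hit x hx
  rw [hasDerivAt_iff_tendsto_slope]
  have hii : ∀ y a b : ℝ, IntervalIntegrable (fun τ => ∫ ξ in (0 : ℝ)..y, h ξ τ) volume a b :=
    fun y a b => (integrable_primitive_fst hh y).intervalIntegrable
  refine tendsto_of_monotone_of_rat (l := 𝓝[≠] t)
    (q := fun s y => slope (fun s => ∫ τ in (0 : ℝ)..s, ∫ ξ in (0 : ℝ)..y, h ξ τ) t s)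
    (m := fun y => ∫ ξ in (0 : ℝ)..y, h ξ t) ?_ ?_ ?_ hx
  · have hae : ∀ y z : ℝ, 0 ≤ y → y ≤ z →
        ∀ᵐ τ, (∫ ξ in (0 : ℝ)..y, h ξ τ) ≤ ∫ ξ in (0 : ℝ)..z, h ξ τ := by
      intro y z hy hyz
      filter_upwards [ae_integrable_fst hh] with τ hτ
      rw [← sub_nonneg, intervalIntegral.integral_interval_sub_left hτ.intervalIntegrable
        hτ.intervalIntegrable]
      exact intervalIntegral.integral_nonneg hyz fun _ _ => h0 _ _
    filter_upwards [self_mem_nhdsWithin] with s hs y hy z hz hyz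
    simp only [slope_def_field]
    rw [intervalIntegral.integral_interval_sub_left (hii _ _ _) (hii _ _ _),
      intervalIntegral.integral_interval_sub_left (hii _ _ _) (hii _ _ _)]
    rcases lt_or_gt_of_ne (show s ≠ t from hs) with hst | hst
    · rw [intervalIntegral.integral_symm s t, intervalIntegral.integral_symm s t]
      refine div_le_div_of_nonpos_of_le (by linarith) (neg_le_neg ?_)
      exact intervalIntegral.integral_mono_ae hst.le (hii _ _ _) (hii _ _ _) (hae y z hy hyz)
    · refine div_le_div_of_nonneg_right ?_ (by linarith)
      exact intervalIntegral.integral_mono_ae hst.le (hii _ _ _) (hii _ _ _) (hae y z hy hyz)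
  · exact intervalIntegral.continuous_primitive (fun a b => hit.intervalIntegrable) 0
  · intro r _
    exact hasDerivAt_iff_tendsto_slope.1 (ht r)

/-- For almost every `t`, a double primitive is differentiable in `t` for all `x` at once. -/
theorem ae_hasDerivAt_primitive {h : ℝ → ℝ → ℝ}
    (hh : Integrable (fun q : ℝ × ℝ => h q.1 q.2)) :
    ∀ᵐ t, ∀ x, 0 ≤ x → HasDerivAt (fun s => ∫ τ in (0 : ℝ)..s, ∫ ξ in (0 : ℝ)..x, h ξ τ)
      (∫ ξ in (0 : ℝ)..x, h ξ t) t := by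
  -- The positive and the negative part of h each fall under the monotone case.
  have hp : Integrable (fun q : ℝ × ℝ => max (h q.1 q.2) 0) := hh.pos_part
  have hn : Integrable (fun q : ℝ × ℝ => max (-h q.1 q.2) 0) := hh.neg_part
  have key : ∀ x : ℝ, ∀ᵐ τ, (∫ ξ in (0 : ℝ)..x, h ξ τ) =
      (∫ ξ in (0 : ℝ)..x, max (h ξ τ) 0) - ∫ ξ in (0 : ℝ)..x, max (-h ξ τ) 0 := by
    intro x
    filter_upwards [ae_integrable_fst (h := fun x t => max (h x t) 0) hp, ae_integrable_fst (h := fun x t => max (-h x t) 0) hn] with τ h1 h2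
    rw [← intervalIntegral.integral_sub h1.intervalIntegrable h2.intervalIntegrable]
    congr 1; ext ξ
    rcases le_total (h ξ τ) 0 with h | h <;> simp [h]
  filter_upwards [ae_hasDerivAt_primitive_of_nonneg (h := fun x t => max (h x t) 0) hp
      (fun _ _ => le_max_right _ _),
    ae_hasDerivAt_primitive_of_nonneg (h := fun x t => max (-h x t) 0) hn
      (fun _ _ => le_max_right _ _),
    ae_integrable_fst (h := fun x t => max (h x t) 0) hp, ae_integrable_fst (h := fun x t => max (-h x t) 0) hn] with t h1 h2 h3 h4 x hx
  have h5 : (∫ ξ in (0 : ℝ)..x, h ξ t) =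
      (∫ ξ in (0 : ℝ)..x, max (h ξ t) 0) - ∫ ξ in (0 : ℝ)..x, max (-h ξ t) 0 := by
    rw [← intervalIntegral.integral_sub h3.intervalIntegrable h4.intervalIntegrable]
    congr 1; ext ξ
    rcases le_total (h ξ t) 0 with h | h <;> simp [h]
  rw [h5]
  refine ((h1 x hx).sub (h2 x hx)).congr_of_eventuallyEq (Eventually.of_forall fun s => ?_)
  simp only [Pi.sub_apply]
  rw [← intervalIntegral.integral_sub (integrable_primitive_fst hp x).intervalIntegrable
    (integrable_primitive_fst hn x).intervalIntegrable]
  exact intervalIntegral.integral_congr_ae ((key x).mono fun τ hτ _ => hτ)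

/-- Continuity of g makes the difference quotient continuous in a nonzero increment, so rational
increments decide. With only countably many increments, the set of points of differentiability
becomes measurable. -/
theorem tendsto_slope_of_rat {g : ℝ → ℝ} (hg : Continuous g) {x c : ℝ}
    (h : Tendsto (fun r : ℚ => (g (x + r) - g x) / r) (comap (fun r : ℚ => (r : ℝ)) (𝓝[≠] 0))
      (𝓝 c)) : HasDerivAt g c x := by
  rw [hasDerivAt_iff_tendsto_slope_zero]
  refine Metric.nhds_basis_closedBall.tendsto_right_iff.2 fun ε hε => ?_
  have h1 := (Metric.nhds_basis_closedBall.tendsto_right_iff.1 h) ε hε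
  rw [eventually_comap] at h1
  rw [eventually_nhdsWithin_iff, Metric.eventually_nhds_iff] at h1 ⊢
  obtain ⟨δ, hδ, h1⟩ := h1
  refine ⟨δ, hδ, fun y hy hy0 => ?_⟩
  have hcl : y ∈ closure ((Metric.ball 0 δ ∩ {0}ᶜ) ∩ range (fun r : ℚ => (r : ℝ))) :=
    Rat.denseRange_cast.open_subset_closure_inter
      (Metric.isOpen_ball.inter isOpen_compl_singleton) ⟨by simpa using hy, hy0⟩
  obtain ⟨s, hs, hsy⟩ := mem_closure_iff_seq_limit.1 hcl
  have hc : Tendsto (fun n => (s n)⁻¹ • (g (x + s n) - g x)) atTop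
      (𝓝 (y⁻¹ • (g (x + y) - g x))) :=
    (hsy.inv₀ hy0).smul (((hg.tendsto _).comp (tendsto_const_nhds.add hsy)).sub_const _)
  refine Metric.isClosed_closedBall.mem_of_tendsto hc (Eventually.of_forall fun n => ?_)
  obtain ⟨⟨hb, hn0⟩, r, hr⟩ := hs n
  have := h1 (by simpa using hb) hn0 r hr
  rw [← hr]
  simpa [div_eq_inv_mul] using this

/-- Lebesgue differentiation in one variable, almost everywhere in the plane. -/
theorem ae_hasDerivAt_primitive_fst {h : ℝ → ℝ → ℝ}
    (hh : Integrable (fun q : ℝ × ℝ => h q.1 q.2)) :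
    ∀ᵐ q : ℝ × ℝ, HasDerivAt (fun y => ∫ ξ in (0 : ℝ)..y, h ξ q.2) (h q.1 q.2) q.1 := by
  -- A measurable representative makes the set of good points measurable, so that Fubini can turn
  -- "for almost every t, for almost every x" into almost everywhere in the plane.
  obtain ⟨k, hk, hhk⟩ := hh.aestronglyMeasurable
  have hki : Integrable (fun q : ℝ × ℝ => k (q.1, q.2)) := hh.congr hhk
  let P : ℝ × ℝ → ℝ := fun q => ∫ ξ in (0 : ℝ)..q.1, k (ξ, q.2)
  have hP : Measurable P := by
    have hPm : ∀ q, P q = (∫ ξ, (Ioc 0 q.1).indicator (fun ξ => k (ξ, q.2)) ξ) -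
        ∫ ξ, (Ioc q.1 0).indicator (fun ξ => k (ξ, q.2)) ξ := fun q => by
      simp only [P, intervalIntegral, integral_indicator measurableSet_Ioc]
    have hm : ∀ s : Set ((ℝ × ℝ) × ℝ), MeasurableSet s → StronglyMeasurable
        (fun q : ℝ × ℝ => ∫ ξ, s.indicator (fun z => k (z.2, z.1.2)) (q, ξ)) := fun s hs =>
      StronglyMeasurable.integral_prod_right' (ν := volume)
        ((hk.measurable.comp (by fun_prop : Measurable
          fun z : (ℝ × ℝ) × ℝ => (z.2, z.1.2))).indicator hs).stronglyMeasurable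
    have e1 : MeasurableSet {z : (ℝ × ℝ) × ℝ | z.2 ∈ Ioc 0 z.1.1} :=
      (measurableSet_lt measurable_const measurable_snd).inter
        (measurableSet_le measurable_snd (by fun_prop))
    have e2 : MeasurableSet {z : (ℝ × ℝ) × ℝ | z.2 ∈ Ioc z.1.1 0} :=
      (measurableSet_lt (by fun_prop) measurable_snd).inter
        (measurableSet_le measurable_snd measurable_const)
    have := ((hm _ e1).sub (hm _ e2)).measurable
    convert this using 1
    ext q
    rw [hPm]; rfl
  have hG : MeasurableSet {q : ℝ × ℝ | Tendsto (fun r : ℚ => (P (q.1 + r, q.2) - P q) / r)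
      (comap (fun r : ℚ => (r : ℝ)) (𝓝[≠] 0)) (𝓝 (k q))} :=
    measurableSet_tendsto_fun (fun r => ((hP.comp (by fun_prop)).sub hP).div_const _) hk.measurable
  have hae := hki.prod_left_ae
  have hGae : ∀ᵐ t : ℝ, ∀ᵐ x : ℝ, Tendsto (fun r : ℚ => (P (x + r, t) - P (x, t)) / r)
      (comap (fun r : ℚ => (r : ℝ)) (𝓝[≠] 0)) (𝓝 (k (x, t))) := by
    filter_upwards [hae] with t ht
    filter_upwards [LocallyIntegrable.ae_hasDerivAt_integral ht.locallyIntegrable] with x hx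
    have := (hasDerivAt_iff_tendsto_slope_zero.1 (hx 0)).comp
      (tendsto_comap (f := fun r : ℚ => (r : ℝ)))
    refine this.congr fun r => ?_
    simp [P, div_eq_inv_mul]
  have hGae2 := (Measure.ae_prod_iff_ae_ae hG).2 ((Measure.ae_ae_comm (μ := volume)
    (ν := volume) (p := fun x t => Tendsto (fun r : ℚ => (P (x + r, t) - P (x, t)) / r)
      (comap (fun r : ℚ => (r : ℝ)) (𝓝[≠] 0)) (𝓝 (k (x, t)))) hG).2 hGae)
  have hsec : ∀ᵐ q : ℝ × ℝ, Integrable (fun ξ => k (ξ, q.2)) :=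
    Measure.quasiMeasurePreserving_snd.ae hae
  have hcongr : ∀ᵐ t : ℝ, (fun ξ => h ξ t) =ᵐ[volume] fun ξ => k (ξ, t) := by
    have := Measure.ae_ae_of_ae_prod (Measure.measurePreserving_swap.quasiMeasurePreserving.ae hhk)
    exact this
  have hcongr2 : ∀ᵐ q : ℝ × ℝ, (fun ξ => h ξ q.2) =ᵐ[volume] fun ξ => k (ξ, q.2) :=
    Measure.quasiMeasurePreserving_snd.ae hcongr
  filter_upwards [hGae2, hsec, hcongr2, hhk] with q h1 h2 h3 h4
  rw [h4]
  have h5 : (fun y => ∫ ξ in (0 : ℝ)..y, h ξ q.2) = fun y => P (y, q.2) := by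
    ext y
    exact intervalIntegral.integral_congr_ae (h3.mono fun ξ hξ _ => hξ)
  rw [h5]
  refine tendsto_slope_of_rat ?_ h1
  exact intervalIntegral.continuous_primitive (fun a b => h2.intervalIntegrable) 0

/-! ### Double primitives on the rectangle and their derivatives -/

/-- The primitive in the first variable. -/
noncomputable def primX (f : ℝ → ℝ → ℝ) : ℝ → ℝ → ℝ := fun x t => ∫ ξ in (0 : ℝ)..x, f ξ t

/-- The primitive in the second variable. -/
noncomputable def primT (f : ℝ → ℝ → ℝ) : ℝ → ℝ → ℝ := fun x t => ∫ τ in (0 : ℝ)..t, f x τ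

theorem restrict_Omega (T : ℝ) : (volume : Measure (ℝ × ℝ)).restrict (Omega T) =
    (volume.restrict (Icc (0 : ℝ) 1)).prod (volume.restrict (Icc (0 : ℝ) T)) := by
  rw [Omega, Measure.volume_eq_prod, Measure.prod_restrict]

theorem measurableSet_Omega (T : ℝ) : MeasurableSet (Omega T) :=
  measurableSet_Icc.prod measurableSet_Icc

instance isFiniteMeasure_restrict_Omega (T : ℝ) :
    IsFiniteMeasure ((volume : Measure (ℝ × ℝ)).restrict (Omega T)) := by
  rw [restrict_Omega]; infer_instance

theorem uIoc_prod_subset_Omega {T x t : ℝ} (hx : x ∈ Icc (0 : ℝ) 1) (ht : t ∈ Icc (0 : ℝ) T) :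
    uIoc 0 x ×ˢ uIoc 0 t ⊆ Omega T := by
  rw [uIoc_of_le hx.1, uIoc_of_le ht.1]
  exact prod_mono (fun y hy => ⟨hy.1.le, hy.2.trans hx.2⟩) (fun y hy => ⟨hy.1.le, hy.2.trans ht.2⟩)

/-- Fubini's theorem for iterated primitives on the rectangle. -/
theorem primX_primT_comm {T : ℝ} {h : ℝ → ℝ → ℝ}
    (hh : IntegrableOn (fun q : ℝ × ℝ => h q.1 q.2) (Omega T)) {x t : ℝ}
    (hx : x ∈ Icc (0 : ℝ) 1) (ht : t ∈ Icc (0 : ℝ) T) :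
    primX (primT h) x t = primT (primX h) x t :=
  intervalIntegral_intervalIntegral_swap (hh.mono_set (uIoc_prod_subset_Omega hx ht))

theorem primX_primT_eq_setIntegral {T : ℝ} {h : ℝ → ℝ → ℝ}
    (hh : IntegrableOn (fun q : ℝ × ℝ => h q.1 q.2) (Omega T)) {x t : ℝ}
    (hx : x ∈ Icc (0 : ℝ) 1) (ht : t ∈ Icc (0 : ℝ) T) :
    primX (primT h) x t = ∫ q in Ioc 0 x ×ˢ Ioc 0 t, h q.1 q.2 := by
  have h1 := hh.mono_set (uIoc_prod_subset_Omega hx ht)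
  rw [uIoc_of_le hx.1, uIoc_of_le ht.1] at h1
  rw [Measure.volume_eq_prod] at h1 ⊢
  rw [setIntegral_prod _ h1]
  simp only [primX, primT, intervalIntegral.integral_of_le hx.1, intervalIntegral.integral_of_le ht.1]

/-- Extension of a function on the rectangle by zero. -/
noncomputable def zeroExt (T : ℝ) (h : ℝ → ℝ → ℝ) : ℝ → ℝ → ℝ :=
  fun x t => (Omega T).indicator (fun q : ℝ × ℝ => h q.1 q.2) (x, t)

theorem zeroExt_of_mem {T : ℝ} {h : ℝ → ℝ → ℝ} {x t : ℝ}
    (hx : x ∈ Icc (0 : ℝ) 1) (ht : t ∈ Icc (0 : ℝ) T) : zeroExt T h x t = h x t :=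
  indicator_of_mem (s := Omega T) (mk_mem_prod hx ht) _

theorem integrable_zeroExt {T : ℝ} {h : ℝ → ℝ → ℝ}
    (hh : IntegrableOn (fun q : ℝ × ℝ => h q.1 q.2) (Omega T)) :
    Integrable (fun q : ℝ × ℝ => zeroExt T h q.1 q.2) :=
  hh.integrable_indicator (measurableSet_Omega T)

theorem primX_congr {T : ℝ} {f g : ℝ → ℝ → ℝ}
    (h : ∀ x ∈ Icc (0 : ℝ) 1, ∀ t ∈ Icc (0 : ℝ) T, f x t = g x t) {x t : ℝ}
    (hx : x ∈ Icc (0 : ℝ) 1) (ht : t ∈ Icc (0 : ℝ) T) : primX f x t = primX g x t := by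
  refine intervalIntegral.integral_congr fun ξ hξ => ?_
  rw [uIcc_of_le hx.1] at hξ
  exact h ξ ⟨hξ.1, hξ.2.trans hx.2⟩ t ht

theorem primT_congr {T : ℝ} {f g : ℝ → ℝ → ℝ}
    (h : ∀ x ∈ Icc (0 : ℝ) 1, ∀ t ∈ Icc (0 : ℝ) T, f x t = g x t) {x t : ℝ}
    (hx : x ∈ Icc (0 : ℝ) 1) (ht : t ∈ Icc (0 : ℝ) T) : primT f x t = primT g x t := by
  refine intervalIntegral.integral_congr fun ξ hξ => ?_
  rw [uIcc_of_le ht.1] at hξ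
  exact h x hx ξ ⟨hξ.1, hξ.2.trans ht.2⟩

theorem ae_hasDerivWithinAt_of_primitive {l c : ℝ} (hl : 0 < l) {a g : ℝ → ℝ}
    (ha : IntegrableOn a (Icc 0 l))
    (hg : ∀ x ∈ Icc (0 : ℝ) l, g x = c + ∫ ξ in (0 : ℝ)..x, a ξ) :
    ∀ᵐ x ∂(volume.restrict (Icc (0 : ℝ) l)), HasDerivWithinAt g (a x) (Icc 0 l) x := by
  have h1 : IntervalIntegrable a volume 0 l :=
    (intervalIntegrable_iff_integrableOn_Icc_of_le hl.le).2 ha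
  have h2 := IntervalIntegrable.ae_hasDerivAt_integral h1
  rw [uIcc_of_le hl.le] at h2
  rw [ae_restrict_iff' measurableSet_Icc]
  filter_upwards [h2] with x hx hxm
  have h3 := ((hx hxm 0 (left_mem_Icc.2 hl.le)).const_add c).hasDerivWithinAt (s := Icc 0 l)
  exact h3.congr hg (hg x hxm)

/-- `f` is the double primitive on the rectangle with the data `f 0 0`, `a`, `b`, `h`. -/
def IsDoublePrimitive (T : ℝ) (f : ℝ → ℝ → ℝ) (a b : ℝ → ℝ) (h : ℝ → ℝ → ℝ) : Prop :=
  ∀ x ∈ Icc (0 : ℝ) 1, ∀ t ∈ Icc (0 : ℝ) T,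
    f x t = f 0 0 + (∫ ξ in (0 : ℝ)..x, a ξ) + (∫ τ in (0 : ℝ)..t, b τ)
      + ∫ ξ in (0 : ℝ)..x, ∫ τ in (0 : ℝ)..t, h ξ τ

section Derivatives

variable {T : ℝ} {f : ℝ → ℝ → ℝ} {a b : ℝ → ℝ} {h : ℝ → ℝ → ℝ}

theorem IsDoublePrimitive.apply_bottom (hf : IsDoublePrimitive T f a b h) (hT : 0 < T) {x : ℝ}
    (hx : x ∈ Icc (0 : ℝ) 1) : f x 0 = f 0 0 + ∫ ξ in (0 : ℝ)..x, a ξ := by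
  rw [hf x hx 0 (left_mem_Icc.2 hT.le)]; simp

theorem IsDoublePrimitive.apply_left (hf : IsDoublePrimitive T f a b h) {t : ℝ}
    (ht : t ∈ Icc (0 : ℝ) T) : f 0 t = f 0 0 + ∫ τ in (0 : ℝ)..t, b τ := by
  rw [hf 0 (by simp) t ht]; simp

theorem IsDoublePrimitive.ae_dx_bottom (hf : IsDoublePrimitive T f a b h) (hT : 0 < T)
    (ha : IntegrableOn a (Icc 0 1)) :
    ∀ᵐ x ∂(volume.restrict (Icc (0 : ℝ) 1)), dx f x 0 = a x := by
  filter_upwards [ae_hasDerivWithinAt_of_primitive one_pos ha (fun x hx => hf.apply_bottom hT hx),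
    ae_restrict_mem measurableSet_Icc] with x hx hxm
  exact hx.derivWithin (uniqueDiffOn_Icc one_pos x hxm)

theorem IsDoublePrimitive.ae_dt_left (hf : IsDoublePrimitive T f a b h) (hT : 0 < T)
    (hb : IntegrableOn b (Icc 0 T)) :
    ∀ᵐ t ∂(volume.restrict (Icc (0 : ℝ) T)), dt T f 0 t = b t := by
  filter_upwards [ae_hasDerivWithinAt_of_primitive hT hb (fun t ht => hf.apply_left ht),
    ae_restrict_mem measurableSet_Icc] with x hx hxm
  exact hx.derivWithin (uniqueDiffOn_Icc hT x hxm)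

/-- The quantifier over x stands inside the almost everywhere statement, so that for a good t the
whole function ∂tf(·,t) is known as a primitive and can be differentiated again in x. -/
theorem IsDoublePrimitive.ae_dt (hf : IsDoublePrimitive T f a b h) (hT : 0 < T)
    (hb : IntegrableOn b (Icc 0 T))
    (hh : IntegrableOn (fun q : ℝ × ℝ => h q.1 q.2) (Omega T)) :
    ∀ᵐ t ∂(volume.restrict (Icc (0 : ℝ) T)), ∀ x ∈ Icc (0 : ℝ) 1,
      dt T f x t = b t + primX (zeroExt T h) x t := by
  filter_upwards [ae_hasDerivWithinAt_of_primitive (c := f 0 0) hT hb (fun t ht => rfl),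
    ae_restrict_mem measurableSet_Icc,
    ae_restrict_of_ae (ae_hasDerivAt_primitive (integrable_zeroExt hh))] with t h1 ht h2 x hx
  have h3 := (h1.add ((h2 x hx.1).hasDerivWithinAt (s := Icc 0 T))).const_add
    (∫ ξ in (0 : ℝ)..x, a ξ)
  refine (h3.congr_of_mem (fun s hs => ?_) ht).derivWithin (uniqueDiffOn_Icc hT t ht)
  have h4 : (∫ ξ in (0 : ℝ)..x, ∫ τ in (0 : ℝ)..s, h ξ τ) = primT (primX (zeroExt T h)) x s := by
    rw [← primX_primT_comm (integrable_zeroExt hh).integrableOn hx hs]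
    exact primX_congr (fun x hx t ht => primT_congr (fun x hx t ht =>
      (zeroExt_of_mem hx ht).symm) hx ht) hx hs
  rw [hf x hx s hs, h4]
  simp only [primT, primX, Pi.add_apply]
  ring

theorem IsDoublePrimitive.ae_dx_dt (hf : IsDoublePrimitive T f a b h) (hT : 0 < T)
    (hb : IntegrableOn b (Icc 0 T))
    (hh : IntegrableOn (fun q : ℝ × ℝ => h q.1 q.2) (Omega T)) :
    ∀ᵐ q ∂(volume.restrict (Omega T)), dx (dt T f) q.1 q.2 = h q.1 q.2 := by
  have h1 : ∀ᵐ q ∂(volume.restrict (Omega T)), ∀ x ∈ Icc (0 : ℝ) 1,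
      dt T f x q.2 = b q.2 + primX (zeroExt T h) x q.2 := by
    rw [restrict_Omega]
    exact Measure.quasiMeasurePreserving_snd.ae (hf.ae_dt hT hb hh)
  filter_upwards [h1, ae_restrict_mem (measurableSet_Omega T),
    ae_restrict_of_ae (ae_hasDerivAt_primitive_fst (integrable_zeroExt hh))] with q h1 hq h2
  rw [← zeroExt_of_mem (h := h) hq.1 hq.2]
  have h3 := (h2.hasDerivWithinAt (s := Icc 0 1)).const_add (b q.2)
  exact (h3.congr_of_mem (fun s hs => h1 s hs) hq.1).derivWithin (uniqueDiffOn_Icc one_pos _ hq.1)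

theorem continuousOn_primitive_zero {l : ℝ} {g : ℝ → ℝ} (hl : 0 ≤ l)
    (hg : IntegrableOn g (Icc 0 l)) :
    ContinuousOn (fun x => ∫ ξ in (0 : ℝ)..x, g ξ) (Icc 0 l) := by
  have := intervalIntegral.continuousOn_primitive_interval (a := 0) (b := l) (f := g)
    (μ := volume) (by rwa [uIcc_of_le hl])
  rwa [uIcc_of_le hl] at this

/-- Dominated convergence: the double integral is the integral of h times the indicator of a
rectangle that varies with the point. -/
theorem IsDoublePrimitive.continuousOn (hf : IsDoublePrimitive T f a b h) (hT : 0 < T)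
    (ha : IntegrableOn a (Icc 0 1)) (hb : IntegrableOn b (Icc 0 T))
    (hh : IntegrableOn (fun q : ℝ × ℝ => h q.1 q.2) (Omega T)) :
    ContinuousOn (fun q : ℝ × ℝ => f q.1 q.2) (Omega T) := by
  -- Off the two lines through q₀, a null set, membership of q in the rectangle is locally constant
  -- in the moving corner.
  have hae : ∀ q₀ : ℝ × ℝ, ∀ᵐ q : ℝ × ℝ, q.1 ≠ q₀.1 ∧ q.2 ≠ q₀.2 := fun q₀ => by
    have h0 : ∀ c : ℝ, ∀ᵐ y : ℝ, y ≠ c := fun c => by simp [ae_iff, measure_singleton]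
    exact (Measure.quasiMeasurePreserving_fst.ae (h0 q₀.1)).and
      (Measure.quasiMeasurePreserving_snd.ae (h0 q₀.2))
  have h1 : Continuous (fun z : ℝ × ℝ => ∫ q : ℝ × ℝ,
      (Ioc 0 z.1 ×ˢ Ioc 0 z.2).indicator (fun q => zeroExt T h q.1 q.2) q) := by
    refine continuous_iff_continuousAt.2 fun z₀ => continuousAt_of_dominated
      (bound := fun q => ‖zeroExt T h q.1 q.2‖) (Eventually.of_forall fun z => ?_)
      (Eventually.of_forall fun z => Eventually.of_forall fun q => norm_indicator_le_norm_self _ _)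
      (integrable_zeroExt hh).norm ?_
    · exact (integrable_zeroExt hh).aestronglyMeasurable.indicator
        (measurableSet_Ioc.prod measurableSet_Ioc)
    · filter_upwards [hae z₀] with q hq
      have hc : ∀ c c₀ : ℝ, c ≠ c₀ → ∀ᶠ z in 𝓝 c₀, (c ∈ Ioc 0 z ↔ c ∈ Ioc 0 c₀) := by
        intro c c₀ hne
        rcases lt_or_gt_of_ne hne with hlt | hlt
        · filter_upwards [lt_mem_nhds hlt] with z hz
          simp [hz.le, hlt.le]
        · filter_upwards [gt_mem_nhds hlt] with z hz
          simp [not_le.2 hz, not_le.2 hlt]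
      have he : ∀ᶠ z in 𝓝 z₀, (Ioc 0 z.1 ×ˢ Ioc 0 z.2).indicator
          (fun q : ℝ × ℝ => zeroExt T h q.1 q.2) q =
          (Ioc 0 z₀.1 ×ˢ Ioc 0 z₀.2).indicator (fun q => zeroExt T h q.1 q.2) q := by
        filter_upwards [(continuous_fst.tendsto z₀).eventually (hc _ _ hq.1),
          (continuous_snd.tendsto z₀).eventually (hc _ _ hq.2)] with z h1 h2
        simp only [indicator, mem_prod, h1, h2]
      exact (continuousAt_const.congr (he.mono fun z hz => hz.symm))
  have ha' : ContinuousOn (fun x => ∫ ξ in (0 : ℝ)..x, a ξ) (Icc 0 1) :=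
    continuousOn_primitive_zero zero_le_one ha
  have hb' : ContinuousOn (fun x => ∫ ξ in (0 : ℝ)..x, b ξ) (Icc 0 T) :=
    continuousOn_primitive_zero hT.le hb
  have h2 : ContinuousOn (fun z : ℝ × ℝ => f 0 0 + (∫ ξ in (0 : ℝ)..z.1, a ξ) +
      (∫ τ in (0 : ℝ)..z.2, b τ) + ∫ q : ℝ × ℝ,
      (Ioc 0 z.1 ×ˢ Ioc 0 z.2).indicator (fun q => zeroExt T h q.1 q.2) q) (Omega T) :=
    ((continuousOn_const.add (ha'.comp continuousOn_fst fun q hq => hq.1)).add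
      (hb'.comp continuousOn_snd fun q hq => hq.2)).add h1.continuousOn
  refine h2.congr fun z hz => ?_
  simp only
  rw [hf _ hz.1 _ hz.2, integral_indicator (measurableSet_Ioc.prod measurableSet_Ioc)]
  congr 1
  rw [← primX_primT_eq_setIntegral (integrable_zeroExt hh).integrableOn hz.1 hz.2]
  exact primX_congr (fun x hx t ht => primT_congr (fun x hx t ht =>
      (zeroExt_of_mem hx ht).symm) hx ht) hz.1 hz.2

end Derivatives

/-! ### Square integrable data and L² bounds for primitives -/

/-- `f` is a double primitive with square integrable data. -/
structure IsL2Primitive (T : ℝ) (f : ℝ → ℝ → ℝ) (a b : ℝ → ℝ) (h : ℝ → ℝ → ℝ) : Prop where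
  a_memLp : MemLp a 2 (volume.restrict (Icc 0 1))
  b_memLp : MemLp b 2 (volume.restrict (Icc 0 T))
  h_memLp : MemLp (fun q : ℝ × ℝ => h q.1 q.2) 2 (volume.restrict (Omega T))
  prim : IsDoublePrimitive T f a b h

namespace IsL2Primitive

variable {T : ℝ} {f : ℝ → ℝ → ℝ} {a b : ℝ → ℝ} {h : ℝ → ℝ → ℝ}

theorem a_int (hf : IsL2Primitive T f a b h) : IntegrableOn a (Icc 0 1) :=
  hf.a_memLp.integrable one_le_two

theorem b_int (hf : IsL2Primitive T f a b h) : IntegrableOn b (Icc 0 T) :=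
  hf.b_memLp.integrable one_le_two

theorem h_int (hf : IsL2Primitive T f a b h) :
    IntegrableOn (fun q : ℝ × ℝ => h q.1 q.2) (Omega T) :=
  hf.h_memLp.integrable one_le_two

theorem memHatW (hf : IsL2Primitive T f a b h) (hT : 0 < T) : MemHatW T f where
  completelyContinuous := ⟨a, b, h, hf.a_int, hf.b_int, hf.h_int, hf.prim⟩
  memLp_top := (memLp_congr_ae (hf.prim.ae_dx_dt hT hf.b_int hf.h_int)).2 hf.h_memLp
  memLp_left := (memLp_congr_ae (hf.prim.ae_dt_left hT hf.b_int)).2 hf.b_memLp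
  memLp_bottom := (memLp_congr_ae (hf.prim.ae_dx_bottom hT hf.a_int)).2 hf.a_memLp

theorem continuousOn (hf : IsL2Primitive T f a b h) (hT : 0 < T) :
    ContinuousOn (fun q : ℝ × ℝ => f q.1 q.2) (Omega T) :=
  hf.prim.continuousOn hT hf.a_int hf.b_int hf.h_int

end IsL2Primitive

theorem MemHatW.exists_isL2Primitive {T : ℝ} (hT : 0 < T) {f : ℝ → ℝ → ℝ} (hf : MemHatW T f) :
    ∃ a b h, IsL2Primitive T f a b h := by
  obtain ⟨a, b, h, ha, hb, hh, hp⟩ := hf.completelyContinuous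
  have hp : IsDoublePrimitive T f a b h := hp
  exact ⟨a, b, h, (memLp_congr_ae (hp.ae_dx_bottom hT ha)).1 hf.memLp_bottom,
    (memLp_congr_ae (hp.ae_dt_left hT hb)).1 hf.memLp_left,
    (memLp_congr_ae (hp.ae_dx_dt hT hb hh)).1 hf.memLp_top, hp⟩

/-- Cauchy–Schwarz against the constant 1, by expanding ∫ (|g| − c)² ≥ 0 at the mean c of |g|. -/
theorem sq_integral_abs_le {α : Type*} [MeasurableSpace α] {μ : Measure α} [IsFiniteMeasure μ]
    {g : α → ℝ} (hg : MemLp g 2 μ) : (∫ x, |g x| ∂μ) ^ 2 ≤ μ.real univ * ∫ x, g x ^ 2 ∂μ := by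
  have h1 : Integrable g μ := hg.integrable one_le_two
  have h2 : Integrable (fun x => g x ^ 2) μ := hg.integrable_sq
  rcases (measureReal_nonneg (μ := μ) (s := univ)).eq_or_lt with h0 | h0
  · have : μ = 0 := by
      rw [← Measure.measure_univ_eq_zero]
      exact (measureReal_eq_zero_iff (measure_ne_top _ _)).1 h0.symm
    simp [this]
  · set c := (∫ x, |g x| ∂μ) / μ.real univ with hc
    have h3 : 0 ≤ ∫ x, (|g x| - c) ^ 2 ∂μ := integral_nonneg fun x => sq_nonneg _
    have h4 : ∀ x, (|g x| - c) ^ 2 = g x ^ 2 - 2 * c * |g x| + c ^ 2 := fun x => by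
      rw [sub_sq, sq_abs]; ring
    simp_rw [h4] at h3
    have h1' : Integrable (fun x => 2 * c * |g x|) μ := h1.abs.const_mul _
    have h2' : Integrable (fun x => g x ^ 2 - 2 * c * |g x|) μ := h2.sub h1'
    rw [integral_add h2' (integrable_const _), integral_sub h2 h1', integral_const_mul, integral_const, smul_eq_mul] at h3
    have h5 : ∫ x, |g x| ∂μ = c * μ.real univ := by rw [hc]; field_simp
    rw [h5] at h3 ⊢
    nlinarith

section Box

variable {l₁ l₂ : ℝ} {k : ℝ → ℝ → ℝ} {σ : ℝ → ℝ}

/-- As an integral of an indicator over a measurable set, the expression is a parametric integral.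
The upper limit σ is general so that σ = id gives the primitive and σ = 1 the integral over the
whole side. -/
theorem aestronglyMeasurable_primitive
    (hk : AEStronglyMeasurable (fun q : ℝ × ℝ => k q.1 q.2)
      ((volume.restrict (Icc 0 l₁)).prod (volume.restrict (Icc 0 l₂))))
    (hσ : Measurable σ) (hσl : ∀ x ∈ Icc (0 : ℝ) l₁, σ x ∈ Icc (0 : ℝ) l₁) :
    AEStronglyMeasurable (fun q : ℝ × ℝ => ∫ ξ in (0 : ℝ)..σ q.1, k ξ q.2)
      ((volume.restrict (Icc 0 l₁)).prod (volume.restrict (Icc 0 l₂))) := by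
  set μ₁ : Measure ℝ := volume.restrict (Icc 0 l₁)
  set μ₂ : Measure ℝ := volume.restrict (Icc 0 l₂)
  have hq : Measure.QuasiMeasurePreserving (fun z : (ℝ × ℝ) × ℝ => (z.2, z.1.2))
      ((μ₁.prod μ₂).prod μ₁) (μ₁.prod μ₂) :=
    Measure.measurePreserving_swap.quasiMeasurePreserving.comp
      (QuasiMeasurePreserving.prodMap Measure.quasiMeasurePreserving_snd
        (Measure.QuasiMeasurePreserving.id μ₁))
  have hm := hk.comp_quasiMeasurePreserving hq
  have hs : MeasurableSet {z : (ℝ × ℝ) × ℝ | z.2 ∈ Ioc 0 (σ z.1.1)} :=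
    (measurableSet_lt measurable_const measurable_snd).inter
      (measurableSet_le measurable_snd (hσ.comp (by fun_prop)))
  have h1 := (hm.indicator hs).integral_prod_right'
  refine h1.congr ?_
  have hmem : ∀ᵐ q ∂(μ₁.prod μ₂), q.1 ∈ Icc 0 l₁ :=
    Measure.quasiMeasurePreserving_fst.ae (ae_restrict_mem measurableSet_Icc)
  filter_upwards [hmem] with q hq
  have h2 := hσl _ hq
  rw [intervalIntegral.integral_of_le h2.1]
  change ∫ y, (Ioc 0 (σ q.1)).indicator (fun ξ => k ξ q.2) y ∂μ₁ = _
  rw [integral_indicator measurableSet_Ioc, Measure.restrict_restrict measurableSet_Ioc,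
    inter_eq_left.2 (show Ioc 0 (σ q.1) ⊆ Icc 0 l₁ from fun y hy => ⟨hy.1.le, hy.2.trans h2.2⟩)]

/-- Almost every section of a square integrable function is square integrable, and Cauchy–Schwarz
applies to it. The bound depends on the second variable only. -/
theorem ae_sq_primitive_le (hk : MemLp (fun q : ℝ × ℝ => k q.1 q.2) 2
      ((volume.restrict (Icc 0 l₁)).prod (volume.restrict (Icc 0 l₂))))
    (hσl : ∀ x ∈ Icc (0 : ℝ) l₁, σ x ∈ Icc (0 : ℝ) l₁) :
    ∀ᵐ q : ℝ × ℝ ∂((volume.restrict (Icc 0 l₁)).prod (volume.restrict (Icc 0 l₂))),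
      (∫ ξ in (0 : ℝ)..σ q.1, k ξ q.2) ^ 2 ≤ l₁ * ∫ ξ in Icc 0 l₁, k ξ q.2 ^ 2 := by
  have h1 : ∀ᵐ t ∂(volume.restrict (Icc 0 l₂)),
      MemLp (fun ξ => k ξ t) 2 (volume.restrict (Icc 0 l₁)) := by
    have hm : ∀ᵐ t ∂(volume.restrict (Icc 0 l₂)),
        AEStronglyMeasurable (fun ξ => k ξ t) (volume.restrict (Icc 0 l₁)) :=
      (hk.integrable one_le_two).prod_left_ae.mono fun t ht => ht.aestronglyMeasurable
    filter_upwards [hm, hk.integrable_sq.prod_left_ae] with t h1 h2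
    exact (memLp_two_iff_integrable_sq h1).2 h2
  filter_upwards [Measure.quasiMeasurePreserving_snd.ae h1,
    Measure.quasiMeasurePreserving_fst.ae (ae_restrict_mem measurableSet_Icc)] with q hq hx
  have h2 := hσl _ hx
  have hl : 0 ≤ l₁ := hx.1.trans hx.2
  have h3 := sq_integral_abs_le hq
  have h4 : (volume.restrict (Icc 0 l₁)).real univ = l₁ := by
    simp [measureReal_def, hl]
  rw [h4] at h3
  refine le_trans ?_ h3
  rw [sq_le_sq, abs_of_nonneg (a := ∫ x in Icc 0 l₁, |k x q.2|)
    (integral_nonneg fun _ => abs_nonneg _), intervalIntegral.integral_of_le h2.1]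
  refine (abs_integral_le_integral_abs).trans ?_
  exact setIntegral_mono_set (hq.integrable one_le_two).abs
    (Eventually.of_forall fun _ => abs_nonneg _)
    (Eventually.of_forall fun y (hy : y ∈ Ioc 0 (σ q.1)) => ⟨hy.1.le, hy.2.trans h2.2⟩)

theorem memLp_primitive (hk : MemLp (fun q : ℝ × ℝ => k q.1 q.2) 2
      ((volume.restrict (Icc 0 l₁)).prod (volume.restrict (Icc 0 l₂))))
    (hσ : Measurable σ) (hσl : ∀ x ∈ Icc (0 : ℝ) l₁, σ x ∈ Icc (0 : ℝ) l₁) :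
    MemLp (fun q : ℝ × ℝ => ∫ ξ in (0 : ℝ)..σ q.1, k ξ q.2) 2
      ((volume.restrict (Icc 0 l₁)).prod (volume.restrict (Icc 0 l₂))) := by
  have h1 := aestronglyMeasurable_primitive hk.aestronglyMeasurable hσ hσl
  refine (memLp_two_iff_integrable_sq h1).2 ?_
  have h2 := (hk.integrable_sq.integral_prod_right.comp_snd (volume.restrict (Icc 0 l₁))).const_mul
    l₁
  refine h2.mono' (h1.pow 2) ?_
  filter_upwards [ae_sq_primitive_le hk hσl] with q hq
  simpa using hq

theorem integral_sq_primitive_le (hl : 0 ≤ l₁) (hk : MemLp (fun q : ℝ × ℝ => k q.1 q.2) 2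
      ((volume.restrict (Icc 0 l₁)).prod (volume.restrict (Icc 0 l₂))))
    (hσ : Measurable σ) (hσl : ∀ x ∈ Icc (0 : ℝ) l₁, σ x ∈ Icc (0 : ℝ) l₁) :
    ∫ q : ℝ × ℝ, (∫ ξ in (0 : ℝ)..σ q.1, k ξ q.2) ^ 2
      ∂((volume.restrict (Icc 0 l₁)).prod (volume.restrict (Icc 0 l₂))) ≤
    l₁ ^ 2 * ∫ q : ℝ × ℝ, k q.1 q.2 ^ 2
      ∂((volume.restrict (Icc 0 l₁)).prod (volume.restrict (Icc 0 l₂))) := by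
  have h2 := (hk.integrable_sq.integral_prod_right.comp_snd (volume.restrict (Icc 0 l₁))).const_mul
    l₁
  refine (integral_mono_ae (memLp_primitive hk hσ hσl).integrable_sq h2
    (ae_sq_primitive_le hk hσl)).trans ?_
  rw [integral_const_mul,
    integral_fun_snd (f := fun t => ∫ x in Icc 0 l₁, k x t ^ 2),
    integral_prod_symm _ hk.integrable_sq]
  simp [measureReal_def, hl]
  rw [pow_two, mul_assoc]

end Box

theorem memLp_primX {T : ℝ} {k : ℝ → ℝ → ℝ}
    (hk : MemLp (fun q : ℝ × ℝ => k q.1 q.2) 2 (volume.restrict (Omega T))) :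
    MemLp (fun q : ℝ × ℝ => primX k q.1 q.2) 2 (volume.restrict (Omega T)) := by
  rw [restrict_Omega] at hk ⊢
  exact memLp_primitive hk measurable_id fun _ h => h

theorem memLp_primX_one {T : ℝ} {k : ℝ → ℝ → ℝ}
    (hk : MemLp (fun q : ℝ × ℝ => k q.1 q.2) 2 (volume.restrict (Omega T))) :
    MemLp (fun q : ℝ × ℝ => primX k 1 q.2) 2 (volume.restrict (Omega T)) := by
  rw [restrict_Omega] at hk ⊢
  exact memLp_primitive hk measurable_const fun _ h => by simp

theorem memLp_primT {T : ℝ} {k : ℝ → ℝ → ℝ}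
    (hk : MemLp (fun q : ℝ × ℝ => k q.1 q.2) 2 (volume.restrict (Omega T))) :
    MemLp (fun q : ℝ × ℝ => primT k q.1 q.2) 2 (volume.restrict (Omega T)) := by
  rw [restrict_Omega] at hk ⊢
  have h1 := hk.comp_measurePreserving Measure.measurePreserving_swap
  have h2 := memLp_primitive (k := fun t x => k x t) h1 measurable_id fun _ h => h
  exact h2.comp_measurePreserving Measure.measurePreserving_swap

theorem isProbabilityMeasure_unit :
    IsProbabilityMeasure ((volume : Measure ℝ).restrict (Icc 0 1)) := ⟨by simp⟩

theorem memLp_of_snd {T : ℝ} {b : ℝ → ℝ} (hb : MemLp b 2 (volume.restrict (Icc 0 T))) :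
    MemLp (fun q : ℝ × ℝ => b q.2) 2 (volume.restrict (Omega T)) := by
  rw [restrict_Omega]
  have := isProbabilityMeasure_unit
  exact hb.comp_measurePreserving measurePreserving_snd

theorem memLp_of_fst {T : ℝ} {a : ℝ → ℝ} (ha : MemLp a 2 (volume.restrict (Icc 0 1))) :
    MemLp (fun q : ℝ × ℝ => a q.1) 2 (volume.restrict (Omega T)) := by
  rw [restrict_Omega]
  exact ha.comp_fst _

/-- The second projection preserves measure because the x-side has length 1; measurability of b is
read off from a single good section. -/
theorem memLp_left_of_memLp_snd {T : ℝ} {b : ℝ → ℝ}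
    (hb : MemLp (fun q : ℝ × ℝ => b q.2) 2 (volume.restrict (Omega T))) :
    MemLp b 2 (volume.restrict (Icc 0 T)) := by
  rw [restrict_Omega] at hb
  have := isProbabilityMeasure_unit
  have hm : AEStronglyMeasurable b (volume.restrict (Icc 0 T)) := by
    have := (hb.integrable one_le_two).prod_right_ae
    obtain ⟨x, hx⟩ := this.exists
    exact hx.aestronglyMeasurable
  rw [← (measurePreserving_snd (μ := volume.restrict (Icc (0 : ℝ) 1))
    (ν := volume.restrict (Icc 0 T))).map_eq] at hm ⊢
  exact (memLp_map_measure_iff hm measurable_snd.aemeasurable).2 hb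

/-! ### The inner product of Ŵ(Ω) and its reproducing kernel -/

theorem integral_Omega_eq {T : ℝ} (hT : 0 ≤ T) {k : ℝ → ℝ → ℝ}
    (hk : IntegrableOn (fun q : ℝ × ℝ => k q.1 q.2) (Omega T)) :
    ∫ q in Omega T, k q.1 q.2 = ∫ x in (0 : ℝ)..1, ∫ t in (0 : ℝ)..T, k x t := by
  rw [IntegrableOn, restrict_Omega] at hk
  rw [restrict_Omega, integral_prod _ hk, intervalIntegral.integral_of_le zero_le_one,
    integral_Icc_eq_integral_Ioc]
  simp_rw [intervalIntegral.integral_of_le hT, integral_Icc_eq_integral_Ioc]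

theorem intervalIntegral_mul_eq_of_ae {l : ℝ} (hl : 0 ≤ l) {f g f' g' : ℝ → ℝ}
    (hf : ∀ᵐ x ∂(volume.restrict (Icc (0 : ℝ) l)), f x = f' x)
    (hg : ∀ᵐ x ∂(volume.restrict (Icc (0 : ℝ) l)), g x = g' x) :
    ∫ x in (0 : ℝ)..l, f x * g x = ∫ x in Icc (0 : ℝ) l, f' x * g' x := by
  rw [intervalIntegral.integral_of_le hl, ← integral_Icc_eq_integral_Ioc]
  refine integral_congr_ae ?_
  filter_upwards [hf, hg] with x h1 h2
  rw [h1, h2]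

theorem iteratedIntegral_mul_eq_of_ae {T : ℝ} (hT : 0 ≤ T) {f g f' g' : ℝ → ℝ → ℝ}
    (hf : ∀ᵐ q ∂(volume.restrict (Omega T)), f q.1 q.2 = f' q.1 q.2)
    (hg : ∀ᵐ q ∂(volume.restrict (Omega T)), g q.1 q.2 = g' q.1 q.2)
    (hf' : MemLp (fun q : ℝ × ℝ => f' q.1 q.2) 2 (volume.restrict (Omega T)))
    (hg' : MemLp (fun q : ℝ × ℝ => g' q.1 q.2) 2 (volume.restrict (Omega T))) :
    ∫ x in (0 : ℝ)..1, ∫ t in (0 : ℝ)..T, f x t * g x t =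
      ∫ q in Omega T, f' q.1 q.2 * g' q.1 q.2 := by
  have h1 : IntegrableOn (fun q : ℝ × ℝ => f' q.1 q.2 * g' q.1 q.2) (Omega T) :=
    hf'.integrable_mul hg'
  have h2 : ∀ᵐ q ∂(volume.restrict (Omega T)), f' q.1 q.2 * g' q.1 q.2 = f q.1 q.2 * g q.1 q.2 := by
    filter_upwards [hf, hg] with q h1 h2
    rw [h1, h2]
  rw [integral_congr_ae h2, integral_Omega_eq hT (k := fun x t => f x t * g x t)]
  exact h1.congr h2

theorem innerHatW_eq {T : ℝ} (hT : 0 < T) {f g : ℝ → ℝ → ℝ} {a b a' b' : ℝ → ℝ}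
    {h h' : ℝ → ℝ → ℝ} (hf : IsL2Primitive T f a b h) (hg : IsL2Primitive T g a' b' h') :
    innerHatW T f g = (∫ t in Icc 0 T, b t * b' t) + (f 0 0 * g 0 0 + ∫ x in Icc 0 1, a x * a' x)
      + ∫ q in Omega T, h q.1 q.2 * h' q.1 q.2 := by
  unfold innerHatW inner1
  rw [intervalIntegral_mul_eq_of_ae hT.le (hf.prim.ae_dt_left hT hf.b_int)
      (hg.prim.ae_dt_left hT hg.b_int),
    iteratedIntegral_mul_eq_of_ae hT.le (hf.prim.ae_dx_dt hT hf.b_int hf.h_int)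
      (hg.prim.ae_dx_dt hT hg.b_int hg.h_int) hf.h_memLp hg.h_memLp,
    ← intervalIntegral_mul_eq_of_ae zero_le_one (hf.prim.ae_dx_bottom hT hf.a_int)
      (hg.prim.ae_dx_bottom hT hg.a_int)]
  rfl

theorem kernelQ_eq {y x : ℝ} (hy : 0 ≤ y) (hx : 0 ≤ x) :
    kernelQ y x = 1 + ∫ ξ in (0 : ℝ)..x, (Ioc 0 y).indicator 1 ξ := by
  rw [intervalIntegral.integral_of_le hx, integral_indicator measurableSet_Ioc,
    Measure.restrict_restrict measurableSet_Ioc, Ioc_inter_Ioc]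
  unfold kernelQ
  split_ifs with h
  · simp [measureReal_def, h, hx]
  · simp [measureReal_def, (not_le.1 h).le, hy]

theorem memLp_indicator_one {l y : ℝ} :
    MemLp ((Ioc 0 y).indicator (1 : ℝ → ℝ)) 2 (volume.restrict (Icc 0 l)) :=
  (memLp_const (1 : ℝ)).indicator measurableSet_Ioc

/-- Each factor 1 + min(·, y) is 1 plus the primitive of the indicator of (0, y]. Pairing with G
thus integrates the data of a function over (0, y], (0, s] and their product, which rebuilds its
value at (y, s). -/
theorem isL2Primitive_kernelG {T : ℝ} {q : ℝ × ℝ} (hq : q ∈ Omega T) :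
    IsL2Primitive T (kernelG q) ((Ioc 0 q.1).indicator 1) ((Ioc 0 q.2).indicator 1)
      (fun x t => (Ioc 0 q.1).indicator 1 x * (Ioc 0 q.2).indicator 1 t) where
  a_memLp := memLp_indicator_one
  b_memLp := memLp_indicator_one
  h_memLp := by
    have : (fun z : ℝ × ℝ => (Ioc 0 q.1).indicator (1 : ℝ → ℝ) z.1 *
        (Ioc 0 q.2).indicator (1 : ℝ → ℝ) z.2) = (Ioc 0 q.1 ×ˢ Ioc 0 q.2).indicator 1 := by
      ext z
      by_cases h1 : z.1 ∈ Ioc 0 q.1 <;> by_cases h2 : z.2 ∈ Ioc 0 q.2 <;>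
        simp [indicator, h1, h2]
    rw [this]
    exact (memLp_const (1 : ℝ)).indicator (measurableSet_Ioc.prod measurableSet_Ioc)
  prim := fun x hx t ht => by
    simp only [kernelG, intervalIntegral.integral_const_mul, intervalIntegral.integral_mul_const]
    rw [kernelQ_eq hq.1.1 hx.1, kernelQ_eq hq.2.1 ht.1, kernelQ_eq hq.1.1 le_rfl,
      kernelQ_eq hq.2.1 le_rfl]
    simp only [intervalIntegral.integral_same]
    ring

/-- The reproducing property of the kernel `G`. -/
theorem innerHatW_kernelG {T : ℝ} (hT : 0 < T) {f : ℝ → ℝ → ℝ} (hf : MemHatW T f) {q : ℝ × ℝ}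
    (hq : q ∈ Omega T) : innerHatW T f (kernelG q) = f q.1 q.2 := by
  obtain ⟨a, b, h, hf⟩ := hf.exists_isL2Primitive hT
  have h1 : ∀ {l y : ℝ} (c : ℝ → ℝ), y ∈ Icc 0 l →
      ∫ x in Icc 0 l, c x * (Ioc 0 y).indicator 1 x = ∫ x in (0 : ℝ)..y, c x := by
    intro l y c hy
    have : ∀ x, c x * (Ioc 0 y).indicator 1 x = (Ioc 0 y).indicator c x := fun x => by
      by_cases hx : x ∈ Ioc 0 y <;> simp [hx]
    simp_rw [this]
    rw [integral_indicator measurableSet_Ioc, Measure.restrict_restrict measurableSet_Ioc,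
      inter_eq_left.2 (show Ioc 0 y ⊆ Icc 0 l from fun z hz => ⟨hz.1.le, hz.2.trans hy.2⟩),
      intervalIntegral.integral_of_le hy.1]
  rw [innerHatW_eq hT hf (isL2Primitive_kernelG hq), h1 _ hq.1, h1 _ hq.2,
    hf.prim _ hq.1 _ hq.2]
  have h2 : ∀ z : ℝ × ℝ, h z.1 z.2 * ((Ioc 0 q.1).indicator 1 z.1 * (Ioc 0 q.2).indicator 1 z.2)
      = (Ioc 0 q.1 ×ˢ Ioc 0 q.2).indicator (fun z => h z.1 z.2) z := fun z => by
    by_cases h1 : z.1 ∈ Ioc 0 q.1 <;> by_cases h2 : z.2 ∈ Ioc 0 q.2 <;> simp [indicator, h1, h2]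
  simp_rw [h2]
  rw [integral_indicator (measurableSet_Ioc.prod measurableSet_Ioc),
    Measure.restrict_restrict (measurableSet_Ioc.prod measurableSet_Ioc), inter_eq_left.2,
    ← primX_primT_eq_setIntegral hf.h_int hq.1 hq.2]
  · simp only [kernelG, kernelQ_eq hq.1.1 le_rfl, kernelQ_eq hq.2.1 le_rfl,
      intervalIntegral.integral_same, primX, primT]
    ring
  · have := uIoc_prod_subset_Omega hq.1 hq.2
    rwa [uIoc_of_le hq.1.1, uIoc_of_le hq.2.1] at this

/-! ### Primitives and the Dirichlet Green operator on continuous functions -/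

/-- The primitive in the first variable, on continuous functions. -/
noncomputable def primXC : C(ℝ × ℝ, ℝ) →ₗ[ℝ] C(ℝ × ℝ, ℝ) where
  toFun g := ⟨fun q => ∫ ξ in (0 : ℝ)..q.1, g (ξ, q.2), by
    exact intervalIntegral.continuous_parametric_intervalIntegral_of_continuous
      (f := fun (q : ℝ × ℝ) ξ => g (ξ, q.2))
      (g.continuous.comp (by fun_prop)) continuous_fst⟩
  map_add' f g := by
    ext q
    exact intervalIntegral.integral_add
      ((f.continuous.comp (by fun_prop : Continuous fun ξ : ℝ => (ξ, q.2))).intervalIntegrable _ _)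
      ((g.continuous.comp (by fun_prop : Continuous fun ξ : ℝ => (ξ, q.2))).intervalIntegrable _ _)
  map_smul' c g := by
    ext q
    exact intervalIntegral.integral_const_mul _ _

/-- The primitive in the second variable, on continuous functions. -/
noncomputable def primTC : C(ℝ × ℝ, ℝ) →ₗ[ℝ] C(ℝ × ℝ, ℝ) where
  toFun g := ⟨fun q => ∫ τ in (0 : ℝ)..q.2, g (q.1, τ), by
    exact intervalIntegral.continuous_parametric_intervalIntegral_of_continuous
      (f := fun (q : ℝ × ℝ) τ => g (q.1, τ))
      (g.continuous.comp (by fun_prop)) continuous_snd⟩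
  map_add' f g := by
    ext q
    exact intervalIntegral.integral_add
      ((f.continuous.comp (by fun_prop : Continuous fun τ : ℝ => (q.1, τ))).intervalIntegrable _ _)
      ((g.continuous.comp (by fun_prop : Continuous fun τ : ℝ => (q.1, τ))).intervalIntegrable _ _)
  map_smul' c g := by
    ext q
    exact intervalIntegral.integral_const_mul _ _

/-- The value at `x = 1`. -/
def evalOneC : C(ℝ × ℝ, ℝ) →ₗ[ℝ] C(ℝ × ℝ, ℝ) where
  toFun g := ⟨fun q => g (1, q.2), by fun_prop⟩
  map_add' f g := rfl
  map_smul' c g := rfl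

/-- Multiplication by `x`. -/
def mulXC : C(ℝ × ℝ, ℝ) →ₗ[ℝ] C(ℝ × ℝ, ℝ) where
  toFun g := ⟨fun q => q.1 * g q, by fun_prop⟩
  map_add' f g := by ext q; exact mul_add _ _ _
  map_smul' c g := by ext q; exact mul_left_comm _ _ _

/-- The solution of `∂²w/∂x² = g` with `w = 0` for `x = 0` and `x = 1`. -/
noncomputable def greenC : C(ℝ × ℝ, ℝ) →ₗ[ℝ] C(ℝ × ℝ, ℝ) :=
  primXC ∘ₗ primXC - mulXC ∘ₗ evalOneC ∘ₗ primXC ∘ₗ primXC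

/-- The derivative in `x` of `greenC`. -/
noncomputable def greenDerivC : C(ℝ × ℝ, ℝ) →ₗ[ℝ] C(ℝ × ℝ, ℝ) :=
  primXC - evalOneC ∘ₗ primXC ∘ₗ primXC

theorem primXC_apply (g : C(ℝ × ℝ, ℝ)) (x t : ℝ) :
    primXC g (x, t) = ∫ ξ in (0 : ℝ)..x, g (ξ, t) := rfl

theorem primTC_apply (g : C(ℝ × ℝ, ℝ)) (x t : ℝ) :
    primTC g (x, t) = ∫ τ in (0 : ℝ)..t, g (x, τ) := rfl

theorem greenC_apply (g : C(ℝ × ℝ, ℝ)) (x t : ℝ) :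
    greenC g (x, t) = primXC (primXC g) (x, t) - x * primXC (primXC g) (1, t) := rfl

theorem greenDerivC_apply (g : C(ℝ × ℝ, ℝ)) (x t : ℝ) :
    greenDerivC g (x, t) = primXC g (x, t) - primXC (primXC g) (1, t) := rfl

theorem hasDerivAt_primXC (g : C(ℝ × ℝ, ℝ)) (x t : ℝ) :
    HasDerivAt (fun y => primXC g (y, t)) (g (x, t)) x :=
  intervalIntegral.integral_hasDerivAt_right
    ((g.continuous.comp (by fun_prop : Continuous fun ξ : ℝ => (ξ, t))).intervalIntegrable _ _)
    ((g.continuous.comp (by fun_prop : Continuous fun ξ : ℝ =>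
      (ξ, t))).stronglyMeasurableAtFilter _ _)
    (g.continuous.comp (by fun_prop : Continuous fun ξ : ℝ => (ξ, t))).continuousAt

theorem hasDerivAt_primTC (g : C(ℝ × ℝ, ℝ)) (x t : ℝ) :
    HasDerivAt (fun s => primTC g (x, s)) (g (x, t)) t :=
  intervalIntegral.integral_hasDerivAt_right
    ((g.continuous.comp (by fun_prop : Continuous fun ξ : ℝ => (x, ξ))).intervalIntegrable _ _)
    ((g.continuous.comp (by fun_prop : Continuous fun ξ : ℝ =>
      (x, ξ))).stronglyMeasurableAtFilter _ _)
    (g.continuous.comp (by fun_prop : Continuous fun ξ : ℝ => (x, ξ))).continuousAt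

theorem primXC_primTC (g : C(ℝ × ℝ, ℝ)) : primXC (primTC g) = primTC (primXC g) := by
  ext ⟨x, t⟩
  refine intervalIntegral_intervalIntegral_swap (F := fun x t => g (x, t)) ?_
  exact (g.continuous.continuousOn.integrableOn_compact
    (isCompact_uIcc.prod isCompact_uIcc)).mono_set (prod_mono uIoc_subset_uIcc uIoc_subset_uIcc)

theorem evalOneC_primTC (g : C(ℝ × ℝ, ℝ)) : evalOneC (primTC g) = primTC (evalOneC g) := rfl

theorem mulXC_primTC (g : C(ℝ × ℝ, ℝ)) : mulXC (primTC g) = primTC (mulXC g) := by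
  ext ⟨x, t⟩
  exact (intervalIntegral.integral_const_mul _ _).symm

theorem greenC_primTC (g : C(ℝ × ℝ, ℝ)) : greenC (primTC g) = primTC (greenC g) := by
  simp only [greenC, LinearMap.sub_apply, LinearMap.comp_apply, primXC_primTC, evalOneC_primTC,
    mulXC_primTC, map_sub]

theorem hasDerivAt_greenC (g : C(ℝ × ℝ, ℝ)) (x t : ℝ) :
    HasDerivAt (fun y => greenC g (y, t)) (greenDerivC g (x, t)) x := by
  have := (hasDerivAt_primXC (primXC g) x t).sub
    ((hasDerivAt_id x).mul_const (primXC (primXC g) (1, t)))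
  rw [one_mul] at this
  exact this

theorem hasDerivAt_greenDerivC (g : C(ℝ × ℝ, ℝ)) (x t : ℝ) :
    HasDerivAt (fun y => greenDerivC g (y, t)) (g (x, t)) x :=
  (hasDerivAt_primXC g x t).sub_const (primXC (primXC g) (1, t))

theorem greenC_zero (g : C(ℝ × ℝ, ℝ)) (t : ℝ) : greenC g (0, t) = 0 := by
  simp [greenC_apply, primXC_apply]

theorem greenC_one (g : C(ℝ × ℝ, ℝ)) (t : ℝ) : greenC g (1, t) = 0 := by
  simp [greenC_apply]

theorem primTC_zero (g : C(ℝ × ℝ, ℝ)) (x : ℝ) : primTC g (x, 0) = 0 := by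
  simp [primTC_apply]

/-! ### Recovering a function from its derivative ∂x²∂t²u -/

/-- A family `u i j` that behaves like the derivatives `∂^{i+j}u/∂x^i∂t^j` of a function with
homogeneous initial and boundary values. -/
structure IsDerivFamily (T : ℝ) (u : ℕ → ℕ → ℝ → ℝ → ℝ) : Prop where
  deriv_t : ∀ j < 2, ∀ x ∈ Icc (0 : ℝ) 1, ∀ t ∈ Icc (0 : ℝ) T,
    HasDerivWithinAt (u 0 j x) (u 0 (j + 1) x t) (Icc 0 T) t
  deriv_x : ∀ i < 2, ∀ j ≤ 2, ∀ x ∈ Icc (0 : ℝ) 1, ∀ t ∈ Icc (0 : ℝ) T,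
    HasDerivWithinAt (fun y => u i j y t) (u (i + 1) j x t) (Icc 0 1) x
  initial : ∀ x ∈ Icc (0 : ℝ) 1, u 0 0 x 0 = 0 ∧ u 0 1 x 0 = 0
  boundary : ∀ t ∈ Icc (0 : ℝ) T, u 0 0 0 t = 0 ∧ u 0 0 1 t = 0

theorem dx_congr {T : ℝ} {f g : ℝ → ℝ → ℝ}
    (h : ∀ x ∈ Icc (0 : ℝ) 1, ∀ t ∈ Icc (0 : ℝ) T, f x t = g x t) :
    ∀ x ∈ Icc (0 : ℝ) 1, ∀ t ∈ Icc (0 : ℝ) T, dx f x t = dx g x t := fun x hx t ht =>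
  derivWithin_congr (fun y hy => h y hy t ht) (h x hx t ht)

theorem dt_congr {T : ℝ} {f g : ℝ → ℝ → ℝ}
    (h : ∀ x ∈ Icc (0 : ℝ) 1, ∀ t ∈ Icc (0 : ℝ) T, f x t = g x t) :
    ∀ x ∈ Icc (0 : ℝ) 1, ∀ t ∈ Icc (0 : ℝ) T, dt T f x t = dt T g x t := fun x hx t ht =>
  derivWithin_congr (fun s hs => h x hx s hs) (h x hx t ht)

theorem D_succ_left (T : ℝ) (i j : ℕ) (u : ℝ → ℝ → ℝ) : D T (i + 1) j u = dx (D T i j u) :=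
  Function.iterate_succ_apply' _ _ _

theorem D_zero_succ (T : ℝ) (j : ℕ) (u : ℝ → ℝ → ℝ) : D T 0 (j + 1) u = dt T (D T 0 j u) :=
  Function.iterate_succ_apply' _ _ _

theorem D_congr {T : ℝ} {f g : ℝ → ℝ → ℝ}
    (h : ∀ x ∈ Icc (0 : ℝ) 1, ∀ t ∈ Icc (0 : ℝ) T, f x t = g x t) (i j : ℕ) :
    ∀ x ∈ Icc (0 : ℝ) 1, ∀ t ∈ Icc (0 : ℝ) T, D T i j f x t = D T i j g x t := by
  induction i with
  | zero =>
    induction j with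
    | zero => exact h
    | succ j ih => rw [D_zero_succ, D_zero_succ]; exact dt_congr ih
  | succ i ih => rw [D_succ_left, D_succ_left]; exact dx_congr ih

theorem eq_of_hasDerivWithinAt_zero {l : ℝ} (hl : 0 < l) {g : ℝ → ℝ}
    (h : ∀ x ∈ Icc (0 : ℝ) l, HasDerivWithinAt g 0 (Icc 0 l) x) :
    ∀ x ∈ Icc (0 : ℝ) l, g x = g 0 :=
  constant_of_derivWithin_zero (fun x hx => (h x hx).differentiableWithinAt) fun x hx =>
    (h x ⟨hx.1, hx.2.le⟩).derivWithin (uniqueDiffOn_Icc hl x ⟨hx.1, hx.2.le⟩)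

namespace IsDerivFamily

variable {T : ℝ} {u w : ℕ → ℕ → ℝ → ℝ → ℝ}

theorem sub (hu : IsDerivFamily T u) (hw : IsDerivFamily T w) :
    IsDerivFamily T (fun i j x t => u i j x t - w i j x t) where
  deriv_t j hj x hx t ht := (hu.deriv_t j hj x hx t ht).sub (hw.deriv_t j hj x hx t ht)
  deriv_x i hi j hj x hx t ht := (hu.deriv_x i hi j hj x hx t ht).sub (hw.deriv_x i hi j hj x hx t ht)
  initial x hx := by simp [hu.initial x hx, hw.initial x hx]
  boundary t ht := by simp [hu.boundary t ht, hw.boundary t ht]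

theorem D_eq (hu : IsDerivFamily T u) (hT : 0 < T) {i j : ℕ} (hi : i ≤ 2) (hj : j ≤ 2) :
    ∀ x ∈ Icc (0 : ℝ) 1, ∀ t ∈ Icc (0 : ℝ) T, D T i j (u 0 0) x t = u i j x t := by
  induction i with
  | zero =>
    induction j with
    | zero => exact fun _ _ _ _ => rfl
    | succ j ih =>
      intro x hx t ht
      rw [D_zero_succ, dt_congr (ih (by omega)) x hx t ht]
      exact (hu.deriv_t j (by omega) x hx t ht).derivWithin (uniqueDiffOn_Icc hT t ht)
  | succ i ih =>
    intro x hx t ht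
    rw [D_succ_left, dx_congr (ih (by omega)) x hx t ht]
    exact (hu.deriv_x i (by omega) j hj x hx t ht).derivWithin (uniqueDiffOn_Icc one_pos x hx)

/-- The boundary condition holds for all t and may be differentiated in t. -/
theorem boundary_zero (hu : IsDerivFamily T u) (hT : 0 < T) {x : ℝ} (hx : x = 0 ∨ x = 1) {j : ℕ}
    (hj : j ≤ 2) : ∀ t ∈ Icc (0 : ℝ) T, u 0 j x t = 0 := by
  have hxm : x ∈ Icc (0 : ℝ) 1 := by rcases hx with rfl | rfl <;> simp
  induction j with
  | zero =>
    intro t ht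
    rcases hx with rfl | rfl
    exacts [(hu.boundary t ht).1, (hu.boundary t ht).2]
  | succ j ih =>
    intro t ht
    have h1 := hu.deriv_t j (by omega) x hxm t ht
    have h2 : HasDerivWithinAt (u 0 j x) 0 (Icc 0 T) t :=
      (hasDerivWithinAt_const t (Icc 0 T) (0 : ℝ)).congr_of_mem (ih (by omega)) ht
    exact (uniqueDiffOn_Icc hT t ht).eq_deriv _ h1 h2

/-- For fixed t the function ∂t²u is affine in x and vanishes at both ends, so it is zero; the
initial conditions then remove ∂tu and u in turn. -/
theorem eq_zero (hu : IsDerivFamily T u) (hT : 0 < T)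
    (h22 : ∀ x ∈ Icc (0 : ℝ) 1, ∀ t ∈ Icc (0 : ℝ) T, u 2 2 x t = 0) :
    ∀ x ∈ Icc (0 : ℝ) 1, ∀ t ∈ Icc (0 : ℝ) T, u 0 0 x t = 0 := by
  have h02 : ∀ x ∈ Icc (0 : ℝ) 1, ∀ t ∈ Icc (0 : ℝ) T, u 0 2 x t = 0 := by
    intro x hx t ht
    have h1 : ∀ x ∈ Icc (0 : ℝ) 1, u 1 2 x t = u 1 2 0 t :=
      eq_of_hasDerivWithinAt_zero one_pos (g := fun x => u 1 2 x t) fun x hx => by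
        have := hu.deriv_x 1 (by norm_num) 2 le_rfl x hx t ht
        rwa [h22 x hx t ht] at this
    have h2 : ∀ x ∈ Icc (0 : ℝ) 1, u 0 2 x t - x * u 1 2 0 t = u 0 2 0 t - 0 * u 1 2 0 t :=
      eq_of_hasDerivWithinAt_zero one_pos (g := fun x => u 0 2 x t - x * u 1 2 0 t)
        fun x hx => by
          have h3 := (hu.deriv_x 0 (by norm_num) 2 le_rfl x hx t ht).sub
            ((hasDerivWithinAt_id x (Icc 0 1)).mul_const (u 1 2 0 t))
          rw [zero_add, h1 x hx, one_mul, sub_self] at h3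
          exact h3
    have h4 := h2 1 (by simp)
    have h5 := h2 x hx
    rw [hu.boundary_zero hT (Or.inl rfl) le_rfl t ht] at h4 h5
    rw [hu.boundary_zero hT (Or.inr rfl) le_rfl t ht] at h4
    have h6 : u 1 2 0 t = 0 := by linarith
    rw [h6] at h5
    linarith
  have h01 : ∀ x ∈ Icc (0 : ℝ) 1, ∀ t ∈ Icc (0 : ℝ) T, u 0 1 x t = 0 := by
    intro x hx t ht
    rw [eq_of_hasDerivWithinAt_zero hT (g := u 0 1 x) (fun t ht => by
      have := hu.deriv_t 1 (by norm_num) x hx t ht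
      rwa [h02 x hx t ht] at this) t ht]
    exact (hu.initial x hx).2
  intro x hx t ht
  rw [eq_of_hasDerivWithinAt_zero hT (g := u 0 0 x) (fun t ht => by
    have := hu.deriv_t 0 (by norm_num) x hx t ht
    rwa [h01 x hx t ht] at this) t ht]
  exact (hu.initial x hx).1

end IsDerivFamily

/-- The function in `W(Ω)` with `∂⁴u/∂x²∂t² = F`, with its derivatives. -/
noncomputable def reconFamily (F : C(ℝ × ℝ, ℝ)) (i j : ℕ) : C(ℝ × ℝ, ℝ) :=
  match i with
  | 0 => greenC (primTC^[2 - j] F)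
  | 1 => greenDerivC (primTC^[2 - j] F)
  | _ => primTC^[2 - j] F

theorem isDerivFamily_recon (T : ℝ) (F : C(ℝ × ℝ, ℝ)) :
    IsDerivFamily T (fun i j x t => reconFamily F i j (x, t)) where
  deriv_t j hj x _ t _ := by
    refine HasDerivAt.hasDerivWithinAt ?_
    interval_cases j
    · simp only [reconFamily, Nat.sub_zero, Function.iterate_succ_apply, Function.iterate_zero_apply]
      rw [greenC_primTC]
      exact hasDerivAt_primTC _ x t
    · change HasDerivAt (fun s => greenC (primTC F) (x, s)) (greenC F (x, t)) t
      rw [greenC_primTC]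
      exact hasDerivAt_primTC _ x t
  deriv_x i hi j _ x _ t _ := by
    refine HasDerivAt.hasDerivWithinAt ?_
    interval_cases i
    · exact hasDerivAt_greenC _ x t
    · exact hasDerivAt_greenDerivC _ x t
  initial x _ := by
    constructor
    · change greenC (primTC (primTC F)) (x, 0) = 0
      rw [greenC_primTC, primTC_zero]
    · change greenC (primTC F) (x, 0) = 0
      rw [greenC_primTC, primTC_zero]
  boundary t _ := ⟨greenC_zero _ t, greenC_one _ t⟩

/-- The function in `W(Ω)` with `∂⁴u/∂x²∂t² = F`. -/
noncomputable def recon (F : C(ℝ × ℝ, ℝ)) : ℝ → ℝ → ℝ := fun x t => greenC (primTC (primTC F)) (x, t)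

theorem IsDerivFamily.eq_recon {T : ℝ} {u : ℕ → ℕ → ℝ → ℝ → ℝ} (hu : IsDerivFamily T u)
    (hT : 0 < T) {F : C(ℝ × ℝ, ℝ)}
    (hF : ∀ x ∈ Icc (0 : ℝ) 1, ∀ t ∈ Icc (0 : ℝ) T, u 2 2 x t = F (x, t)) :
    ∀ x ∈ Icc (0 : ℝ) 1, ∀ t ∈ Icc (0 : ℝ) T, u 0 0 x t = recon F x t := fun x hx t ht =>
  sub_eq_zero.1 ((hu.sub (isDerivFamily_recon T F)).eq_zero hT
    (fun x hx t ht => sub_eq_zero.2 (hF x hx t ht)) x hx t ht)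

theorem D_recon {T : ℝ} (hT : 0 < T) (F : C(ℝ × ℝ, ℝ)) {i j : ℕ} (hi : i ≤ 2) (hj : j ≤ 2) :
    ∀ x ∈ Icc (0 : ℝ) 1, ∀ t ∈ Icc (0 : ℝ) T, D T i j (recon F) x t = reconFamily F i j (x, t) :=
  (isDerivFamily_recon T F).D_eq hT hi hj

theorem MemW.isDerivFamily {T : ℝ} {u : ℝ → ℝ → ℝ} (hu : MemW T u) :
    IsDerivFamily T (fun i j => D T i j u) where
  deriv_t j hj x hx t ht := by
    simp only [D_zero_succ]
    exact (hu.diff_t j hj x hx t ht).hasDerivWithinAt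
  deriv_x i hi j hj x hx t ht := by
    simp only [D_succ_left]
    exact (hu.diff_x i hi j hj x hx t ht).hasDerivWithinAt
  initial := hu.initial
  boundary := hu.boundary

theorem iteratedDerivWithin_three (T : ℝ) (j : ℕ) (u : ℝ → ℝ → ℝ) :
    iteratedDerivWithin 3 (fun x => D T 0 j u x 0) (Icc 0 1) = fun x => dx (D T 2 j u) x 0 := by
  ext x
  rw [iteratedDerivWithin_eq_iterate]
  rfl

theorem MemW.memHatW {T : ℝ} {u : ℝ → ℝ → ℝ} (hu : MemW T u) : MemHatW T (D T 2 2 u) where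
  completelyContinuous := hu.completelyContinuous
  memLp_top := hu.memLp_top
  memLp_left := hu.memLp_left 2 le_rfl
  memLp_bottom := by
    have := hu.memLp_bottom 2 le_rfl
    rwa [iteratedDerivWithin_three] at this

/-! ### Calculus of square integrable double primitives -/

section Sub

variable {T : ℝ} {f g : ℝ → ℝ → ℝ} {a b a' b' : ℝ → ℝ} {h h' : ℝ → ℝ → ℝ}

theorem intervalIntegrable_of_integrableOn_Icc {l x : ℝ} {a : ℝ → ℝ} (ha : IntegrableOn a (Icc 0 l))
    (hx : x ∈ Icc 0 l) : IntervalIntegrable a volume 0 x :=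
  (intervalIntegrable_iff_integrableOn_Icc_of_le hx.1).2 (ha.mono_set (Icc_subset_Icc_right hx.2))

theorem IsL2Primitive.sub (hf : IsL2Primitive T f a b h) (hg : IsL2Primitive T g a' b' h') :
    IsL2Primitive T (fun x t => f x t - g x t) (fun x => a x - a' x) (fun t => b t - b' t)
      (fun x t => h x t - h' x t) where
  a_memLp := hf.a_memLp.sub hg.a_memLp
  b_memLp := hf.b_memLp.sub hg.b_memLp
  h_memLp := hf.h_memLp.sub hg.h_memLp
  prim x hx t ht := by
    have h1 : primX (primT (fun x t => h x t - h' x t)) x t =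
        primX (primT h) x t - primX (primT h') x t := by
      rw [primX_primT_eq_setIntegral hf.h_int hx ht, primX_primT_eq_setIntegral hg.h_int hx ht,
        primX_primT_eq_setIntegral (hf.h_int.sub hg.h_int) hx ht]
      have hs := uIoc_prod_subset_Omega hx ht
      rw [uIoc_of_le hx.1, uIoc_of_le ht.1] at hs
      exact integral_sub (hf.h_int.mono_set hs) (hg.h_int.mono_set hs)
    simp only [primX, primT] at h1
    rw [h1, intervalIntegral.integral_sub (intervalIntegrable_of_integrableOn_Icc hf.a_int hx)
      (intervalIntegrable_of_integrableOn_Icc hg.a_int hx),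
      intervalIntegral.integral_sub (intervalIntegrable_of_integrableOn_Icc hf.b_int ht)
      (intervalIntegrable_of_integrableOn_Icc hg.b_int ht)]
    beta_reduce
    rw [hf.prim x hx t ht, hg.prim x hx t ht]
    ring

theorem IsL2Primitive.congr (hf : IsL2Primitive T f a b h) (hT : 0 ≤ T)
    (hfg : ∀ x ∈ Icc (0 : ℝ) 1, ∀ t ∈ Icc (0 : ℝ) T, g x t = f x t) :
    IsL2Primitive T g a b h where
  a_memLp := hf.a_memLp
  b_memLp := hf.b_memLp
  h_memLp := hf.h_memLp
  prim x hx t ht := by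
    rw [hfg x hx t ht, hfg 0 (by simp) 0 (by simp [hT])]
    exact hf.prim x hx t ht

/-- The derivative in `t` of a double primitive. -/
noncomputable def primDt (b : ℝ → ℝ) (h : ℝ → ℝ → ℝ) : ℝ → ℝ → ℝ := fun x t => b t + primX h x t

/-- The derivative in `x` of a double primitive. -/
noncomputable def primDx (a : ℝ → ℝ) (h : ℝ → ℝ → ℝ) : ℝ → ℝ → ℝ := fun x t => a x + primT h x t

theorem IsL2Primitive.memLp_primDt (hf : IsL2Primitive T f a b h) :
    MemLp (fun q : ℝ × ℝ => primDt b h q.1 q.2) 2 (volume.restrict (Omega T)) :=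
  (memLp_of_snd hf.b_memLp).add (memLp_primX hf.h_memLp)

theorem IsL2Primitive.memLp_primDx (hf : IsL2Primitive T f a b h) :
    MemLp (fun q : ℝ × ℝ => primDx a h q.1 q.2) 2 (volume.restrict (Omega T)) :=
  (memLp_of_fst hf.a_memLp).add (memLp_primT hf.h_memLp)

theorem integrableOn_primX (hh : IntegrableOn (fun q : ℝ × ℝ => h q.1 q.2) (Omega T)) {x : ℝ}
    (hx : x ∈ Icc (0 : ℝ) 1) : IntegrableOn (primX h x) (Icc 0 T) :=
  (integrable_primitive_fst (integrable_zeroExt hh) x).integrableOn.congr_fun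
    (fun _ ht => primX_congr (fun _ hx _ ht => zeroExt_of_mem hx ht) hx ht) measurableSet_Icc

theorem integrableOn_primT (hh : IntegrableOn (fun q : ℝ × ℝ => h q.1 q.2) (Omega T)) {t : ℝ}
    (ht : t ∈ Icc (0 : ℝ) T) : IntegrableOn (fun x => primT h x t) (Icc 0 1) := by
  have h1 : Integrable (fun q : ℝ × ℝ => zeroExt T h q.2 q.1) := (integrable_zeroExt hh).swap
  exact (integrable_primitive_fst (h := fun t x => zeroExt T h x t) h1 t).integrableOn.congr_fun
    (fun _ hx => primT_congr (fun _ hx _ ht => zeroExt_of_mem hx ht) hx ht) measurableSet_Icc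

/-- Reading the double primitive as a single primitive in t, with density ∂tf, is what allows
integration in x under the t-integral. -/
theorem IsL2Primitive.eq_add_primT (hf : IsL2Primitive T f a b h) {x t : ℝ}
    (hx : x ∈ Icc (0 : ℝ) 1) (ht : t ∈ Icc (0 : ℝ) T) :
    f x t = f x 0 + primT (primDt b h) x t := by
  have h1 : primT (primDt b h) x t = (∫ τ in (0 : ℝ)..t, b τ) + primT (primX h) x t :=
    intervalIntegral.integral_add (intervalIntegrable_of_integrableOn_Icc hf.b_int ht)
      (intervalIntegrable_of_integrableOn_Icc (integrableOn_primX hf.h_int hx) ht)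
  rw [h1, ← primX_primT_comm hf.h_int hx ht, hf.prim x hx t ht,
    hf.prim x hx 0 ⟨le_rfl, ht.1.trans ht.2⟩]
  simp only [intervalIntegral.integral_same, intervalIntegral.integral_zero, primX, primT]
  ring

theorem IsL2Primitive.eq_add_primX (hf : IsL2Primitive T f a b h) {x t : ℝ}
    (hx : x ∈ Icc (0 : ℝ) 1) (ht : t ∈ Icc (0 : ℝ) T) :
    f x t = f 0 t + primX (primDx a h) x t := by
  have h1 : primX (primDx a h) x t = (∫ τ in (0 : ℝ)..x, a τ) + primX (primT h) x t :=
    intervalIntegral.integral_add (intervalIntegrable_of_integrableOn_Icc hf.a_int hx)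
      (intervalIntegrable_of_integrableOn_Icc (integrableOn_primT hf.h_int ht) hx)
  rw [h1, hf.prim x hx t ht, hf.prim 0 (by simp) t ht]
  simp only [intervalIntegral.integral_same, primX, primT]
  ring

end Sub

theorem primXC_sub_eq {g : C(ℝ × ℝ, ℝ)} {T : ℝ} {k : ℝ → ℝ → ℝ}
    (hg : ∀ x ∈ Icc (0 : ℝ) 1, ∀ t ∈ Icc (0 : ℝ) T, g (x, t) = g (x, 0) + primT k x t)
    {x t : ℝ} (hx : x ∈ Icc (0 : ℝ) 1) (ht : t ∈ Icc (0 : ℝ) T) :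
    primXC g (x, t) = primXC g (x, 0) + primX (primT k) x t := by
  have h1 : primX (primT k) x t = ∫ ξ in (0 : ℝ)..x, (g (ξ, t) - g (ξ, 0)) := by
    refine intervalIntegral.integral_congr fun ξ hξ => ?_
    rw [uIcc_of_le hx.1] at hξ
    simp only [hg ξ ⟨hξ.1, hξ.2.trans hx.2⟩ t ht]
    ring
  rw [h1, intervalIntegral.integral_sub]
  · simp only [primXC_apply]; ring
  · exact (g.continuous.comp (by fun_prop : Continuous fun ξ : ℝ => (ξ, t))).intervalIntegrable _ _
  · exact (g.continuous.comp (by fun_prop : Continuous fun ξ : ℝ =>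
      (ξ, (0 : ℝ)))).intervalIntegrable _ _

theorem primXC_eq {g : C(ℝ × ℝ, ℝ)} {T : ℝ} {k : ℝ → ℝ → ℝ}
    (hk : IntegrableOn (fun q : ℝ × ℝ => k q.1 q.2) (Omega T))
    (hg : ∀ x ∈ Icc (0 : ℝ) 1, ∀ t ∈ Icc (0 : ℝ) T, g (x, t) = g (x, 0) + primT k x t) :
    ∀ x ∈ Icc (0 : ℝ) 1, ∀ t ∈ Icc (0 : ℝ) T,
      primXC g (x, t) = primXC g (x, 0) + primT (primX k) x t := fun x hx t ht => by
  rw [primXC_sub_eq hg hx ht, primX_primT_comm hk hx ht]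

theorem primTC_eq {g : C(ℝ × ℝ, ℝ)} {T : ℝ} {k : ℝ → ℝ → ℝ}
    (hk : IntegrableOn (fun q : ℝ × ℝ => k q.1 q.2) (Omega T))
    (hg : ∀ x ∈ Icc (0 : ℝ) 1, ∀ t ∈ Icc (0 : ℝ) T, g (x, t) = g (0, t) + primX k x t) :
    ∀ x ∈ Icc (0 : ℝ) 1, ∀ t ∈ Icc (0 : ℝ) T,
      primTC g (x, t) = primTC g (0, t) + primX (primT k) x t := fun x hx t ht => by
  have h1 : primT (primX k) x t = ∫ τ in (0 : ℝ)..t, (g (x, τ) - g (0, τ)) := by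
    refine intervalIntegral.integral_congr fun τ hτ => ?_
    rw [uIcc_of_le ht.1] at hτ
    simp only [hg x hx τ ⟨hτ.1, hτ.2.trans ht.2⟩]
    ring
  rw [primX_primT_comm hk hx ht, h1, intervalIntegral.integral_sub]
  · simp only [primTC_apply]; ring
  · exact (g.continuous.comp (by fun_prop : Continuous fun ξ : ℝ => (x, ξ))).intervalIntegrable _ _
  · exact (g.continuous.comp (by fun_prop : Continuous fun ξ : ℝ =>
      ((0 : ℝ), ξ))).intervalIntegrable _ _

theorem memLp_of_continuous {l : ℝ} {g : ℝ → ℝ} (hg : Continuous g) :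
    MemLp g 2 (volume.restrict (Icc 0 l)) := by
  obtain ⟨C, hC⟩ := isCompact_Icc.exists_bound_of_continuousOn (s := Icc 0 l) hg.continuousOn
  refine (memLp_const C).of_le hg.aestronglyMeasurable ?_
  filter_upwards [ae_restrict_mem measurableSet_Icc] with x hx
  exact (hC x hx).trans (le_abs_self C)

/-! ### The reconstructed functions lie in W(Ω), and their inner products -/

section Recon

variable {T : ℝ} {F : C(ℝ × ℝ, ℝ)} {a b : ℝ → ℝ} {h : ℝ → ℝ → ℝ}

theorem memLp_primX_one_left {k : ℝ → ℝ → ℝ}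
    (hk : MemLp (fun q : ℝ × ℝ => k q.1 q.2) 2 (volume.restrict (Omega T))) :
    MemLp (fun t => primX k 1 t) 2 (volume.restrict (Icc 0 T)) :=
  memLp_left_of_memLp_snd (memLp_primX_one hk)

/-- The double x-primitive of F has mixed derivative ∫₀ˣ ∂tF and vanishes on x = 0. The x-linear
correction has a mixed derivative depending on t alone, which is the reason for the L² bound of the
integral over the full side. -/
theorem isL2Primitive_greenC (hF : IsL2Primitive T (fun x t => F (x, t)) a b h) :
    ∃ a' b' h', IsL2Primitive T (fun x t => greenC F (x, t)) a' b' h' := by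
  have hk := hF.memLp_primDt
  have hk1 := memLp_primX hk
  have hk2 := memLp_primX_one_left hk1
  have e1 := primXC_eq (hk.integrable one_le_two) (fun x hx t ht => hF.eq_add_primT hx ht)
  have h1 : IsL2Primitive T (fun x t => primXC (primXC F) (x, t)) (fun x => primXC F (x, 0))
      (fun _ => 0) (primX (primDt b h)) :=
    { a_memLp := memLp_of_continuous (by fun_prop)
      b_memLp := memLp_const 0
      h_memLp := hk1
      prim := fun x hx t ht => by
        beta_reduce
        rw [primXC_sub_eq e1 hx ht]
        simp [primXC_apply, primX, primT] }
  have e2 := primXC_eq (hk1.integrable one_le_two) e1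
  have h2 : IsL2Primitive T (fun x t => x * primXC (primXC F) (1, t))
      (fun x => primXC (primXC F) (1, 0)) (fun _ => 0)
      (fun _ t => primX (primX (primDt b h)) 1 t) :=
    { a_memLp := memLp_const _
      b_memLp := memLp_const 0
      h_memLp := memLp_of_snd hk2
      prim := fun x hx t ht => by
        beta_reduce
        rw [e2 1 (by simp) t ht]
        simp only [intervalIntegral.integral_const, smul_eq_mul, primT]
        ring }
  exact ⟨_, _, _, h1.sub h2⟩

theorem isL2Primitive_primTC (hF : IsL2Primitive T (fun x t => F (x, t)) a b h) :
    ∃ a' b' h', IsL2Primitive T (fun x t => primTC (primTC F) (x, t)) a' b' h' := by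
  have hk := hF.memLp_primDx
  have hk1 := memLp_primT hk
  have e1 := primTC_eq (hk.integrable one_le_two) (fun x hx t ht => hF.eq_add_primX hx ht)
  have e2 := primTC_eq (hk1.integrable one_le_two) e1
  refine ⟨fun _ => 0, fun t => primTC F (0, t), primT (primDx a h),
    ⟨memLp_const 0, memLp_of_continuous (by fun_prop), hk1, fun x hx t ht => ?_⟩⟩
  rw [e2 x hx t ht]
  simp [primTC_apply, primX, primT]

theorem waveOp_recon (hT : 0 < T) (F : C(ℝ × ℝ, ℝ)) :
    ∀ x ∈ Icc (0 : ℝ) 1, ∀ t ∈ Icc (0 : ℝ) T,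
      waveOp T (recon F) x t = greenC F (x, t) - primTC (primTC F) (x, t) := fun x hx t ht => by
  unfold waveOp
  rw [D_recon hT F (by norm_num) le_rfl x hx t ht, D_recon hT F le_rfl (by norm_num) x hx t ht]
  rfl

/-- Both terms of Lu integrate F twice in one variable, and such integrations preserve square
integrable data; this is why L maps into Ŵ(Ω). -/
theorem memHatW_waveOp_recon (hF : IsL2Primitive T (fun x t => F (x, t)) a b h) (hT : 0 < T) :
    MemHatW T (waveOp T (recon F)) := by
  obtain ⟨_, _, _, h1⟩ := isL2Primitive_greenC hF
  obtain ⟨_, _, _, h2⟩ := isL2Primitive_primTC hF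
  exact ((h1.sub h2).congr hT.le (waveOp_recon hT F)).memHatW hT

/-- The derivative in `t` of `∂³u/∂x∂t²(0,t)`, in terms of the data of `∂⁴u/∂x²∂t²`. -/
noncomputable def slopeData (b : ℝ → ℝ) (h : ℝ → ℝ → ℝ) : ℝ → ℝ :=
  fun t => -primX (primX (primDt b h)) 1 t

theorem memLp_slopeData (hF : IsL2Primitive T (fun x t => F (x, t)) a b h) :
    MemLp (slopeData b h) 2 (volume.restrict (Icc 0 T)) :=
  (memLp_primX_one_left (memLp_primX hF.memLp_primDt)).neg

theorem dt_recon_zero (hT : 0 < T) {t : ℝ} (ht : t ∈ Icc 0 T) : dt T (D T 0 2 (recon F)) 0 t = 0 := by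
  rw [dt_congr (D_recon hT F (by norm_num) le_rfl) 0 (by simp) t ht]
  have : ∀ s, reconFamily F 0 2 (0, s) = 0 := fun s => greenC_zero _ _
  simp [dt, this]

/-- At x = 0 only the correction term of the Green operator contributes to the slope, namely minus
the double x-primitive of F at x = 1; differentiating it in t replaces F by ∂tF. -/
theorem ae_dt_recon_one (hF : IsL2Primitive T (fun x t => F (x, t)) a b h) (hT : 0 < T) :
    ∀ᵐ t ∂(volume.restrict (Icc 0 T)), dt T (D T 1 2 (recon F)) 0 t = slopeData b h t := by
  have hk := hF.memLp_primDt
  have hk1 := memLp_primX hk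
  have e2 := primXC_eq (hk1.integrable one_le_two)
    (primXC_eq (hk.integrable one_le_two) (fun x hx t ht => hF.eq_add_primT hx ht))
  have h1 : ∀ t ∈ Icc (0 : ℝ) T, D T 1 2 (recon F) 0 t = greenDerivC F (0, 0) +
      ∫ τ in (0 : ℝ)..t, slopeData b h τ := fun t ht => by
    rw [D_recon hT F (by norm_num) le_rfl 0 (by simp) t ht]
    change greenDerivC F (0, t) = _
    rw [greenDerivC_apply, greenDerivC_apply, e2 1 (by simp) t ht]
    simp only [slopeData, intervalIntegral.integral_neg, primT, primXC_apply,
      intervalIntegral.integral_same]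
    ring
  filter_upwards [ae_hasDerivWithinAt_of_primitive hT
    ((memLp_slopeData hF).integrable one_le_two) h1, ae_restrict_mem measurableSet_Icc] with t ht htm
  exact ht.derivWithin (uniqueDiffOn_Icc hT t htm)

theorem isL2Primitive_D_recon (hF : IsL2Primitive T (fun x t => F (x, t)) a b h) (hT : 0 < T) :
    IsL2Primitive T (D T 2 2 (recon F)) a b h :=
  hF.congr hT.le (D_recon hT F le_rfl le_rfl)

theorem D_recon_initial (hT : 0 < T) {i j : ℕ} (hi : i ≤ 2) (hj : j < 2) {x : ℝ}
    (hx : x ∈ Icc (0 : ℝ) 1) : D T i j (recon F) x 0 = 0 := by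
  have h0 : (0 : ℝ) ∈ Icc 0 T := left_mem_Icc.2 hT.le
  have hz : ∀ x ∈ Icc (0 : ℝ) 1, D T 0 j (recon F) x 0 = 0 := by
    intro x hx
    rw [D_recon hT F (by norm_num) hj.le x hx 0 h0]
    interval_cases j
    · exact ((isDerivFamily_recon T F).initial x hx).1
    · exact ((isDerivFamily_recon T F).initial x hx).2
  induction i generalizing x with
  | zero => exact hz x hx
  | succ i ih =>
    rw [D_succ_left]
    unfold dx
    rw [derivWithin_congr (f := fun _ => (0 : ℝ)) (fun y hy => ih (by omega) hy) (ih (by omega) hx)]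
    simp

theorem dx_D_recon_initial (hT : 0 < T) {j : ℕ} (hj : j < 2) {x : ℝ}
    (hx : x ∈ Icc (0 : ℝ) 1) : dx (D T 2 j (recon F)) x 0 = 0 := by
  unfold dx
  rw [derivWithin_congr (f := fun _ => (0 : ℝ)) (fun y hy => D_recon_initial hT le_rfl hj hy)
    (D_recon_initial hT le_rfl hj hx)]
  simp

theorem memW_recon (hF : IsL2Primitive T (fun x t => F (x, t)) a b h) (hT : 0 < T) :
    MemW T (recon F) := by
  have hfam := isDerivFamily_recon T F
  have hD := fun {i j : ℕ} (hi : i ≤ 2) (hj : j ≤ 2) => D_recon hT F hi hj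
  have hH := (isL2Primitive_D_recon hF hT).memHatW hT
  refine ⟨fun j hj x hx t ht => ?_, fun i hi j hj x hx t ht => ?_, hH.completelyContinuous,
    hH.memLp_top, fun i hi => ?_, fun j hj => ?_, fun x hx => ?_, hfam.boundary⟩
  · exact ((hfam.deriv_t j hj x hx t ht).congr_of_mem
      (fun s hs => hD (by norm_num) hj.le x hx s hs) ht).differentiableWithinAt
  · exact ((hfam.deriv_x i hi j hj x hx t ht).congr_of_mem
      (fun y hy => hD hi.le hj y hy t ht) hx).differentiableWithinAt
  · interval_cases i
    · refine (memLp_congr_ae ?_).2 (memLp_const (0 : ℝ))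
      filter_upwards [ae_restrict_mem measurableSet_Icc] with t ht using dt_recon_zero hT ht
    · exact (memLp_congr_ae (ae_dt_recon_one hF hT)).2 (memLp_slopeData hF)
    · exact hH.memLp_left
  · rw [iteratedDerivWithin_three]
    rcases hj.lt_or_eq with hj | rfl
    · refine (memLp_congr_ae ?_).2 (memLp_const (0 : ℝ))
      filter_upwards [ae_restrict_mem measurableSet_Icc] with x hx using dx_D_recon_initial hT hj hx
    · exact hH.memLp_bottom
  · exact ⟨D_recon_initial (i := 0) (j := 0) hT (by norm_num) (by norm_num) hx,
      D_recon_initial (i := 0) (j := 1) hT (by norm_num) (by norm_num) hx⟩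

theorem inner3_eq_zero_of_initial (hT : 0 < T) {j : ℕ} (hj : j < 2) (w : ℝ → ℝ) :
    inner3 (fun x => D T 0 j (recon F) x 0) w = 0 := by
  have h1 : ∀ x ∈ Icc (0 : ℝ) 1, D T 1 j (recon F) x 0 = 0 := fun x hx =>
    D_recon_initial hT (by norm_num) hj hx
  have h2 : ∀ x, derivWithin (fun x => D T 0 j (recon F) x 0) (Icc 0 1) x =
    D T 1 j (recon F) x 0 := fun x => rfl
  unfold inner3
  rw [iteratedDerivWithin_three, h2, h2, h1 0 (by simp), h1 1 (by simp)]
  beta_reduce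
  rw [D_recon_initial hT (by norm_num) hj (by simp)]
  have h3 : ∫ x in (0 : ℝ)..1, dx (D T 2 j (recon F)) x 0 * iteratedDerivWithin 3 w (Icc 0 1) x
      = ∫ x in (0 : ℝ)..1, 0 := by
    refine intervalIntegral.integral_congr fun x hx => ?_
    rw [uIcc_of_le zero_le_one] at hx
    simp only [dx_D_recon_initial hT hj hx, zero_mul]
  rw [h3]
  simp

/-- The homogeneous conditions remove the rest: ∂t²u vanishes on x = 0, which kills the term i = 0
and the value term for j = 2, while u and ∂tu vanish on t = 0, which kills j = 0 and j = 1. -/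
theorem innerW_recon {F' : C(ℝ × ℝ, ℝ)} {a' b' : ℝ → ℝ} {h' : ℝ → ℝ → ℝ}
    (hF : IsL2Primitive T (fun x t => F (x, t)) a b h)
    (hF' : IsL2Primitive T (fun x t => F' (x, t)) a' b' h') (hT : 0 < T) :
    innerW T (recon F) (recon F') =
      (∫ t in Icc 0 T, slopeData b h t * slopeData b' h' t) + (∫ t in Icc 0 T, b t * b' t)
      + (greenDerivC F (0, 0) * greenDerivC F' (0, 0) + greenDerivC F (1, 0) * greenDerivC F' (1, 0)
        + ∫ x in Icc 0 1, a x * a' x) + ∫ q in Omega T, h q.1 q.2 * h' q.1 q.2 := by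
  have hD := isL2Primitive_D_recon hF hT
  have hD' := isL2Primitive_D_recon hF' hT
  have h0 : (0 : ℝ) ∈ Icc 0 T := left_mem_Icc.2 hT.le
  have hz : ∫ t in (0 : ℝ)..T, dt T (D T 0 2 (recon F)) 0 t * dt T (D T 0 2 (recon F')) 0 t = 0 := by
    rw [intervalIntegral_mul_eq_of_ae hT.le (f' := fun _ => 0) (g' := fun _ => 0)]
    · simp
    · filter_upwards [ae_restrict_mem measurableSet_Icc] with t ht using dt_recon_zero hT ht
    · filter_upwards [ae_restrict_mem measurableSet_Icc] with t ht using dt_recon_zero hT ht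
  have h3 : inner3 (fun x => D T 0 2 (recon F) x 0) (fun x => D T 0 2 (recon F') x 0) =
      greenDerivC F (0, 0) * greenDerivC F' (0, 0) + greenDerivC F (1, 0) * greenDerivC F' (1, 0)
        + ∫ x in Icc 0 1, a x * a' x := by
    have e : ∀ (F : C(ℝ × ℝ, ℝ)), ∀ x ∈ Icc (0 : ℝ) 1,
        derivWithin (fun x => D T 0 2 (recon F) x 0) (Icc 0 1) x = greenDerivC F (x, 0) :=
      fun F x hx => D_recon hT F (i := 1) (by norm_num) le_rfl x hx 0 h0
    unfold inner3
    rw [iteratedDerivWithin_three, iteratedDerivWithin_three, e F 0 (by simp), e F 1 (by simp),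
      e F' 0 (by simp), e F' 1 (by simp)]
    beta_reduce
    rw [D_recon hT F (by norm_num) le_rfl 0 (by simp) 0 h0,
      intervalIntegral_mul_eq_of_ae zero_le_one (hD.prim.ae_dx_bottom hT hD.a_int)
        (hD'.prim.ae_dx_bottom hT hD'.a_int)]
    have : reconFamily F 0 2 (0, 0) = 0 := greenC_zero _ _
    rw [this]
    ring
  unfold innerW
  simp only [Finset.sum_range_succ, Finset.sum_range_zero]
  rw [hz, h3, inner3_eq_zero_of_initial hT (by norm_num), inner3_eq_zero_of_initial hT (by norm_num),
    intervalIntegral_mul_eq_of_ae hT.le (ae_dt_recon_one hF hT) (ae_dt_recon_one hF' hT),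
    intervalIntegral_mul_eq_of_ae hT.le (hD.prim.ae_dt_left hT hD.b_int)
      (hD'.prim.ae_dt_left hT hD'.b_int),
    iteratedIntegral_mul_eq_of_ae hT.le (hD.prim.ae_dx_dt hT hD.b_int hD.h_int)
      (hD'.prim.ae_dx_dt hT hD'.b_int hD'.h_int) hD.h_memLp hD'.h_memLp]
  ring

end Recon

/-! ### The space of data -/

section L2

variable {α : Type*} [MeasurableSpace α] {μ : Measure α}

theorem norm_sq_Lp_eq (f : Lp ℝ 2 μ) : ‖f‖ ^ 2 = ∫ x, f x ^ 2 ∂μ := by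
  rw [← real_inner_self_eq_norm_sq, L2.inner_def]
  simp [pow_two]

theorem inner_Lp_eq (f g : Lp ℝ 2 μ) : ⟪f, g⟫_ℝ = ∫ x, f x * g x ∂μ := by
  rw [L2.inner_def]
  simp [mul_comm]

/-- Integration over a set, on `L²`. -/
noncomputable def setIntegralL2 [IsFiniteMeasure μ] {s : Set α} (hs : MeasurableSet s) :
    Lp ℝ 2 μ →L[ℝ] ℝ :=
  innerSL ℝ (indicatorConstLp 2 hs (measure_ne_top μ s) (1 : ℝ))

theorem setIntegralL2_apply [IsFiniteMeasure μ] {s : Set α} (hs : MeasurableSet s) (f : Lp ℝ 2 μ) :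
    setIntegralL2 hs f = ∫ x in s, f x ∂μ :=
  L2.inner_indicatorConstLp_one hs (measure_ne_top μ s) f

theorem abs_setIntegralL2_le [IsFiniteMeasure μ] {s : Set α} (hs : MeasurableSet s)
    (f : Lp ℝ 2 μ) : |setIntegralL2 hs f| ≤ √(μ.real univ) * ‖f‖ := by
  refine abs_le_of_sq_le_sq ?_ (by positivity)
  rw [mul_pow, Real.sq_sqrt measureReal_nonneg, norm_sq_Lp_eq]
  refine le_trans ?_ (sq_integral_abs_le (Lp.memLp f))
  rw [setIntegralL2_apply, sq_le_sq, abs_of_nonneg (a := ∫ x, |f x| ∂μ)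
    (integral_nonneg fun _ => abs_nonneg _)]
  refine abs_integral_le_integral_abs.trans ?_
  exact setIntegral_le_integral ((Lp.memLp f).integrable one_le_two).abs
    (Eventually.of_forall fun _ => abs_nonneg _)

end L2

/-- The data `f(0,0)`, `∂f/∂x(·,0)`, `∂f/∂t(0,·)`, `∂²f/∂x∂t` of a function in `Ŵ(Ω)`. -/
abbrev Data (T : ℝ) : Type :=
  ℝ × Lp ℝ 2 ((volume : Measure ℝ).restrict (Icc 0 1)) ×
    Lp ℝ 2 ((volume : Measure ℝ).restrict (Icc 0 T)) ×
    Lp ℝ 2 ((volume : Measure (ℝ × ℝ)).restrict (Omega T))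

namespace Data

variable {T : ℝ}

/-- The part `∂f/∂x(·,0)` of the data. -/
noncomputable def bot (d : Data T) : ℝ → ℝ := d.2.1
/-- The part `∂f/∂t(0,·)` of the data. -/
noncomputable def left (d : Data T) : ℝ → ℝ := d.2.2.1
/-- The part `∂²f/∂x∂t` of the data. -/
noncomputable def top (d : Data T) : ℝ → ℝ → ℝ := fun x t => d.2.2.2 (x, t)

/-- The value at `(x, t)` of the double primitive of the data. -/
noncomputable def val (T x t : ℝ) : Data T →L[ℝ] ℝ :=
  ContinuousLinearMap.fst ℝ _ _ +
  setIntegralL2 (measurableSet_Ioc (a := 0) (b := x)) ∘L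
    ContinuousLinearMap.fst ℝ _ _ ∘L ContinuousLinearMap.snd ℝ _ _ +
  setIntegralL2 (measurableSet_Ioc (a := 0) (b := t)) ∘L
    ContinuousLinearMap.fst ℝ _ _ ∘L ContinuousLinearMap.snd ℝ _ _ ∘L
    ContinuousLinearMap.snd ℝ _ _ +
  setIntegralL2 ((measurableSet_Ioc (a := 0) (b := x)).prod (measurableSet_Ioc (a := 0) (b := t))) ∘L
    ContinuousLinearMap.snd ℝ _ _ ∘L ContinuousLinearMap.snd ℝ _ _ ∘L
    ContinuousLinearMap.snd ℝ _ _

theorem val_apply (x t : ℝ) (d : Data T) : val T x t d = d.1 +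
    setIntegralL2 (measurableSet_Ioc (a := 0) (b := x)) d.2.1 +
    setIntegralL2 (measurableSet_Ioc (a := 0) (b := t)) d.2.2.1 +
    setIntegralL2 ((measurableSet_Ioc (a := 0) (b := x)).prod
      (measurableSet_Ioc (a := 0) (b := t))) d.2.2.2 := rfl

/-- The constant does not depend on the point; this is the source of all the uniform bounds below.
-/
theorem exists_val_le (T : ℝ) : ∃ C, 0 ≤ C ∧ ∀ x t (d : Data T), |val T x t d| ≤ C * ‖d‖ := by
  refine ⟨1 + √(((volume : Measure ℝ).restrict (Icc 0 1)).real univ) +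
    √(((volume : Measure ℝ).restrict (Icc 0 T)).real univ) +
    √(((volume : Measure (ℝ × ℝ)).restrict (Omega T)).real univ), by positivity, fun x t d => ?_⟩
  rw [val_apply, add_mul, add_mul, add_mul, one_mul]
  have h1 : ‖d.1‖ ≤ ‖d‖ := norm_fst_le d
  have h2 : ‖d.2.1‖ ≤ ‖d‖ := (norm_fst_le d.2).trans (norm_snd_le d)
  have h3 : ‖d.2.2.1‖ ≤ ‖d‖ := (norm_fst_le d.2.2).trans ((norm_snd_le d.2).trans (norm_snd_le d))
  have h4 : ‖d.2.2.2‖ ≤ ‖d‖ := (norm_snd_le d.2.2).trans ((norm_snd_le d.2).trans (norm_snd_le d))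
  refine (abs_add_le _ _).trans (add_le_add ((abs_add_le _ _).trans (add_le_add
    ((abs_add_le _ _).trans (add_le_add h1 ?_)) ?_)) ?_)
  · exact (abs_setIntegralL2_le _ _).trans (by gcongr)
  · exact (abs_setIntegralL2_le _ _).trans (by gcongr)
  · exact (abs_setIntegralL2_le _ _).trans (by gcongr)

theorem memLp_top (d : Data T) :
    MemLp (fun q : ℝ × ℝ => d.top q.1 q.2) 2 (volume.restrict (Omega T)) := Lp.memLp _

theorem setIntegralL2_Ioc {l x : ℝ} (hx : x ∈ Icc 0 l)
    (f : Lp ℝ 2 ((volume : Measure ℝ).restrict (Icc 0 l))) :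
    setIntegralL2 (measurableSet_Ioc (a := 0) (b := x)) f = ∫ ξ in (0 : ℝ)..x, f ξ := by
  rw [setIntegralL2_apply, Measure.restrict_restrict measurableSet_Ioc,
    inter_eq_left.2 (show Ioc 0 x ⊆ Icc 0 l from fun z hz => ⟨hz.1.le, hz.2.trans hx.2⟩),
    intervalIntegral.integral_of_le hx.1]

theorem val_eq (d : Data T) {x t : ℝ} (hx : x ∈ Icc (0 : ℝ) 1) (ht : t ∈ Icc (0 : ℝ) T) :
    val T x t d = d.1 + (∫ ξ in (0 : ℝ)..x, d.bot ξ) + (∫ τ in (0 : ℝ)..t, d.left τ)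
      + ∫ ξ in (0 : ℝ)..x, ∫ τ in (0 : ℝ)..t, d.top ξ τ := by
  have h1 := primX_primT_eq_setIntegral (d.memLp_top.integrable one_le_two) hx ht
  rw [val_apply, setIntegralL2_Ioc hx, setIntegralL2_Ioc ht, setIntegralL2_apply,
    Measure.restrict_restrict (measurableSet_Ioc.prod measurableSet_Ioc), inter_eq_left.2]
  · exact congrArg _ h1.symm
  · have := uIoc_prod_subset_Omega hx ht
    rwa [uIoc_of_le hx.1, uIoc_of_le ht.1] at this

theorem isL2Primitive_val (hT : 0 ≤ T) (d : Data T) :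
    IsL2Primitive T (fun x t => val T x t d) d.bot d.left d.top where
  a_memLp := Lp.memLp _
  b_memLp := Lp.memLp _
  h_memLp := d.memLp_top
  prim x hx t ht := by
    beta_reduce
    rw [val_eq d hx ht, val_eq d (by simp : (0 : ℝ) ∈ Icc 0 1) (left_mem_Icc.2 hT)]
    simp

/-- The double primitive of the data, extended continuously to the plane. -/
noncomputable def prim (hT : 0 < T) : Data T →ₗ[ℝ] C(ℝ × ℝ, ℝ) where
  toFun d := ⟨fun q => val T (projIcc 0 1 zero_le_one q.1) (projIcc 0 T hT.le q.2) d,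
    ((isL2Primitive_val hT.le d).continuousOn hT).comp_continuous
      (f := fun q : ℝ × ℝ => ((projIcc (0 : ℝ) 1 zero_le_one q.1 : ℝ),
        (projIcc 0 T hT.le q.2 : ℝ))) (by fun_prop)
      (fun q => ⟨(projIcc (0 : ℝ) 1 zero_le_one q.1).2, (projIcc 0 T hT.le q.2).2⟩)⟩
  map_add' d e := by ext q; exact (val T _ _).map_add d e
  map_smul' c d := by ext q; exact (val T _ _).map_smul c d

theorem prim_apply (hT : 0 < T) (d : Data T) {x t : ℝ} (hx : x ∈ Icc (0 : ℝ) 1)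
    (ht : t ∈ Icc (0 : ℝ) T) : prim hT d (x, t) = val T x t d := by
  change val T (projIcc 0 1 zero_le_one x) (projIcc 0 T hT.le t) d = _
  rw [projIcc_of_mem _ hx, projIcc_of_mem _ ht]

theorem isL2Primitive_prim (hT : 0 < T) (d : Data T) :
    IsL2Primitive T (fun x t => prim hT d (x, t)) d.bot d.left d.top :=
  (isL2Primitive_val hT.le d).congr hT.le fun _ hx _ ht => prim_apply hT d hx ht

/-- The element of `W(Ω)` with the given data for `∂⁴u/∂x²∂t²`. -/
noncomputable def toFun (hT : 0 < T) (d : Data T) : ℝ → ℝ → ℝ := recon (prim hT d)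

theorem memW_toFun (hT : 0 < T) (d : Data T) : MemW T (d.toFun hT) :=
  memW_recon (isL2Primitive_prim hT d) hT

end Data

theorem exists_data_of_memHatW {T : ℝ} (hT : 0 < T) {f : ℝ → ℝ → ℝ} (hf : MemHatW T f) :
    ∃ d : Data T, ∀ x ∈ Icc (0 : ℝ) 1, ∀ t ∈ Icc (0 : ℝ) T, f x t = Data.prim hT d (x, t) := by
  obtain ⟨a, b, h, hf⟩ := hf.exists_isL2Primitive hT
  refine ⟨(f 0 0, hf.a_memLp.toLp _, hf.b_memLp.toLp _, hf.h_memLp.toLp _), fun x hx t ht => ?_⟩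
  rw [Data.prim_apply hT _ hx ht, hf.prim x hx t ht, Data.val_apply, Data.setIntegralL2_Ioc hx,
    Data.setIntegralL2_Ioc ht, setIntegralL2_apply]
  have h1 := primX_primT_eq_setIntegral hf.h_int hx ht
  have hs := uIoc_prod_subset_Omega hx ht
  rw [uIoc_of_le hx.1, uIoc_of_le ht.1] at hs
  have e : ∀ {l y : ℝ} {c : ℝ → ℝ} (hc : MemLp c 2 (volume.restrict (Icc 0 l))), y ∈ Icc 0 l →
      ∫ ξ in (0 : ℝ)..y, (hc.toLp c : ℝ → ℝ) ξ = ∫ ξ in (0 : ℝ)..y, c ξ := by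
    intro l y c hc hy
    refine intervalIntegral.integral_congr_ae ?_
    filter_upwards [(ae_restrict_iff' measurableSet_Icc).1 hc.coeFn_toLp] with ξ h1 h2
    rw [uIoc_of_le hy.1] at h2
    exact h1 ⟨h2.1.le, h2.2.trans hy.2⟩
  rw [e hf.a_memLp hx, e hf.b_memLp ht, integral_congr_ae (ae_restrict_of_ae hf.h_memLp.coeFn_toLp),
    Measure.restrict_restrict (measurableSet_Ioc.prod measurableSet_Ioc), inter_eq_left.2 hs, ← h1]
  rfl

/-- Stated for families of derivatives so that it covers both members of W(Ω) and explicit test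
functions, for which membership in W(Ω) need not be checked. -/
theorem IsDerivFamily.exists_data {T : ℝ} {u : ℕ → ℕ → ℝ → ℝ → ℝ} (hu : IsDerivFamily T u)
    (hT : 0 < T) (h22 : MemHatW T (u 2 2)) :
    ∃ d : Data T, ∀ x ∈ Icc (0 : ℝ) 1, ∀ t ∈ Icc (0 : ℝ) T, u 0 0 x t = d.toFun hT x t := by
  obtain ⟨d, hd⟩ := exists_data_of_memHatW hT h22
  exact ⟨d, hu.eq_recon hT hd⟩

theorem MemW.exists_data {T : ℝ} {u : ℝ → ℝ → ℝ} (hu : MemW T u) (hT : 0 < T) :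
    ∃ d : Data T, ∀ x ∈ Icc (0 : ℝ) 1, ∀ t ∈ Icc (0 : ℝ) T, u x t = d.toFun hT x t :=
  hu.isDerivFamily.exists_data hT hu.memHatW

/-! ### Primitives as operators on L² -/

section PrimLp

variable {T : ℝ}

/-- Almost all sections of almost everywhere equal functions agree almost everywhere; hence
primitives are well defined on L² classes. -/
theorem ae_primitive_congr {f g : ℝ × ℝ → ℝ} (h : f =ᵐ[volume.restrict (Omega T)] g) :
    ∀ᵐ q ∂(volume.restrict (Omega T)), ∀ y ∈ Icc (0 : ℝ) 1,
      ∫ ξ in (0 : ℝ)..y, f (ξ, q.2) = ∫ ξ in (0 : ℝ)..y, g (ξ, q.2) := by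
  rw [restrict_Omega] at h ⊢
  have h1 := Measure.ae_ae_of_ae_prod (Measure.measurePreserving_swap.quasiMeasurePreserving.ae h)
  have h2 : ∀ᵐ t ∂((volume : Measure ℝ).restrict (Icc 0 T)), ∀ y ∈ Icc (0 : ℝ) 1,
      ∫ ξ in (0 : ℝ)..y, f (ξ, t) = ∫ ξ in (0 : ℝ)..y, g (ξ, t) := h1.mono fun t ht y hy => ?_
  · exact Measure.quasiMeasurePreserving_snd.ae h2
  refine intervalIntegral.integral_congr_ae ?_
  filter_upwards [(ae_restrict_iff' measurableSet_Icc).1 ht] with ξ h1 h2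
  rw [uIoc_of_le hy.1] at h2
  exact h1 ⟨h2.1.le, h2.2.trans hy.2⟩

theorem ae_intervalIntegrable_section {f : ℝ × ℝ → ℝ} (hf : IntegrableOn f (Omega T)) :
    ∀ᵐ q ∂(volume.restrict (Omega T)), ∀ y ∈ Icc (0 : ℝ) 1,
      IntervalIntegrable (fun ξ => f (ξ, q.2)) volume 0 y := by
  rw [IntegrableOn, restrict_Omega] at hf
  rw [restrict_Omega]
  have h1 : ∀ᵐ t ∂((volume : Measure ℝ).restrict (Icc 0 T)), ∀ y ∈ Icc (0 : ℝ) 1,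
      IntervalIntegrable (fun ξ => f (ξ, t)) volume 0 y := hf.prod_left_ae.mono fun t ht y hy =>
    intervalIntegrable_of_integrableOn_Icc ht hy
  exact Measure.quasiMeasurePreserving_snd.ae h1

theorem memLp_primitive_Omega {k : ℝ × ℝ → ℝ} {σ : ℝ → ℝ}
    (hk : MemLp k 2 (volume.restrict (Omega T))) (hσ : Measurable σ)
    (hσ1 : ∀ x ∈ Icc (0 : ℝ) 1, σ x ∈ Icc (0 : ℝ) 1) :
    MemLp (fun q : ℝ × ℝ => ∫ ξ in (0 : ℝ)..σ q.1, k (ξ, q.2)) 2 (volume.restrict (Omega T)) := by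
  rw [restrict_Omega] at hk ⊢
  exact memLp_primitive (k := fun x t => k (x, t)) hk hσ hσ1

theorem integral_sq_primitive_Omega_le {k : ℝ × ℝ → ℝ} {σ : ℝ → ℝ}
    (hk : MemLp k 2 (volume.restrict (Omega T))) (hσ : Measurable σ)
    (hσ1 : ∀ x ∈ Icc (0 : ℝ) 1, σ x ∈ Icc (0 : ℝ) 1) :
    ∫ q in Omega T, (∫ ξ in (0 : ℝ)..σ q.1, k (ξ, q.2)) ^ 2 ≤ ∫ q in Omega T, k q ^ 2 := by
  rw [restrict_Omega] at hk ⊢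
  have h3 := integral_sq_primitive_le (k := fun x t => k (x, t)) zero_le_one hk hσ hσ1
  rwa [one_pow, one_mul] at h3

/-- The function `(x, t) ↦ ∫₀^{σ(x)} k(ξ, t) dξ`, on `L²`. -/
noncomputable def primLp (T : ℝ) {σ : ℝ → ℝ} (hσ : Measurable σ)
    (hσ1 : ∀ x ∈ Icc (0 : ℝ) 1, σ x ∈ Icc (0 : ℝ) 1) :
    Lp ℝ 2 ((volume : Measure (ℝ × ℝ)).restrict (Omega T)) →L[ℝ]
      Lp ℝ 2 ((volume : Measure (ℝ × ℝ)).restrict (Omega T)) :=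
  have hmem : ∀ k : Lp ℝ 2 ((volume : Measure (ℝ × ℝ)).restrict (Omega T)),
      MemLp (fun q : ℝ × ℝ => ∫ ξ in (0 : ℝ)..σ q.1, k (ξ, q.2)) 2
        (volume.restrict (Omega T)) := fun k => memLp_primitive_Omega (Lp.memLp k) hσ hσ1
  have hΩ : ∀ᵐ q ∂((volume : Measure (ℝ × ℝ)).restrict (Omega T)), σ q.1 ∈ Icc (0 : ℝ) 1 := by
    filter_upwards [ae_restrict_mem (measurableSet_Omega T)] with q hq using hσ1 _ hq.1
  LinearMap.mkContinuous
    { toFun := fun k => (hmem k).toLp _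
      map_add' := fun k l => by
        rw [← MemLp.toLp_add]
        refine MemLp.toLp_congr _ _ ?_
        filter_upwards [hΩ, ae_primitive_congr (Lp.coeFn_add k l),
          ae_intervalIntegrable_section ((Lp.memLp k).integrable one_le_two),
          ae_intervalIntegrable_section ((Lp.memLp l).integrable one_le_two)] with q h1 h2 h3 h4
        rw [h2 _ h1]
        exact intervalIntegral.integral_add (h3 _ h1) (h4 _ h1)
      map_smul' := fun c k => by
        rw [RingHom.id_apply, ← MemLp.toLp_const_smul]
        refine MemLp.toLp_congr _ _ ?_
        filter_upwards [hΩ, ae_primitive_congr (Lp.coeFn_smul c k)] with q h1 h2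
        rw [h2 _ h1]
        exact intervalIntegral.integral_const_mul _ _ }
    -- The operator norm is at most 1 because the x-side has length 1.
    1 fun k => by
      rw [one_mul]
      refine le_of_sq_le_sq ?_ (norm_nonneg _)
      rw [norm_sq_Lp_eq, norm_sq_Lp_eq]
      have h1 : ∫ q in Omega T, (hmem k).toLp _ q ^ 2 =
          ∫ q in Omega T, (∫ ξ in (0 : ℝ)..σ q.1, k (ξ, q.2)) ^ 2 := by
        refine integral_congr_ae ?_
        filter_upwards [(hmem k).coeFn_toLp] with q hq
        rw [hq]
      exact h1.le.trans (integral_sq_primitive_Omega_le (Lp.memLp k) hσ hσ1)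

theorem coeFn_primLp {σ : ℝ → ℝ} (hσ : Measurable σ)
    (hσ1 : ∀ x ∈ Icc (0 : ℝ) 1, σ x ∈ Icc (0 : ℝ) 1)
    (k : Lp ℝ 2 ((volume : Measure (ℝ × ℝ)).restrict (Omega T))) :
    primLp T hσ hσ1 k =ᵐ[volume.restrict (Omega T)]
      fun q => ∫ ξ in (0 : ℝ)..σ q.1, k (ξ, q.2) :=
  MemLp.coeFn_toLp (memLp_primitive_Omega (Lp.memLp k) hσ hσ1)

theorem measurePreserving_snd_Omega (T : ℝ) : MeasurePreserving Prod.snd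
    ((volume : Measure (ℝ × ℝ)).restrict (Omega T)) ((volume : Measure ℝ).restrict (Icc 0 T)) := by
  rw [restrict_Omega]
  have := isProbabilityMeasure_unit
  exact measurePreserving_snd

/-- Functions of `t`, as functions on the rectangle. -/
noncomputable def liftLp (T : ℝ) : Lp ℝ 2 ((volume : Measure ℝ).restrict (Icc 0 T)) →L[ℝ]
    Lp ℝ 2 ((volume : Measure (ℝ × ℝ)).restrict (Omega T)) :=
  (Lp.compMeasurePreservingₗᵢ ℝ Prod.snd (measurePreserving_snd_Omega T)).toContinuousLinearMap

theorem coeFn_liftLp (b : Lp ℝ 2 ((volume : Measure ℝ).restrict (Icc 0 T))) :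
    liftLp T b =ᵐ[volume.restrict (Omega T)] fun q => b q.2 :=
  Lp.coeFn_compMeasurePreserving b (measurePreserving_snd_Omega T)

end PrimLp

namespace Data

variable {T : ℝ}

/-- The derivative in `t` of `∂³u/∂x∂t²(0,t)` as an element of `L²`. -/
noncomputable def slope (T : ℝ) : Data T →L[ℝ]
    Lp ℝ 2 ((volume : Measure (ℝ × ℝ)).restrict (Omega T)) :=
  -(primLp T (σ := fun _ => 1) measurable_const (fun _ _ => by simp) ∘L
    primLp T (σ := id) measurable_id (fun _ h => h) ∘L
    (liftLp T ∘L ContinuousLinearMap.fst ℝ _ _ ∘L ContinuousLinearMap.snd ℝ _ _ ∘L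
      ContinuousLinearMap.snd ℝ _ _ +
    primLp T (σ := id) measurable_id (fun _ h => h) ∘L
      ContinuousLinearMap.snd ℝ _ _ ∘L ContinuousLinearMap.snd ℝ _ _ ∘L
      ContinuousLinearMap.snd ℝ _ _))

theorem coeFn_slope (d : Data T) : slope T d =ᵐ[volume.restrict (Omega T)]
    fun q => slopeData d.left d.top q.2 := by
  set k₁ := primLp T (σ := id) measurable_id (fun _ h => h) d.2.2.2 with hk₁
  set k₂ := liftLp T d.2.2.1 + k₁ with hk₂
  set k₃ := primLp T (σ := id) measurable_id (fun _ h => h) k₂ with hk₃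
  have e1 : k₁ =ᵐ[volume.restrict (Omega T)] fun q => primX d.top q.1 q.2 :=
    coeFn_primLp measurable_id _ _
  have e2 : k₂ =ᵐ[volume.restrict (Omega T)] fun q => primDt d.left d.top q.1 q.2 := by
    filter_upwards [Lp.coeFn_add (liftLp T d.2.2.1) k₁, e1, coeFn_liftLp d.2.2.1] with q h1 h2 h3
    rw [hk₂, h1, Pi.add_apply, h2, h3]
    rfl
  have e3 : k₃ =ᵐ[volume.restrict (Omega T)] fun q => primX (primDt d.left d.top) q.1 q.2 := by
    filter_upwards [coeFn_primLp measurable_id (fun _ h => h) k₂, ae_primitive_congr e2,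
      ae_restrict_mem (measurableSet_Omega T)] with q h1 h2 h3
    rw [hk₃, h1]
    exact h2 _ h3.1
  change (-(primLp T (σ := fun _ => 1) measurable_const (fun _ _ => by simp) k₃) :
    Lp ℝ 2 ((volume : Measure (ℝ × ℝ)).restrict (Omega T))) =ᵐ[_] _
  filter_upwards [Lp.coeFn_neg (primLp T (σ := fun _ => 1) measurable_const
    (fun _ _ => by simp) k₃), coeFn_primLp (σ := fun _ => 1) measurable_const
    (fun _ _ => by simp) k₃, ae_primitive_congr e3] with q h1 h2 h3
  rw [h1, Pi.neg_apply, h2, h3 1 (by simp)]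
  rfl

/-- Functions of t alone have the same integral over Ω as over [0,T], so the slope may be kept as an
element of L²(Ω), on which the primitive operators act. -/
theorem inner_slope (d e : Data T) : ⟪slope T d, slope T e⟫_ℝ =
    ∫ t in Icc 0 T, slopeData d.left d.top t * slopeData e.left e.top t := by
  rw [inner_Lp_eq]
  have h1 : ∫ q in Omega T, slope T d q * slope T e q =
      ∫ q in Omega T, slopeData d.left d.top q.2 * slopeData e.left e.top q.2 := by
    refine integral_congr_ae ?_
    filter_upwards [coeFn_slope d, coeFn_slope e] with q h1 h2
    rw [h1, h2]
  rw [h1, restrict_Omega,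
    integral_fun_snd (f := fun t => slopeData d.left d.top t * slopeData e.left e.top t)]
  simp

/-! ### Uniform bounds for u and Lu in terms of the data -/

/-- A linear family of continuous functions is bounded on the rectangle by the data. -/
def UnifBdd (A : Data T →ₗ[ℝ] C(ℝ × ℝ, ℝ)) : Prop :=
  ∃ C, 0 ≤ C ∧ ∀ d, ∀ x ∈ Icc (0 : ℝ) 1, ∀ t ∈ Icc (0 : ℝ) T, |A d (x, t)| ≤ C * ‖d‖

theorem unifBdd_prim (hT : 0 < T) : UnifBdd (prim hT) := by
  obtain ⟨C, hC, h⟩ := exists_val_le T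
  exact ⟨C, hC, fun d x _ t _ => h _ _ d⟩

theorem abs_integral_le_mul {l y c : ℝ} {g : ℝ → ℝ} (hy : y ∈ Icc 0 l)
    (hg : ∀ z ∈ Icc 0 l, |g z| ≤ c) : |∫ z in (0 : ℝ)..y, g z| ≤ l * c := by
  have h1 : ∀ z ∈ uIoc 0 y, ‖g z‖ ≤ c := fun z hz => by
    rw [uIoc_of_le hy.1] at hz
    exact hg z ⟨hz.1.le, hz.2.trans hy.2⟩
  have h2 := intervalIntegral.norm_integral_le_of_norm_le_const h1
  rw [sub_zero, abs_of_nonneg hy.1, mul_comm] at h2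
  have hc : 0 ≤ c := (abs_nonneg _).trans (hg y hy)
  exact h2.trans (mul_le_mul_of_nonneg_right hy.2 hc)

theorem UnifBdd.primXC {A : Data T →ₗ[ℝ] C(ℝ × ℝ, ℝ)} (hA : UnifBdd A) :
    UnifBdd (primXC ∘ₗ A) := by
  obtain ⟨C, hC, h⟩ := hA
  refine ⟨C, hC, fun d x hx t ht => ?_⟩
  have := abs_integral_le_mul hx (fun z hz => h d z hz t ht)
  rwa [one_mul] at this

theorem UnifBdd.primTC {A : Data T →ₗ[ℝ] C(ℝ × ℝ, ℝ)} (hA : UnifBdd A) (hT : 0 ≤ T) :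
    UnifBdd (primTC ∘ₗ A) := by
  obtain ⟨C, hC, h⟩ := hA
  refine ⟨T * C, by positivity, fun d x hx t ht => ?_⟩
  rw [mul_assoc]
  exact abs_integral_le_mul ht (fun z hz => h d x hx z hz)

theorem UnifBdd.sub {A B : Data T →ₗ[ℝ] C(ℝ × ℝ, ℝ)} (hA : UnifBdd A) (hB : UnifBdd B) :
    UnifBdd (A - B) := by
  obtain ⟨C, hC, h⟩ := hA
  obtain ⟨C', hC', h'⟩ := hB
  refine ⟨C + C', by positivity, fun d x hx t ht => ?_⟩
  rw [add_mul]
  exact (abs_sub _ _).trans (add_le_add (h d x hx t ht) (h' d x hx t ht))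

theorem UnifBdd.evalOneC {A : Data T →ₗ[ℝ] C(ℝ × ℝ, ℝ)} (hA : UnifBdd A) :
    UnifBdd (evalOneC ∘ₗ A) := by
  obtain ⟨C, hC, h⟩ := hA
  exact ⟨C, hC, fun d x hx t ht => h d 1 (by simp) t ht⟩

theorem UnifBdd.mulXC {A : Data T →ₗ[ℝ] C(ℝ × ℝ, ℝ)} (hA : UnifBdd A) :
    UnifBdd (mulXC ∘ₗ A) := by
  obtain ⟨C, hC, h⟩ := hA
  refine ⟨C, hC, fun d x hx t ht => ?_⟩
  change |x * A d (x, t)| ≤ _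
  rw [abs_mul, abs_of_nonneg hx.1]
  exact (mul_le_of_le_one_left (abs_nonneg _) hx.2).trans (h d x hx t ht)

theorem UnifBdd.greenC {A : Data T →ₗ[ℝ] C(ℝ × ℝ, ℝ)} (hA : UnifBdd A) :
    UnifBdd (greenC ∘ₗ A) :=
  hA.primXC.primXC.sub hA.primXC.primXC.evalOneC.mulXC

theorem UnifBdd.greenDerivC {A : Data T →ₗ[ℝ] C(ℝ × ℝ, ℝ)} (hA : UnifBdd A) :
    UnifBdd (greenDerivC ∘ₗ A) :=
  hA.primXC.sub hA.primXC.primXC.evalOneC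

theorem UnifBdd.exists_clm {A : Data T →ₗ[ℝ] C(ℝ × ℝ, ℝ)} (hA : UnifBdd A) {x t : ℝ}
    (hx : x ∈ Icc (0 : ℝ) 1) (ht : t ∈ Icc (0 : ℝ) T) :
    ∃ l : Data T →L[ℝ] ℝ, ∀ d, l d = A d (x, t) := by
  obtain ⟨C, hC, h⟩ := hA
  exact ⟨LinearMap.mkContinuous
    { toFun := fun d => A d (x, t)
      map_add' := fun d e => by rw [map_add]; rfl
      map_smul' := fun c d => by rw [map_smul]; rfl } C (fun d => h d x hx t ht), fun d => rfl⟩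

/-- The map from data to elements of `W(Ω)`, as continuous functions. -/
noncomputable def toC (hT : 0 < T) : Data T →ₗ[ℝ] C(ℝ × ℝ, ℝ) :=
  SineGordon.greenC ∘ₗ SineGordon.primTC ∘ₗ SineGordon.primTC ∘ₗ prim hT

theorem toC_apply (hT : 0 < T) (d : Data T) (x t : ℝ) : toC hT d (x, t) = d.toFun hT x t := rfl

theorem unifBdd_toC (hT : 0 < T) : UnifBdd (toC hT) :=
  (((unifBdd_prim hT).primTC hT.le).primTC hT.le).greenC

/-- The map from data to `L u`. -/
noncomputable def waveC (hT : 0 < T) : Data T →ₗ[ℝ] C(ℝ × ℝ, ℝ) :=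
  SineGordon.greenC ∘ₗ prim hT - SineGordon.primTC ∘ₗ SineGordon.primTC ∘ₗ prim hT

theorem waveC_apply (hT : 0 < T) (d : Data T) {x t : ℝ} (hx : x ∈ Icc (0 : ℝ) 1)
    (ht : t ∈ Icc (0 : ℝ) T) : waveC hT d (x, t) = waveOp T (d.toFun hT) x t :=
  (waveOp_recon hT _ x hx t ht).symm

theorem unifBdd_waveC (hT : 0 < T) : UnifBdd (waveC hT) :=
  (unifBdd_prim hT).greenC.sub (((unifBdd_prim hT).primTC hT.le).primTC hT.le)

end Data

/-! ### The Hilbert space structure of W(Ω) and the adjoint of L -/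

section Hilbert

variable {E F G : Type*} [NormedAddCommGroup E] [NormedSpace ℝ E]
  [NormedAddCommGroup F] [InnerProductSpace ℝ F] [NormedAddCommGroup G] [InnerProductSpace ℝ G]

/-- The map into the Hilbert sum with the components `f` and `g`. -/
noncomputable def l2prod (f : E →L[ℝ] F) (g : E →L[ℝ] G) : E →L[ℝ] WithLp 2 (F × G) :=
  (WithLp.prodContinuousLinearEquiv 2 ℝ F G).symm.toContinuousLinearMap ∘L f.prod g

theorem inner_l2prod (f : E →L[ℝ] F) (g : E →L[ℝ] G) (x y : E) :
    ⟪l2prod f g x, l2prod f g y⟫_ℝ = ⟪f x, f y⟫_ℝ + ⟪g x, g y⟫_ℝ := rfl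

theorem norm_sq_l2prod (f : E →L[ℝ] F) (g : E →L[ℝ] G) (x : E) :
    ‖l2prod f g x‖ ^ 2 = ‖f x‖ ^ 2 + ‖g x‖ ^ 2 := WithLp.prod_norm_sq_eq_of_L2 _

/-- The Riesz representation theorem for the inner product pulled back along an embedding. -/
theorem exists_riesz [CompleteSpace E] [CompleteSpace F] (J : E →L[ℝ] F) {C : NNReal}
    (hJ : ∀ d, ‖d‖ ≤ C * ‖J d‖) (l : E →L[ℝ] ℝ) : ∃ e, ∀ d, ⟪J d, J e⟫_ℝ = l d := by
  -- The lower bound and completeness of the source make the range closed, so Riesz applies on the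
  -- range and the representative can be pulled back.
  have hanti : AntilipschitzWith C J := AddMonoidHomClass.antilipschitz_of_bound J hJ
  have hclo : IsClosed (range J) := hanti.isClosed_range J.uniformContinuous
  let eq := J.equivRange hanti.injective hclo
  have : CompleteSpace J.range := hclo.completeSpace_coe
  let k := (InnerProductSpace.toDual ℝ J.range).symm (l ∘L eq.symm.toContinuousLinearMap)
  refine ⟨eq.symm k, fun d => ?_⟩
  have h1 : ∀ z, J (eq.symm z) = z := fun z => congrArg Subtype.val (eq.apply_symm_apply z)
  have h2 : ⟪k, eq d⟫_ℝ = l d := by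
    rw [InnerProductSpace.toDual_symm_apply]
    simp
  rw [h1, real_inner_comm, ← h2]
  rfl

end Hilbert

namespace Data

variable {T : ℝ}

theorem exists_boundarySlope (hT : 0 < T) {x : ℝ} (hx : x ∈ Icc (0 : ℝ) 1) :
    ∃ l : Data T →L[ℝ] ℝ, ∀ d, l d = SineGordon.greenDerivC (prim hT d) (x, 0) :=
  (unifBdd_prim hT).greenDerivC.exists_clm hx (left_mem_Icc.2 hT.le)

/-- `∂³u/∂x∂t²(x, 0)` for `x = 0` and `x = 1`. -/
noncomputable def boundarySlope (hT : 0 < T) {x : ℝ} (hx : x ∈ Icc (0 : ℝ) 1) : Data T →L[ℝ] ℝ :=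
  (exists_boundarySlope hT hx).choose

theorem boundarySlope_apply (hT : 0 < T) {x : ℝ} (hx : x ∈ Icc (0 : ℝ) 1) (d : Data T) :
    boundarySlope hT hx d = SineGordon.greenDerivC (prim hT d) (x, 0) :=
  (exists_boundarySlope hT hx).choose_spec d

/-- The Hilbert space that carries the components of the inner product of `W(Ω)`. -/
abbrev Target (T : ℝ) : Type :=
  WithLp 2 (Lp ℝ 2 ((volume : Measure (ℝ × ℝ)).restrict (Omega T)) ×
    WithLp 2 (Lp ℝ 2 ((volume : Measure ℝ).restrict (Icc 0 T)) ×
      WithLp 2 (ℝ × WithLp 2 (ℝ × WithLp 2 (Lp ℝ 2 ((volume : Measure ℝ).restrict (Icc 0 1)) ×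
        Lp ℝ 2 ((volume : Measure (ℝ × ℝ)).restrict (Omega T)))))))

/-- The isometric image of `W(Ω)` in a Hilbert space. -/
noncomputable def embed (hT : 0 < T) : Data T →L[ℝ] Target T :=
  l2prod (slope T) (l2prod
    (ContinuousLinearMap.fst ℝ _ _ ∘L ContinuousLinearMap.snd ℝ _ _ ∘L ContinuousLinearMap.snd ℝ _ _)
    (l2prod (boundarySlope hT (left_mem_Icc.2 zero_le_one))
      (l2prod (boundarySlope hT (right_mem_Icc.2 zero_le_one))
        (l2prod (ContinuousLinearMap.fst ℝ _ _ ∘L ContinuousLinearMap.snd ℝ _ _)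
          (ContinuousLinearMap.snd ℝ _ _ ∘L ContinuousLinearMap.snd ℝ _ _ ∘L
            ContinuousLinearMap.snd ℝ _ _)))))

theorem inner_embed_eq (hT : 0 < T) (d e : Data T) : ⟪embed hT d, embed hT e⟫_ℝ =
    ⟪slope T d, slope T e⟫_ℝ + (⟪d.2.2.1, e.2.2.1⟫_ℝ +
      (boundarySlope hT (left_mem_Icc.2 zero_le_one) e *
        boundarySlope hT (left_mem_Icc.2 zero_le_one) d +
      (boundarySlope hT (right_mem_Icc.2 zero_le_one) e *
        boundarySlope hT (right_mem_Icc.2 zero_le_one) d +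
        (⟪d.2.1, e.2.1⟫_ℝ + ⟪d.2.2.2, e.2.2.2⟫_ℝ)))) := by
  unfold embed
  rw [inner_l2prod, inner_l2prod, inner_l2prod, inner_l2prod, inner_l2prod]
  rfl

theorem inner_embed (hT : 0 < T) (d e : Data T) :
    ⟪embed hT d, embed hT e⟫_ℝ = innerW T (d.toFun hT) (e.toFun hT) := by
  have h1 := innerW_recon (isL2Primitive_prim hT d) (isL2Primitive_prim hT e) hT
  have h2 : ⟪d.2.2.1, e.2.2.1⟫_ℝ = ∫ t in Icc 0 T, d.left t * e.left t := inner_Lp_eq _ _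
  have h3 : ⟪d.2.1, e.2.1⟫_ℝ = ∫ t in Icc 0 1, d.bot t * e.bot t := inner_Lp_eq _ _
  have h4 : ⟪d.2.2.2, e.2.2.2⟫_ℝ = ∫ q in Omega T, d.top q.1 q.2 * e.top q.1 q.2 :=
    inner_Lp_eq _ _
  rw [inner_embed_eq, inner_slope, boundarySlope_apply, boundarySlope_apply, boundarySlope_apply,
    boundarySlope_apply, h2, h3, h4]
  unfold toFun
  rw [h1]
  ring

theorem norm_sq_embed (hT : 0 < T) (d : Data T) : ‖embed hT d‖ ^ 2 = ‖slope T d‖ ^ 2 +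
    (‖d.2.2.1‖ ^ 2 + (‖boundarySlope hT (left_mem_Icc.2 zero_le_one) d‖ ^ 2 +
      (‖boundarySlope hT (right_mem_Icc.2 zero_le_one) d‖ ^ 2 +
        (‖d.2.1‖ ^ 2 + ‖d.2.2.2‖ ^ 2)))) := by
  unfold embed
  simp only [norm_sq_l2prod]
  rfl

/-- Only F(0,0) is not itself a component of the inner product. The slopes at the two ends differ by
∫₀¹ F(ξ,0) dξ, and F(ξ,0) is within the norm of ∂xF(·,0) of F(0,0); two slopes and this norm account
for the constant 3. -/
theorem norm_le_embed (hT : 0 < T) (d : Data T) : ‖d‖ ≤ (3 : NNReal) * ‖embed hT d‖ := by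
  have h := norm_sq_embed hT d
  set m := ‖embed hT d‖
  have hm : 0 ≤ m := norm_nonneg _
  have key : ∀ y : ℝ, y ^ 2 ≤ m ^ 2 → y ≤ m := fun y hy => le_of_sq_le_sq hy hm
  set w0 := boundarySlope hT (left_mem_Icc.2 zero_le_one) d with hw0
  set w1 := boundarySlope hT (right_mem_Icc.2 zero_le_one) d with hw1
  have n1 := sq_nonneg ‖slope T d‖
  have n2 := sq_nonneg ‖d.2.2.1‖
  have n3 := sq_nonneg ‖w0‖
  have n4 := sq_nonneg ‖w1‖
  have n5 := sq_nonneg ‖d.2.1‖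
  have n6 := sq_nonneg ‖d.2.2.2‖
  have hb : ‖d.2.2.1‖ ≤ m := key _ (by linarith)
  have h0 : ‖w0‖ ≤ m := key _ (by linarith)
  have h1 : ‖w1‖ ≤ m := key _ (by linarith)
  have ha : ‖d.2.1‖ ≤ m := key _ (by linarith)
  have hh : ‖d.2.2.2‖ ≤ m := key _ (by linarith)
  have hc : ‖d.1‖ ≤ 3 * m := by
    have e1 : w1 - w0 = ∫ ξ in (0 : ℝ)..1, prim hT d (ξ, 0) := by
      rw [hw0, hw1, boundarySlope_apply, boundarySlope_apply, greenDerivC_apply, greenDerivC_apply,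
        SineGordon.primXC_apply, SineGordon.primXC_apply _ 0]
      simp
    have e2 : ∀ ξ ∈ Icc (0 : ℝ) 1, |prim hT d (ξ, 0) - d.1| ≤ m := fun ξ hξ => by
      rw [prim_apply hT d hξ (left_mem_Icc.2 hT.le), val_eq d hξ (left_mem_Icc.2 hT.le)]
      have e3 := abs_setIntegralL2_le (measurableSet_Ioc (a := 0) (b := ξ)) d.2.1
      rw [setIntegralL2_Ioc hξ] at e3
      have e4 : √(((volume : Measure ℝ).restrict (Icc 0 1)).real univ) = 1 := by
        simp [measureReal_def]
      rw [e4, one_mul] at e3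
      simp only [intervalIntegral.integral_same, intervalIntegral.integral_zero, add_zero,
        add_sub_cancel_left]
      exact e3.trans ha
    have e5 := abs_integral_le_mul (right_mem_Icc.2 zero_le_one) e2
    rw [intervalIntegral.integral_sub ((by fun_prop : Continuous fun ξ : ℝ =>
      prim hT d (ξ, 0)).intervalIntegrable _ _) intervalIntegrable_const, ← e1] at e5
    simp only [intervalIntegral.integral_const, sub_zero, smul_eq_mul, one_mul] at e5
    rw [Real.norm_eq_abs] at h0 h1 ⊢
    rw [abs_le] at *
    constructor <;> linarith [h0.1, h0.2, h1.1, h1.2, e5.1, e5.2]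
  have : ‖d‖ = max ‖d.1‖ (max ‖d.2.1‖ (max ‖d.2.2.1‖ ‖d.2.2.2‖)) := rfl
  rw [this]
  change _ ≤ 3 * m
  exact max_le hc (max_le (by linarith) (max_le (by linarith) (by linarith)))

/-- `L* G_q` in terms of the data. -/
theorem exists_adjoint (hT : 0 < T) {q : ℝ × ℝ} (hq : q ∈ Omega T) :
    ∃ e : Data T, ∀ d, ⟪embed hT d, embed hT e⟫_ℝ = waveC hT d q := by
  obtain ⟨l, hl⟩ := (unifBdd_waveC hT).exists_clm hq.1 hq.2
  obtain ⟨e, he⟩ := exists_riesz (embed hT) (norm_le_embed hT) l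
  exact ⟨e, fun d => by rw [he, hl]⟩

end Data

/-! ### Invariance under equality on Ω -/

/-- Equality on the rectangle. -/
def EqOmega (T : ℝ) (f g : ℝ → ℝ → ℝ) : Prop :=
  ∀ x ∈ Icc (0 : ℝ) 1, ∀ t ∈ Icc (0 : ℝ) T, f x t = g x t

theorem EqOmega.symm {T : ℝ} {f g : ℝ → ℝ → ℝ} (h : EqOmega T f g) : EqOmega T g f :=
  fun x hx t ht => (h x hx t ht).symm

theorem EqOmega.waveOp {T : ℝ} {f g : ℝ → ℝ → ℝ} (h : EqOmega T f g) :
    EqOmega T (waveOp T f) (waveOp T g) := fun x hx t ht => by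
  unfold SineGordon.waveOp
  rw [D_congr h 0 2 x hx t ht, D_congr h 2 0 x hx t ht]

theorem MemHatW.congr {T : ℝ} (hT : 0 < T) {f g : ℝ → ℝ → ℝ} (hf : MemHatW T f)
    (h : EqOmega T g f) : MemHatW T g := by
  obtain ⟨_, _, _, h1⟩ := hf.exists_isL2Primitive hT
  exact (h1.congr hT.le h).memHatW hT

theorem innerW_congr {T : ℝ} (hT : 0 < T) {f f' g g' : ℝ → ℝ → ℝ} (hf : EqOmega T f f')
    (hg : EqOmega T g g') : innerW T f g = innerW T f' g' := by
  have h0 : (0 : ℝ) ∈ Icc 0 T := left_mem_Icc.2 hT.le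
  have z0 : (0 : ℝ) ∈ Icc (0 : ℝ) 1 := by simp
  have z1 : (1 : ℝ) ∈ Icc (0 : ℝ) 1 := by simp
  unfold innerW
  congr 1
  · congr 1
    · refine Finset.sum_congr rfl fun i _ => intervalIntegral.integral_congr fun t ht => ?_
      rw [uIcc_of_le hT.le] at ht
      simp only [dt_congr (D_congr hf i 2) 0 z0 t ht, dt_congr (D_congr hg i 2) 0 z0 t ht]
    · refine Finset.sum_congr rfl fun j _ => ?_
      have e : ∀ {f f' : ℝ → ℝ → ℝ}, EqOmega T f f' → ∀ x ∈ Icc (0 : ℝ) 1,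
          derivWithin (fun x => D T 0 j f x 0) (Icc 0 1) x =
          derivWithin (fun x => D T 0 j f' x 0) (Icc 0 1) x := fun h x hx =>
        dx_congr (D_congr h 0 j) x hx 0 h0
      unfold inner3
      rw [iteratedDerivWithin_three, iteratedDerivWithin_three, iteratedDerivWithin_three,
        iteratedDerivWithin_three, e hf 0 z0, e hf 1 z1, e hg 0 z0, e hg 1 z1]
      beta_reduce
      rw [D_congr hf 0 j 0 z0 0 h0, D_congr hg 0 j 0 z0 0 h0]
      congr 1
      refine intervalIntegral.integral_congr fun x hx => ?_
      rw [uIcc_of_le zero_le_one] at hx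
      simp only [dx_congr (D_congr hf 2 j) x hx 0 h0, dx_congr (D_congr hg 2 j) x hx 0 h0]
  · refine intervalIntegral.integral_congr fun x hx => intervalIntegral.integral_congr fun t ht => ?_
    rw [uIcc_of_le zero_le_one] at hx
    rw [uIcc_of_le hT.le] at ht
    simp only [dx_congr (dt_congr (D_congr hf 2 2)) x hx t ht,
      dx_congr (dt_congr (D_congr hg 2 2)) x hx t ht]

theorem memHatW_waveOp {T : ℝ} (hT : 0 < T) {w : ℝ → ℝ → ℝ} (hw : MemW T w) :
    MemHatW T (waveOp T w) := by
  obtain ⟨d, hd⟩ := hw.exists_data hT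
  exact (memHatW_waveOp_recon (Data.isL2Primitive_prim hT d) hT).congr hT (EqOmega.waveOp hd)

/-! ### Separating points by test functions -/

section TestFunctions

theorem exists_smooth_localization {g : ℝ → ℝ} (hg : ContDiff ℝ 4 g) (c : ℝ) {ε : ℝ} (hε : 0 < ε) :
    ∃ X : ℝ → ℝ, ContDiff ℝ 4 X ∧ X =ᶠ[𝓝 c] g ∧ ∀ x, ε ≤ |x - c| → X =ᶠ[𝓝 x] fun _ => 0 := by
  -- The outer radius lies strictly below ε, so points at distance ε have a whole neighbourhood on
  -- which the product vanishes.
  let χ : ContDiffBump c := ⟨ε / 4, ε / 2, by positivity, by linarith⟩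
  refine ⟨fun x => χ x * g x, ?_, ?_, fun x hx => ?_⟩
  · exact χ.contDiff.mul hg
  · filter_upwards [χ.eventuallyEq_one] with x hx
    simp [hx]
  · have h1 : ∀ᶠ y in 𝓝 x, ε / 2 < |y - c| :=
      (by fun_prop : Continuous fun y : ℝ => |y - c|).continuousAt.eventually
        (lt_mem_nhds (by linarith))
    filter_upwards [h1] with y hy
    have : χ y = 0 := χ.zero_of_le_dist (by rw [Real.dist_eq]; exact hy.le)
    simp [this]

theorem hasDerivAt_iteratedDeriv {X : ℝ → ℝ} (hX : ContDiff ℝ 4 X) {i : ℕ} (hi : i < 4)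
    (x : ℝ) : HasDerivAt (iteratedDeriv i X) (iteratedDeriv (i + 1) X x) x := by
  rw [iteratedDeriv_succ]
  exact (hX.differentiable_iteratedDeriv i (by exact_mod_cast hi) x).hasDerivAt

theorem isL2Primitive_mul {T : ℝ} {A B A' B' : ℝ → ℝ} (hA : ∀ x, HasDerivAt A (A' x) x)
    (hB : ∀ x, HasDerivAt B (B' x) x) (hA' : Continuous A') (hB' : Continuous B') :
    IsL2Primitive T (fun x t => A x * B t) (fun x => A' x * B 0) (fun t => A 0 * B' t)
      (fun x t => A' x * B' t) where
  a_memLp := memLp_of_continuous (by fun_prop)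
  b_memLp := memLp_of_continuous (by fun_prop)
  h_memLp := by
    have hc : Continuous fun q : ℝ × ℝ => A' q.1 * B' q.2 := by fun_prop
    obtain ⟨C, hC⟩ := (isCompact_Icc.prod isCompact_Icc : IsCompact
      (Icc (0 : ℝ) 1 ×ˢ Icc (0 : ℝ) T)).exists_bound_of_continuousOn hc.continuousOn
    refine (memLp_const C).of_le hc.aestronglyMeasurable ?_
    filter_upwards [ae_restrict_mem (measurableSet_Omega T)] with q hq
    exact (hC q hq).trans (le_abs_self C)
  prim x hx t ht := by
    have e : ∀ {A A' : ℝ → ℝ} (_ : ∀ x, HasDerivAt A (A' x) x) (_ : Continuous A') (x : ℝ),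
        ∫ ξ in (0 : ℝ)..x, A' ξ = A x - A 0 := fun h hc x =>
      intervalIntegral.integral_eq_sub_of_hasDerivAt (fun y _ => h y) (hc.intervalIntegrable _ _)
    simp only [intervalIntegral.integral_mul_const, intervalIntegral.integral_const_mul]
    rw [e hA hA', e hB hB']
    ring

/-- For v = X(x)Θ(t) the operator gives XΘ'' − X''Θ, and the conditions of W(Ω) become conditions on
each factor separately. -/
theorem exists_data_of_mul {T : ℝ} (hT : 0 < T) {X Θ : ℝ → ℝ} (hX : ContDiff ℝ 4 X)
    (hΘ : ContDiff ℝ 4 Θ) (hX0 : X 0 = 0) (hX1 : X 1 = 0) (hΘ0 : Θ 0 = 0)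
    (hΘ1 : iteratedDeriv 1 Θ 0 = 0) : ∃ d : Data T, ∀ x ∈ Icc (0 : ℝ) 1, ∀ t ∈ Icc (0 : ℝ) T,
      Data.waveC hT d (x, t) = X x * iteratedDeriv 2 Θ t - iteratedDeriv 2 X x * Θ t := by
  have hfam : IsDerivFamily T (fun i j x t => iteratedDeriv i X x * iteratedDeriv j Θ t) :=
    { deriv_t := fun j hj x _ t _ =>
        ((hasDerivAt_iteratedDeriv hΘ (by omega) t).const_mul _).hasDerivWithinAt
      deriv_x := fun i hi j _ x _ t _ =>
        ((hasDerivAt_iteratedDeriv hX (by omega) x).mul_const _).hasDerivWithinAt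
      initial := fun x _ => by simp [hΘ0, hΘ1]
      boundary := fun t _ => by simp [hX0, hX1] }
  have hc : ∀ {X : ℝ → ℝ}, ContDiff ℝ 4 X → Continuous (iteratedDeriv 3 X) := fun h =>
    continuous_iff_continuousAt.2 fun x => (hasDerivAt_iteratedDeriv h (by norm_num) x).continuousAt
  have h22 : IsL2Primitive T (fun x t => iteratedDeriv 2 X x * iteratedDeriv 2 Θ t) _ _ _ :=
    isL2Primitive_mul (hasDerivAt_iteratedDeriv hX (by norm_num)) (hasDerivAt_iteratedDeriv hΘ (by norm_num)) (hc hX) (hc hΘ)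
  obtain ⟨d, hd⟩ := hfam.exists_data hT (h22.memHatW hT)
  refine ⟨d, fun x hx t ht => ?_⟩
  rw [Data.waveC_apply hT d hx ht, ← EqOmega.waveOp hd x hx t ht]
  unfold waveOp
  rw [hfam.D_eq hT (by norm_num) le_rfl x hx t ht, hfam.D_eq hT le_rfl (by norm_num) x hx t ht]
  simp

theorem iteratedDeriv_eq_zero {X : ℝ → ℝ} {x : ℝ} (h : X =ᶠ[𝓝 x] fun _ => 0) (i : ℕ) :
    iteratedDeriv i X x = 0 := by
  rw [h.iteratedDeriv_eq i]
  simp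

theorem iteratedDeriv_halfSq (c : ℝ) : iteratedDeriv 1 (fun x => (x - c) ^ 2 / 2) c = 0 ∧
    iteratedDeriv 2 (fun x => (x - c) ^ 2 / 2) c = 1 := by
  have h1 : deriv (fun x : ℝ => (x - c) ^ 2 / 2) = fun x => x - c := by
    ext x
    simp
  rw [iteratedDeriv_one, iteratedDeriv_succ', iteratedDeriv_one, h1]
  simp

/-- For finitely many points other than a point `p` of the rectangle that is not one of the corners
at `t = 0`, some `v ∈ W(Ω)` has `L v = 0` at these points but not at `p`. -/
theorem exists_separating_data {T : ℝ} (hT : 0 < T) {p : ℝ × ℝ} (hp : p ∈ Omega T)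
    (hc : p ≠ (0, 0) ∧ p ≠ (1, 0)) {Q : Set (ℝ × ℝ)} (hQ : Q.Finite) (hQΩ : Q ⊆ Omega T)
    (hpQ : p ∉ Q) :
    ∃ d : Data T, Data.waveC hT d p ≠ 0 ∧ ∀ q ∈ Q, Data.waveC hT d q = 0 := by
  obtain ⟨ε₀, hε₀, hball⟩ : ∃ ε > 0, ∀ q ∈ Q, ε ≤ dist q p := by
    obtain ⟨ε, hε, h⟩ := Metric.mem_nhds_iff.1 (hQ.isClosed.isOpen_compl.mem_nhds hpQ)
    exact ⟨ε, hε, fun q hq => not_lt.1 fun hlt => h (Metric.mem_ball.2 hlt) hq⟩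
  have hsq : ∀ c : ℝ, ContDiff ℝ 4 fun x : ℝ => (x - c) ^ 2 / 2 := fun c => by fun_prop
  have hone : ContDiff ℝ 4 fun _ : ℝ => (1 : ℝ) := contDiff_const
  -- In the maximum metric a point of Q is far from p in at least one coordinate, and the
  -- corresponding factor vanishes near it together with its derivatives.
  have hfar : ∀ {X Θ : ℝ → ℝ} {ε : ℝ}, ε ≤ ε₀ →
      (∀ x, ε ≤ |x - p.1| → X =ᶠ[𝓝 x] fun _ => 0) → (∀ x, ε ≤ |x - p.2| → Θ =ᶠ[𝓝 x] fun _ => 0) →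
      ∀ q ∈ Q, X q.1 * iteratedDeriv 2 Θ q.2 - iteratedDeriv 2 X q.1 * Θ q.2 = 0 := by
    intro X Θ ε hε h1 h2 q hq
    have h3 := hε.trans (hball q hq)
    rw [Prod.dist_eq, Real.dist_eq, Real.dist_eq, le_max_iff] at h3
    rcases h3 with h3 | h3
    · have := h1 _ h3
      simp [this.eq_of_nhds, iteratedDeriv_eq_zero this]
    · have := h2 _ h3
      simp [this.eq_of_nhds, iteratedDeriv_eq_zero this]
  -- If 0 < x < 1, then X = 1 and Θ = (t − p.2)²/2 near p give Lv(p) = 1; Θ meets the initial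
  -- conditions even for p.2 = 0. On the lateral sides X must vanish at p, so the roles are
  -- exchanged and Lv(p) = −1; this needs p.2 > 0, hence the exclusion of the corners.
  by_cases hx : 0 < p.1 ∧ p.1 < 1
  · obtain ⟨ε, hε, hε₀', hε1, hε2, hε3⟩ : ∃ ε > 0, ε ≤ ε₀ ∧ ε ≤ p.1 ∧ ε ≤ 1 - p.1 ∧
        (0 < p.2 → ε ≤ p.2) := by
      by_cases ht : 0 < p.2
      · exact ⟨min (min ε₀ p.1) (min (1 - p.1) p.2), by
          simp [hε₀, hx.1, hx.2, ht], by simp, by simp, by simp, by simp⟩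
      · exact ⟨min (min ε₀ p.1) (1 - p.1), by simp [hε₀, hx.1, hx.2], by simp, by simp, by simp,
          fun h => absurd h ht⟩
    obtain ⟨X, hX, hXp, hX0⟩ := exists_smooth_localization hone p.1 hε
    obtain ⟨Θ, hΘ, hΘp, hΘ0⟩ := exists_smooth_localization (hsq p.2) p.2 hε
    have hΘ00 : Θ 0 = 0 ∧ iteratedDeriv 1 Θ 0 = 0 := by
      rcases hp.2.1.eq_or_lt with h0 | h0
      · rw [← h0] at hΘp
        rw [hΘp.eq_of_nhds, hΘp.iteratedDeriv_eq]
        exact ⟨by simp, (iteratedDeriv_halfSq 0).1⟩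
      · have := hΘ0 0 (by simpa [abs_of_pos h0] using hε3 h0)
        exact ⟨this.eq_of_nhds, iteratedDeriv_eq_zero this 1⟩
    obtain ⟨d, hd⟩ := exists_data_of_mul hT hX hΘ
      (hX0 0 (by simpa [abs_of_pos hx.1] using hε1)).eq_of_nhds
      (hX0 1 (by rwa [abs_of_pos (by linarith [hx.2])])).eq_of_nhds hΘ00.1 hΘ00.2
    refine ⟨d, ?_, fun q hq => ?_⟩
    · rw [hd p.1 hp.1 p.2 hp.2, hXp.eq_of_nhds, hXp.iteratedDeriv_eq, hΘp.iteratedDeriv_eq,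
        (iteratedDeriv_halfSq _).2]
      simp [iteratedDeriv_const]
    · rw [hd q.1 (hQΩ hq).1 q.2 (hQΩ hq).2]
      exact hfar hε₀' hX0 hΘ0 q hq
  · have hx' : p.1 = 0 ∨ p.1 = 1 := by
      rcases hp.1.1.eq_or_lt with h | h
      · exact Or.inl h.symm
      · exact Or.inr (le_antisymm hp.1.2 (not_lt.1 fun h' => hx ⟨h, h'⟩))
    have ht : 0 < p.2 := by
      refine lt_of_le_of_ne hp.2.1 fun h => ?_
      rcases hx' with h' | h'
      · exact hc.1 (Prod.ext h' h.symm)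
      · exact hc.2 (Prod.ext h' h.symm)
    obtain ⟨ε, hε, hε₀', hε1, hε2⟩ : ∃ ε > 0, ε ≤ ε₀ ∧ ε ≤ 1 ∧ ε ≤ p.2 :=
      ⟨min ε₀ (min 1 p.2), by simp [hε₀, ht], by simp, by simp, by simp⟩
    obtain ⟨X, hX, hXp, hX0⟩ := exists_smooth_localization (hsq p.1) p.1 hε
    obtain ⟨Θ, hΘ, hΘp, hΘ0⟩ := exists_smooth_localization hone p.2 hε
    have hΘz := hΘ0 0 (by simpa [abs_of_pos ht] using hε2)
    have hXc : X p.1 = 0 := by rw [hXp.eq_of_nhds]; simp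
    have hXends : X 0 = 0 ∧ X 1 = 0 := by
      rcases hx' with h | h
      · rw [h] at hXc hX0
        exact ⟨hXc, (hX0 1 (by simpa using hε1)).eq_of_nhds⟩
      · rw [h] at hXc hX0
        exact ⟨(hX0 0 (by simpa using hε1)).eq_of_nhds, hXc⟩
    obtain ⟨d, hd⟩ := exists_data_of_mul hT hX hΘ hXends.1 hXends.2 hΘz.eq_of_nhds
      (iteratedDeriv_eq_zero hΘz 1)
    refine ⟨d, ?_, fun q hq => ?_⟩
    · rw [hd p.1 hp.1 p.2 hp.2, hXc, hXp.iteratedDeriv_eq, (iteratedDeriv_halfSq _).2,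
        hΘp.eq_of_nhds]
      simp
    · rw [hd q.1 (hQΩ hq).1 q.2 (hQΩ hq).2]
      exact hfar hε₀' hX0 hΘ0 q hq

end TestFunctions

/-! ### Existence of the scheme -/

theorem exists_strongRec {α : Type*} [Inhabited α] (f : ℕ → (ℕ → α) → α)
    (hf : ∀ i g g', (∀ k < i, g k = g' k) → f i g = f i g') : ∃ g : ℕ → α, ∀ i, g i = f i g := by
  -- The value `default` fills the positions from n on, to which `f n` is insensitive by `hf`.
  let g : ℕ → α := fun n => Nat.strongRecOn (motive := fun _ => α) n
    fun n ih => f n fun k => if h : k < n then ih k h else default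
  refine ⟨g, fun i => ?_⟩
  have h1 : g i = f i fun k => if k < i then g k else default := by
    simp only [g]
    rw [Nat.strongRecOn_eq]
    simp
  rw [h1]
  exact hf i _ _ fun k hk => by simp [hk]

theorem residual_congr {T : ℝ} {Ψ g g' : ℕ → ℝ → ℝ → ℝ} {i : ℕ} (h : ∀ k < i, g k = g' k) :
    residual T Ψ g i = residual T Ψ g' i := by
  unfold residual
  congr 1
  exact Finset.sum_congr rfl fun k hk => by rw [h k (Finset.mem_range.1 hk)]

theorem isAdjointImage_of_data {T : ℝ} (hT : 0 < T) {q : ℝ × ℝ} (hq : q ∈ Omega T) {e : Data T}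
    (he : ∀ d, ⟪Data.embed hT d, Data.embed hT e⟫_ℝ = Data.waveC hT d q) :
    IsAdjointImage T (kernelG q) (e.toFun hT) := by
  refine ⟨Data.memW_toFun hT e, fun v hv => ?_⟩
  obtain ⟨d, hd⟩ := hv.exists_data hT
  rw [innerHatW_kernelG hT (memHatW_waveOp hT hv) hq, EqOmega.waveOp hd q.1 hq.1 q.2 hq.2,
    ← Data.waveC_apply hT d hq.1 hq.2, innerW_congr hT hd (fun _ _ _ _ => rfl),
    ← Data.inner_embed, he]

theorem IsAdjointImage.innerW_eq {T : ℝ} (hT : 0 < T) {q : ℝ × ℝ} (hq : q ∈ Omega T)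
    {Ψ v : ℝ → ℝ → ℝ} (h : IsAdjointImage T (kernelG q) Ψ) (hv : MemW T v) :
    innerW T v Ψ = waveOp T v q.1 q.2 := by
  rw [h.2 v hv, innerHatW_kernelG hT (memHatW_waveOp hT hv) hq]

theorem nonempty_scheme {T : ℝ} (hT : 0 < T) (M : ℝ → ℝ → ℝ → ℝ) {p : ℕ → ℝ × ℝ}
    (hp : ∀ i, p i ∈ Omega T) : Nonempty (Scheme T M p) := by
  choose e he using fun i => Data.exists_adjoint hT (hp i)
  let Ψ : ℕ → ℝ → ℝ → ℝ := fun i => (e i).toFun hT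
  obtain ⟨Ψhat, hΨhat⟩ := exists_strongRec
    (fun i g => (normW T (residual T Ψ g i))⁻¹ • residual T Ψ g i)
    (fun i g g' h => by rw [residual_congr h])
  have hspan : ∀ i, Ψhat i ∈ Submodule.span ℝ (Ψ '' (Finset.range (i + 1) : Set ℕ)) := by
    intro i
    induction i using Nat.strong_induction_on with
    | _ i ih =>
      rw [hΨhat i]
      refine Submodule.smul_mem _ _ (Submodule.sub_mem _ (Submodule.subset_span ⟨i, by simp, rfl⟩)
        (Submodule.sum_mem _ fun k hk => Submodule.smul_mem _ _ ?_))
      have hki := Finset.mem_range.1 hk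
      refine Submodule.span_mono (image_mono ?_) (ih k hki)
      exact_mod_cast Finset.range_subset_range.2 (by omega)
  have hβ : ∀ i, ∃ b : ℕ → ℝ, ∑ k ∈ Finset.range (i + 1), b k • Ψ k = Ψhat i := by
    intro i
    obtain ⟨c, hc⟩ := (Submodule.mem_span_image_finset_iff_exists_fun ℝ).1 (hspan i)
    refine ⟨fun k => if h : k ∈ Finset.range (i + 1) then c ⟨k, h⟩ else 0, ?_⟩
    rw [← hc, ← Finset.sum_coe_sort]
    exact Finset.sum_congr rfl fun k _ => by simp only [dif_pos k.2]
  choose β hβ using hβ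
  -- The recursion is well founded: B_i involves u_k with k ≤ i, and u_k contains only B_l with l <
  -- k.
  obtain ⟨B, hB⟩ := exists_strongRec (fun i g => ∑ k ∈ Finset.range (i + 1),
      β i k * M (p k).1 (p k).2 ((∑ l ∈ Finset.range k, g l • Ψhat l) (p k).1 (p k).2))
    (fun i g g' h => Finset.sum_congr rfl fun k hk => by
      have : ∑ l ∈ Finset.range k, g l • Ψhat l = ∑ l ∈ Finset.range k, g' l • Ψhat l :=
        Finset.sum_congr rfl fun l hl => by
          rw [h l (by have := Finset.mem_range.1 hk; have := Finset.mem_range.1 hl; omega)]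
      rw [this])
  exact ⟨{
    Ψ := Ψ
    Ψhat := Ψhat
    β := β
    B := B
    u := fun n => ∑ i ∈ Finset.range n, B i • Ψhat i
    adjoint_eq := fun i => isAdjointImage_of_data hT (hp i) (he i)
    gramSchmidt_eq := hΨhat
    coeff_eq := fun i x _ t _ => by
      rw [← hβ i]
      simp [Finset.sum_apply]
    B_eq := hB
    u_eq := fun n => rfl }⟩

/-! ### Orthogonal series -/

section Orthogonal

variable {H : Type*} [NormedAddCommGroup H] [InnerProductSpace ℝ H]

/-- The usual induction survives degenerate steps: each vector is either zero or a unit vector, and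
subtracting the component along it yields orthogonality in both cases. -/
theorem inner_eq_zero_of_gramSchmidt {z e : ℕ → H}
    (he : ∀ i, e i = ‖z i - ∑ k ∈ Finset.range i, ⟪z i, e k⟫_ℝ • e k‖⁻¹ •
      (z i - ∑ k ∈ Finset.range i, ⟪z i, e k⟫_ℝ • e k)) :
    ∀ i, ∀ k < i, ⟪e i, e k⟫_ℝ = 0 := by
  have hnorm : ∀ i, e i = 0 ∨ ⟪e i, e i⟫_ℝ = 1 := by
    intro i
    rw [real_inner_self_eq_norm_sq]
    set r := z i - ∑ k ∈ Finset.range i, ⟪z i, e k⟫_ℝ • e k with hr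
    by_cases h0 : r = 0
    · left; rw [he i, ← hr, h0, smul_zero]
    · right; rw [he i, ← hr, norm_smul, norm_inv, norm_norm,
        inv_mul_cancel₀ (norm_ne_zero_iff.2 h0), one_pow]
  intro i
  induction i using Nat.strong_induction_on with
  | _ i ih =>
    intro k hk
    have horth : ∀ l < i, l ≠ k → ⟪e l, e k⟫_ℝ = 0 := fun l hl hlk => by
      rcases lt_or_gt_of_ne hlk with h | h
      · rw [real_inner_comm]; exact ih k hk l h
      · exact ih l hl k h
    have hsum : ∑ l ∈ Finset.range i, ⟪⟪z i, e l⟫_ℝ • e l, e k⟫_ℝ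
        = ⟪⟪z i, e k⟫_ℝ • e k, e k⟫_ℝ :=
      Finset.sum_eq_single_of_mem k (Finset.mem_range.2 hk) fun l hl hlk => by
        rw [real_inner_smul_left, horth l (Finset.mem_range.1 hl) hlk, mul_zero]
    rw [he i, real_inner_smul_left, inner_sub_left, sum_inner, hsum, real_inner_smul_left]
    rcases hnorm k with h | h
    · simp [h]
    · rw [h, mul_one, sub_self, mul_zero]

theorem norm_sq_sum_of_orthogonal {z : ℕ → H} (hz : ∀ i k, i ≠ k → ⟪z i, z k⟫_ℝ = 0)
    (s : Finset ℕ) : ‖∑ i ∈ s, z i‖ ^ 2 = ∑ i ∈ s, ‖z i‖ ^ 2 := by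
  rw [← real_inner_self_eq_norm_sq, sum_inner]
  refine Finset.sum_congr rfl fun i hi => ?_
  rw [inner_sum, Finset.sum_eq_single_of_mem i hi fun k _ hk => hz i k hk.symm,
    real_inner_self_eq_norm_sq]

/-- By Pythagoras the bounded partial sums make the squared norms summable. Pythagoras again, for
arbitrary finite index sets, gives the Cauchy condition for the images, and the lower bound on J
carries it back to the complete space E. -/
theorem summable_of_orthogonal {E : Type*} [NormedAddCommGroup E] [NormedSpace ℝ E]
    [CompleteSpace E] (J : E →L[ℝ] H) {C : NNReal} (hJ : ∀ d, ‖d‖ ≤ C * ‖J d‖) {y : ℕ → E}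
    (hy : ∀ i k, i ≠ k → ⟪J (y i), J (y k)⟫_ℝ = 0) {R : ℝ}
    (hR : ∀ n, ‖J (∑ i ∈ Finset.range n, y i)‖ ≤ R) : Summable y := by
  have hsum : Summable fun i => ‖J (y i)‖ ^ 2 := by
    refine summable_of_sum_range_le (c := R ^ 2) (fun _ => sq_nonneg _) fun n => ?_
    rw [← norm_sq_sum_of_orthogonal hy, ← map_sum]
    exact pow_le_pow_left₀ (norm_nonneg _) (hR n) 2
  rw [summable_iff_vanishing_norm]
  intro ε hε
  -- Dividing by C + 1 instead of C avoids the case C = 0.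
  obtain ⟨s, hs⟩ := summable_iff_vanishing_norm.1 hsum ((ε / (C + 1)) ^ 2) (by positivity)
  refine ⟨s, fun t ht => ?_⟩
  have h1 := hs t ht
  rw [Real.norm_of_nonneg (Finset.sum_nonneg fun _ _ => sq_nonneg _),
    ← norm_sq_sum_of_orthogonal hy, ← map_sum] at h1
  have h2 : ‖J (∑ i ∈ t, y i)‖ < ε / (C + 1) := lt_of_pow_lt_pow_left₀ 2 (by positivity) h1
  rw [lt_div_iff₀ (by positivity)] at h2
  have h3 := hJ (∑ i ∈ t, y i)
  nlinarith [norm_nonneg (J (∑ i ∈ t, y i))]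

end Orthogonal

/-- If a neighbourhood of q contained only points of bounded index, a nonempty open subset of Ω
would lie in the closure of a finite set. Points on the boundary of Ω are reached through the
interior. -/
theorem mapClusterPt_of_dense {T : ℝ} (hT : 0 < T) {p : ℕ → ℝ × ℝ}
    (hdense : Omega T ⊆ closure (range p)) {q : ℝ × ℝ} (hq : q ∈ Omega T) :
    MapClusterPt q atTop p := by
  rw [mapClusterPt_iff_frequently]
  intro U hU hev
  obtain ⟨V, hVU, hVo, hqV⟩ := mem_nhds_iff.1 hU
  obtain ⟨N, hN⟩ := eventually_atTop.1 hev
  have hcl : Omega T ⊆ closure (interior (Omega T)) := by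
    rw [Omega, interior_prod_eq, closure_prod_eq, interior_Icc, interior_Icc,
      closure_Ioo zero_ne_one, closure_Ioo hT.ne]
  obtain ⟨y, hyV, hyi⟩ := mem_closure_iff.1 (hcl hq) V hVo hqV
  have hopen : V ∩ interior (Omega T) ∈ 𝓝 y := (hVo.inter isOpen_interior).mem_nhds ⟨hyV, hyi⟩
  have hfin : (p '' Iio N).Finite := (finite_Iio N).image p
  refine infinite_of_mem_nhds y hopen (hfin.subset fun z hz => ?_)
  have h1 : z ∈ closure (V ∩ range p) :=
    hVo.inter_closure ⟨hz.1, hdense (interior_subset hz.2)⟩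
  have h2 : V ∩ range p ⊆ p '' Iio N := by
    rintro _ ⟨hw, i, rfl⟩
    refine ⟨i, ?_, rfl⟩
    by_contra hi
    exact hN i (not_lt.1 hi) (hVU hw)
  exact hfin.isClosed.closure_subset_iff.2 h2 h1

/-! ### Translation between functions and data -/

section Represent

variable {T : ℝ} (hT : 0 < T)

theorem Data.toFun_sub (d e : Data T) : (d - e).toFun hT = d.toFun hT - e.toFun hT := by
  funext x t
  exact congrArg (fun f : C(ℝ × ℝ, ℝ) => f (x, t)) (map_sub (Data.toC hT) d e)

theorem Data.toFun_smul (c : ℝ) (d : Data T) : (c • d).toFun hT = c • d.toFun hT := by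
  funext x t
  exact congrArg (fun f : C(ℝ × ℝ, ℝ) => f (x, t)) (map_smul (Data.toC hT) c d)

theorem Data.toFun_sum (s : Finset ℕ) (d : ℕ → Data T) :
    (∑ i ∈ s, d i).toFun hT = ∑ i ∈ s, (d i).toFun hT := by
  funext x t
  have h := congrArg (fun f : C(ℝ × ℝ, ℝ) => f (x, t)) (map_sum (Data.toC hT) d s)
  simp only [ContinuousMap.coe_sum, Finset.sum_apply, Data.toC_apply] at h ⊢
  exact h

theorem EqOmega.sub {f f' g g' : ℝ → ℝ → ℝ} (hf : EqOmega T f f') (hg : EqOmega T g g') :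
    EqOmega T (f - g) (f' - g') := fun x hx t ht => by
  simp only [Pi.sub_apply, hf x hx t ht, hg x hx t ht]

theorem EqOmega.smul {f f' : ℝ → ℝ → ℝ} (c : ℝ) (hf : EqOmega T f f') :
    EqOmega T (c • f) (c • f') := fun x hx t ht => by
  simp only [Pi.smul_apply, hf x hx t ht]

theorem EqOmega.sum {s : Finset ℕ} {f f' : ℕ → ℝ → ℝ → ℝ} (hf : ∀ i ∈ s, EqOmega T (f i) (f' i)) :
    EqOmega T (∑ i ∈ s, f i) (∑ i ∈ s, f' i) := fun x hx t ht => by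
  simp only [Finset.sum_apply]
  exact Finset.sum_congr rfl fun i hi => hf i hi x hx t ht

theorem innerW_eq_inner_embed {f g : ℝ → ℝ → ℝ} {d e : Data T} (hf : EqOmega T f (d.toFun hT))
    (hg : EqOmega T g (e.toFun hT)) :
    innerW T f g = ⟪Data.embed hT d, Data.embed hT e⟫_ℝ := by
  rw [innerW_congr hT hf hg, Data.inner_embed]

theorem normW_eq_norm_embed {f : ℝ → ℝ → ℝ} {d : Data T} (hf : EqOmega T f (d.toFun hT)) :
    normW T f = ‖Data.embed hT d‖ := by
  rw [normW, innerW_eq_inner_embed hT hf hf, real_inner_self_eq_norm_sq,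
    Real.sqrt_sq (norm_nonneg _)]

/-- The W-norm depends only on the values on Ω and controls the data, so identities between
functions on Ω lift to identities of data. -/
theorem Data.eq_of_eqOmega {d e : Data T} (h : EqOmega T (d.toFun hT) (e.toFun hT)) : d = e := by
  have h1 : EqOmega T ((d - e).toFun hT) ((e - e).toFun hT) := by
    rw [toFun_sub, toFun_sub]
    exact h.sub fun _ _ _ _ => rfl
  have h2 := normW_eq_norm_embed hT h1
  rw [normW_eq_norm_embed hT (d := d - e) fun _ _ _ _ => rfl, sub_self, map_zero, norm_zero] at h2
  have h3 := norm_le_embed hT (d - e)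
  rw [h2, mul_zero] at h3
  exact sub_eq_zero.1 (norm_le_zero_iff.1 h3)

/-- For t = 0 the double t-primitive drops out, and the Green operator vanishes at both ends. -/
theorem Data.waveC_corner (d : Data T) {q : ℝ × ℝ} (hq : q = (0, 0) ∨ q = (1, 0)) :
    waveC hT d q = 0 := by
  have h : ∀ x : ℝ, waveC hT d (x, 0) = SineGordon.greenC (prim hT d) (x, 0) := fun x => by
    change SineGordon.greenC (prim hT d) (x, 0) - SineGordon.primTC _ (x, 0) = _
    rw [primTC_zero, sub_zero]
  rcases hq with rfl | rfl
  · rw [h, greenC_zero]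
  · rw [h, greenC_one]

end Represent

/-! ### Convergence of the scheme -/

/-- Data that represent the functions `Ψ_i` and `Ψ̂_i` of a scheme. -/
structure SchemeData {T : ℝ} (hT : 0 < T) {M : ℝ → ℝ → ℝ → ℝ} {p : ℕ → ℝ × ℝ}
    (S : Scheme T M p) where
  ψ : ℕ → Data T
  e : ℕ → Data T
  Ψhat_eq : ∀ i, EqOmega T (S.Ψhat i) ((e i).toFun hT)
  e_eq_sum : ∀ i, e i = ∑ k ∈ Finset.range (i + 1), S.β i k • ψ k
  e_eq_residual : ∀ i, e i =
    ‖Data.embed hT (ψ i) - ∑ k ∈ Finset.range i,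
        ⟪Data.embed hT (ψ i), Data.embed hT (e k)⟫_ℝ • Data.embed hT (e k)‖⁻¹ •
      (ψ i - ∑ k ∈ Finset.range i, ⟪Data.embed hT (ψ i), Data.embed hT (e k)⟫_ℝ • e k)
  inner_ψ : ∀ i d, ⟪Data.embed hT d, Data.embed hT (ψ i)⟫_ℝ = Data.waveC hT d (p i)

variable {T : ℝ} {M : ℝ → ℝ → ℝ → ℝ} {p : ℕ → ℝ × ℝ}

theorem nonempty_schemeData (hT : 0 < T) (hp : ∀ i, p i ∈ Omega T) (S : Scheme T M p) :
    Nonempty (SchemeData hT S) := by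
  choose ψ hψ using fun i => (S.adjoint_eq i).1.exists_data hT
  have hψ : ∀ i, EqOmega T (S.Ψ i) ((ψ i).toFun hT) := hψ
  -- Built from the coefficients β, so that the expansion holds by definition; the Gram–Schmidt
  -- recursion is then lifted from the functions on Ω.
  let e : ℕ → Data T := fun i => ∑ k ∈ Finset.range (i + 1), S.β i k • ψ k
  have he : ∀ i, EqOmega T (S.Ψhat i) ((e i).toFun hT) := fun i x hx t ht => by
    simp only [e, Data.toFun_sum, Data.toFun_smul, Finset.sum_apply, Pi.smul_apply, smul_eq_mul]
    rw [S.coeff_eq i x hx t ht]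
    exact Finset.sum_congr rfl fun k _ => by rw [hψ k x hx t ht]
  have hres : ∀ i, EqOmega T (residual T S.Ψ S.Ψhat i)
      ((ψ i - ∑ k ∈ Finset.range i,
        ⟪Data.embed hT (ψ i), Data.embed hT (e k)⟫_ℝ • e k).toFun hT) := fun i => by
    simp only [residual, Data.toFun_sub, Data.toFun_sum, Data.toFun_smul]
    refine (hψ i).sub (EqOmega.sum fun k _ => ?_)
    rw [innerW_eq_inner_embed hT (hψ i) (he k)]
    exact (he k).smul _
  refine ⟨⟨ψ, e, he, fun _ => rfl, fun i => ?_, fun i d => ?_⟩⟩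
  · refine Data.eq_of_eqOmega hT fun x hx t ht => ?_
    rw [← he i x hx t ht, S.gramSchmidt_eq i, normW_eq_norm_embed hT (hres i), Data.toFun_smul,
      map_sub, map_sum]
    simp only [map_smul]
    exact (hres i).smul _ x hx t ht
  · rw [Data.inner_embed, ← innerW_congr hT (fun _ _ _ _ => rfl) (hψ i),
      (S.adjoint_eq i).innerW_eq hT (hp i) (Data.memW_toFun hT d),
      ← Data.waveC_apply hT d (hp i).1 (hp i).2]

/-- Point evaluation is bounded by the norm of the data with one constant for all of Ω. -/
theorem tendstoUniformlyOn_toFun {hT : 0 < T} {ι : Type*} {l : Filter ι} {y : ι → Data T} {d : Data T}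
    (h : Tendsto y l (𝓝 d)) :
    TendstoUniformlyOn (fun n (q : ℝ × ℝ) => (y n).toFun hT q.1 q.2)
      (fun q => d.toFun hT q.1 q.2) l (Omega T) := by
  obtain ⟨C, hC, hb⟩ := Data.unifBdd_toC hT
  rw [Metric.tendstoUniformlyOn_iff]
  intro ε hε
  have h1 : Tendsto (fun n => C * ‖d - y n‖) l (𝓝 0) := by
    have := ((tendsto_const_nhds (x := d)).sub h).norm.const_mul C
    simpa using this
  filter_upwards [h1.eventually (gt_mem_nhds hε)] with n hn q hq
  have h2 := hb (d - y n) q.1 hq.1 q.2 hq.2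
  rw [Data.toC_apply, Data.toFun_sub] at h2
  rw [Real.dist_eq]
  exact h2.trans_lt hn

namespace SchemeData

variable {hT : 0 < T} {S : Scheme T M p} (R : SchemeData hT S)

theorem embed_e_eq (i : ℕ) : Data.embed hT (R.e i) =
    ‖Data.embed hT (R.ψ i) - ∑ k ∈ Finset.range i,
        ⟪Data.embed hT (R.ψ i), Data.embed hT (R.e k)⟫_ℝ • Data.embed hT (R.e k)‖⁻¹ •
      (Data.embed hT (R.ψ i) - ∑ k ∈ Finset.range i,
        ⟪Data.embed hT (R.ψ i), Data.embed hT (R.e k)⟫_ℝ • Data.embed hT (R.e k)) := by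
  have h := congrArg (Data.embed hT) (R.e_eq_residual i)
  rw [map_smul, map_sub, map_sum] at h
  simp only [map_smul] at h
  exact h

theorem inner_e_of_ne {i k : ℕ} (h : i ≠ k) :
    ⟪Data.embed hT (R.e i), Data.embed hT (R.e k)⟫_ℝ = 0 := by
  have h1 : ∀ i, ∀ k < i, ⟪Data.embed hT (R.e i), Data.embed hT (R.e k)⟫_ℝ = 0 :=
    inner_eq_zero_of_gramSchmidt (z := fun i => Data.embed hT (R.ψ i))
      (e := fun i => Data.embed hT (R.e i)) fun i => (R.embed_e_eq i).trans (by congr 1)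
  rcases lt_or_gt_of_ne h with h | h
  · rw [real_inner_comm]; exact h1 k i h
  · exact h1 i k h

theorem inner_e (i : ℕ) (d : Data T) : ⟪Data.embed hT d, Data.embed hT (R.e i)⟫_ℝ =
    ∑ k ∈ Finset.range (i + 1), S.β i k * Data.waveC hT d (p k) := by
  rw [R.e_eq_sum i, map_sum, inner_sum]
  exact Finset.sum_congr rfl fun k _ => by rw [map_smul, real_inner_smul_right, R.inner_ψ]

/-- Away from the corners the function `Ψ_i` is not in the span of its
predecessors, so that the Gram-Schmidt process does not degenerate at step `i`. -/
theorem nondegenerate (hp : ∀ i, p i ∈ Omega T) (hinj : Function.Injective p) {i : ℕ}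
    (hc : p i ≠ (0, 0) ∧ p i ≠ (1, 0)) :
    ⟪Data.embed hT (R.e i), Data.embed hT (R.e i)⟫_ℝ = 1 ∧ S.β i i ≠ 0 := by
  -- The element τ is orthogonal to all earlier vectors and pairs with the residual to Lτ(p i) ≠ 0.
  -- This shows that the residual is nonzero, and the same pairing forces β_ii ≠ 0.
  obtain ⟨τ, hτi, hτ⟩ := exists_separating_data hT (hp i) hc ((finite_Iio i).image p)
    (by rintro _ ⟨k, _, rfl⟩; exact hp k)
    (by rintro ⟨k, hk, hki⟩; exact (ne_of_lt hk) (hinj hki))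
  have hlt : ∀ k < i, Data.waveC hT τ (p k) = 0 := fun k hk => hτ _ ⟨k, hk, rfl⟩
  have he : ∀ k < i, ⟪Data.embed hT τ, Data.embed hT (R.e k)⟫_ℝ = 0 := fun k hk => by
    rw [R.inner_e]
    refine Finset.sum_eq_zero fun l hl => ?_
    rw [hlt l (by have := Finset.mem_range.1 hl; omega), mul_zero]
  have hβ : ⟪Data.embed hT τ, Data.embed hT (R.e i)⟫_ℝ = S.β i i * Data.waveC hT τ (p i) := by
    rw [R.inner_e, Finset.sum_range_succ, Finset.sum_eq_zero, zero_add]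
    intro l hl
    rw [hlt l (Finset.mem_range.1 hl), mul_zero]
  have hei := R.embed_e_eq i
  set r := Data.embed hT (R.ψ i) - ∑ k ∈ Finset.range i,
    ⟪Data.embed hT (R.ψ i), Data.embed hT (R.e k)⟫_ℝ • Data.embed hT (R.e k) with hr
  have hτr : ⟪Data.embed hT τ, r⟫_ℝ = Data.waveC hT τ (p i) := by
    rw [hr, inner_sub_right, R.inner_ψ, inner_sum, Finset.sum_eq_zero, sub_zero]
    intro k hk
    rw [real_inner_smul_right, he k (Finset.mem_range.1 hk), mul_zero]
  have hr0 : r ≠ 0 := fun h => hτi (by rw [← hτr, h, inner_zero_right])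
  have hn : ‖r‖ ≠ 0 := norm_ne_zero_iff.2 hr0
  constructor
  · rw [hei, real_inner_self_eq_norm_sq, norm_smul, norm_inv, norm_norm, inv_mul_cancel₀ hn,
      one_pow]
  · intro h0
    rw [h0, zero_mul, hei, real_inner_smul_right, hτr] at hβ
    exact mul_ne_zero (inv_ne_zero hn) hτi hβ

theorem u_eq (n : ℕ) :
    EqOmega T (S.u n) ((∑ i ∈ Finset.range n, S.B i • R.e i).toFun hT) := by
  rw [S.u_eq n, Data.toFun_sum]
  refine EqOmega.sum fun i _ => ?_
  rw [Data.toFun_smul]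
  exact (R.Ψhat_eq i).smul _

theorem summable (hbdd : ∃ C : ℝ, ∀ n, normW T (S.u n) ≤ C) :
    Summable fun i => S.B i • R.e i := by
  obtain ⟨C, hC⟩ := hbdd
  refine summable_of_orthogonal (Data.embed hT) (Data.norm_le_embed hT) (fun i k hik => ?_)
    (R := C) fun n => ?_
  · rw [map_smul, map_smul, real_inner_smul_left, real_inner_smul_right, R.inner_e_of_ne hik,
      mul_zero, mul_zero]
  · rw [← normW_eq_norm_embed hT (R.u_eq n)]
    exact hC n

/-- The inner product is continuous and only the diagonal term survives. The factor on the right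
remains because Ψ̂_i may be zero. -/
theorem inner_of_hasSum {d : Data T} (hd : HasSum (fun i => S.B i • R.e i) d) (i : ℕ) :
    ⟪Data.embed hT d, Data.embed hT (R.e i)⟫_ℝ =
      S.B i * ⟪Data.embed hT (R.e i), Data.embed hT (R.e i)⟫_ℝ := by
  have h1 := (hd.mapL (Data.embed hT)).mapL (innerSL ℝ (Data.embed hT (R.e i)))
  have h2 := h1.unique (hasSum_single i fun k hk => by
    rw [innerSL_apply_apply, map_smul, real_inner_smul_right, R.inner_e_of_ne hk.symm, mul_zero])
  rw [innerSL_apply_apply, innerSL_apply_apply, map_smul, real_inner_smul_right] at h2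
  rw [real_inner_comm, h2]

/-- The sum of the series solves the problem at every point `p i`, with the iterate `u_i` in the
right-hand side. -/
theorem waveC_point (hp : ∀ i, p i ∈ Omega T) (hinj : Function.Injective p)
    {v : ℝ → ℝ → ℝ} (hv : IsSolution T M v)
    {d : Data T} (hd : HasSum (fun i => S.B i • R.e i) d) (i : ℕ) :
    Data.waveC hT d (p i) = M (p i).1 (p i).2 (S.u i (p i).1 (p i).2) := by
  induction i using Nat.strong_induction_on with
  | _ i ih =>
    -- At the corners Ψ_i = 0 carries no information. There Lv = 0 for all v, and the given
    -- solution, which vanishes at t = 0, shows that M vanishes too.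
    by_cases hc : p i = (0, 0) ∨ p i = (1, 0)
    · have hzero : ∀ d : Data T, d.toFun hT (p i).1 (p i).2 = 0 := fun d => by
        have h := (Data.memW_toFun hT d).initial (p i).1 (hp i).1
        have h0 : (p i).2 = 0 := by rcases hc with hc | hc <;> rw [hc]
        rw [h0, h.1]
      obtain ⟨e, he⟩ := hv.1.exists_data hT
      have h1 := hv.2 _ (hp i).1 _ (hp i).2
      rw [EqOmega.waveOp he _ (hp i).1 _ (hp i).2, he _ (hp i).1 _ (hp i).2,
        ← Data.waveC_apply hT e (hp i).1 (hp i).2, Data.waveC_corner hT e hc, hzero] at h1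
      rw [Data.waveC_corner hT d hc, R.u_eq i _ (hp i).1 _ (hp i).2, hzero, ← h1]
    · push Not at hc
      obtain ⟨hn, hβ⟩ := R.nondegenerate hp hinj hc
      -- Both sides are sums over k ≤ i with weights β_ik; the induction hypothesis cancels k < i
      -- and β_ii ≠ 0 settles the last term.
      have h1 := R.inner_of_hasSum hd i
      rw [hn, mul_one, R.inner_e, S.B_eq, Finset.sum_range_succ, Finset.sum_range_succ,
        Finset.sum_congr rfl fun k hk => by rw [ih k (Finset.mem_range.1 hk)]] at h1
      exact mul_left_cancel₀ hβ (add_left_cancel h1)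

/-- Along indices tending to infinity whose points approach (x, t), the identities at the points p i
pass to the limit. Uniform convergence is needed, since the iterate and the point at which it is
evaluated move together. -/
theorem isSolution_of_hasSum (hM : ContinuousOn (fun q : ℝ × ℝ × ℝ => M q.1 q.2.1 q.2.2)
      (Icc (0 : ℝ) 1 ×ˢ Icc (0 : ℝ) T ×ˢ (univ : Set ℝ)))
    (hp : ∀ i, p i ∈ Omega T) (hinj : Function.Injective p)
    (hdense : Omega T ⊆ closure (range p)) {v : ℝ → ℝ → ℝ} (hv : IsSolution T M v)
    {d : Data T} (hd : HasSum (fun i => S.B i • R.e i) d) : IsSolution T M (d.toFun hT) := by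
  refine ⟨Data.memW_toFun hT d, fun x hx t ht => ?_⟩
  have hq : (x, t) ∈ Omega T := ⟨hx, ht⟩
  obtain ⟨φ, hφ, hlim⟩ := (mapClusterPt_of_dense hT hdense hq).tendsto_subseq
  have hfst : Tendsto (fun n => (p (φ n)).1) atTop (𝓝 x) := (continuous_fst.tendsto _).comp hlim
  have hsnd : Tendsto (fun n => (p (φ n)).2) atTop (𝓝 t) := (continuous_snd.tendsto _).comp hlim
  have hu : Tendsto (fun n => S.u (φ n) (p (φ n)).1 (p (φ n)).2) atTop (𝓝 (d.toFun hT x t)) := by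
    have h1 := tendstoUniformlyOn_toFun (hT := hT) hd.tendsto_sum_nat
    have h2 : TendstoUniformlyOn (fun n (q : ℝ × ℝ) => S.u n q.1 q.2)
        (fun q => d.toFun hT q.1 q.2) atTop (Omega T) :=
      h1.congr (Eventually.of_forall fun n q hq => (R.u_eq n q.1 hq.1 q.2 hq.2).symm)
    have h3 : TendstoUniformlyOn (fun n (q : ℝ × ℝ) => S.u (φ n) q.1 q.2)
        (fun q => d.toFun hT q.1 q.2) atTop (Omega T) := fun U hU =>
      hφ.tendsto_atTop.eventually (h2 U hU)
    exact h3.tendsto_comp (g := fun n => p (φ n)) (x := (x, t))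
      ((Data.toC hT d).continuous.continuousWithinAt)
      (tendsto_nhdsWithin_iff.2 ⟨hlim, Eventually.of_forall fun n => hp _⟩)
  have hR := (hM (x, t, d.toFun hT x t) ⟨hx, ht, trivial⟩).tendsto.comp
    (tendsto_nhdsWithin_iff.2 ⟨hfst.prodMk_nhds (hsnd.prodMk_nhds hu),
      Eventually.of_forall fun n => ⟨(hp _).1, (hp _).2, trivial⟩⟩)
  have hL : Tendsto (fun n => Data.waveC hT d (p (φ n))) atTop (𝓝 (Data.waveC hT d (x, t))) :=
    ((Data.waveC hT d).continuous.tendsto _).comp hlim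
  rw [← Data.waveC_apply hT d hx ht]
  refine tendsto_nhds_unique hL (hR.congr fun n => ?_)
  exact (R.waveC_point hp hinj hv hd (φ n)).symm

end SchemeData

end SineGordon

/-! ### The convergence theorem -/

theorem theorem4p1 (T : ℝ) (hT : 0 < T)
    (M : ℝ → ℝ → ℝ → ℝ)
    (hM : ContinuousOn (fun q : ℝ × ℝ × ℝ => M q.1 q.2.1 q.2.2)
      (Icc (0 : ℝ) 1 ×ˢ Icc (0 : ℝ) T ×ˢ (univ : Set ℝ)))
    (p : ℕ → ℝ × ℝ) (hp : ∀ i, p i ∈ SineGordon.Omega T) (hinj : Function.Injective p)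
    (hdense : SineGordon.Omega T ⊆ closure (range p))
    (v : ℝ → ℝ → ℝ) (hv : SineGordon.IsSolution T M v)
    (huniq : ∀ w, SineGordon.IsSolution T M w →
      ∀ x ∈ Icc (0 : ℝ) 1, ∀ t ∈ Icc (0 : ℝ) T, w x t = v x t) :
    -- the method is well defined: `L` maps `W(Ω)` to `Ŵ(Ω)`, and all its objects exist
    (∀ w, SineGordon.MemW T w → SineGordon.MemHatW T (SineGordon.waveOp T w)) ∧
    Nonempty (SineGordon.Scheme T M p) ∧
    -- if the iterates are bounded, they converge to the solution, which is the sum of the series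
    ∀ S : SineGordon.Scheme T M p, (∃ C : ℝ, ∀ n, SineGordon.normW T (S.u n) ≤ C) →
      Tendsto (fun n => SineGordon.normW T (S.u n - v)) atTop (𝓝 0) ∧
      TendstoUniformlyOn (fun n (q : ℝ × ℝ) => S.u n q.1 q.2) (fun q => v q.1 q.2) atTop
        (SineGordon.Omega T) ∧
      Tendsto (fun s : Finset ℕ => SineGordon.normW T (v - ∑ i ∈ s, S.B i • S.Ψhat i))
        atTop (𝓝 0) ∧
      ∀ x ∈ Icc (0 : ℝ) 1, ∀ t ∈ Icc (0 : ℝ) T, HasSum (fun i => S.B i * S.Ψhat i x t) (v x t) := by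
  refine ⟨fun w hw => SineGordon.memHatW_waveOp hT hw, SineGordon.nonempty_scheme hT M hp,
    fun S hbdd => ?_⟩
  obtain ⟨R⟩ := SineGordon.nonempty_schemeData hT hp S
  obtain ⟨d, hd⟩ := R.summable hbdd
  -- The sum is a solution in its own right; only uniqueness connects it with v.
  have hvd : SineGordon.EqOmega T v (d.toFun hT) := SineGordon.EqOmega.symm
    (huniq _ (R.isSolution_of_hasSum hM hp hinj hdense hv hd))
  have hsum : ∀ s : Finset ℕ, SineGordon.EqOmega T (∑ i ∈ s, S.B i • S.Ψhat i)
      ((∑ i ∈ s, S.B i • R.e i).toFun hT) := fun s => by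
    rw [SineGordon.Data.toFun_sum]
    refine SineGordon.EqOmega.sum fun i _ => ?_
    rw [SineGordon.Data.toFun_smul]
    exact (R.Ψhat_eq i).smul _
  have hnet : Tendsto (fun s : Finset ℕ => SineGordon.normW T (v - ∑ i ∈ s, S.B i • S.Ψhat i))
      atTop (𝓝 0) := by
    have h1 : ∀ s : Finset ℕ, SineGordon.normW T (v - ∑ i ∈ s, S.B i • S.Ψhat i) =
        ‖SineGordon.Data.embed hT (d - ∑ i ∈ s, S.B i • R.e i)‖ := fun s => by
      refine SineGordon.normW_eq_norm_embed hT ?_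
      rw [SineGordon.Data.toFun_sub]
      exact hvd.sub (hsum s)
    simp only [h1]
    have h2 : Tendsto (fun s : Finset ℕ => d - ∑ i ∈ s, S.B i • R.e i) atTop (𝓝 (d - d)) :=
      tendsto_const_nhds.sub hd
    have h3 := (((SineGordon.Data.embed hT).continuous.tendsto _).comp h2).norm
    simpa using h3
  refine ⟨?_, ?_, hnet, fun x hx t ht => ?_⟩
  · have h1 : ∀ n, SineGordon.normW T (S.u n - v) =
        ‖SineGordon.Data.embed hT (∑ i ∈ Finset.range n, S.B i • R.e i - d)‖ := fun n => by
      refine SineGordon.normW_eq_norm_embed hT ?_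
      rw [SineGordon.Data.toFun_sub]
      exact (R.u_eq n).sub hvd
    simp only [h1]
    have h2 : Tendsto (fun n => ∑ i ∈ Finset.range n, S.B i • R.e i - d) atTop (𝓝 (d - d)) :=
      hd.tendsto_sum_nat.sub tendsto_const_nhds
    have h3 := (((SineGordon.Data.embed hT).continuous.tendsto _).comp h2).norm
    simpa using h3
  · refine ((SineGordon.tendstoUniformlyOn_toFun hd.tendsto_sum_nat).congr
      (Eventually.of_forall fun n q hq => (R.u_eq n q.1 hq.1 q.2 hq.2).symm)).congr_right ?_
    exact fun q hq => (hvd q.1 hq.1 q.2 hq.2).symm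
  -- Evaluation at (x, t) is a continuous functional on the data and so preserves the unconditional
  -- sum.
  · obtain ⟨l, hl⟩ := (SineGordon.Data.unifBdd_toC hT).exists_clm hx ht
    have h1 := hd.mapL l
    simp only [hl, SineGordon.Data.toC_apply] at h1
    rw [hvd x hx t ht]
    convert h1 using 2 with i
    rw [SineGordon.Data.toFun_smul, R.Ψhat_eq i x hx t ht]
    rfl
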